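/- **Setting.** Let $U$ be an unknown unitary on $\mathbb C^d$, and let $|\phi_1^{\rm in}\rangle,\dots,|\phi_K^{\rm in}\rangle\in\mathbb C^d$ be unknown unit vectors, $|\phi_i^{\rm out}\rangle=U|\phi_i^{\rm in}\rangle$. Let $\mathcal H_{\rm in}=\mathrm{span}\{|\phi_i^{\rm in}\rangle\}$ and $d_{\rm eff}=\dim\mathcal H_{\rm in}$. Assume that the complex associative algebra generated by the projectors $|\phi_i^{\rm in}\rangle\langle\phi_i^{\rm in}|$ is the algebra of all operators supported on $\mathcal H_{\rm in}$. Let $P_\perp$ be the projector onto the orthogonal complement of $|\phi_1^{\rm in}\rangle$ in $\mathcal H_{\rm in}$, let $A_k=P_\perp-2P_\perp|\phi_k^{\rm in}\rangle\langle\phi_k^{\rm in}|P_\perp$, and let $\lambda_\perp$ be the largest eigenvalue of $\frac1{K-1}\sum_{k=2}^K A_k\otimes A_k^*$ on $\mathbb C^d\otimes\mathbb C^d$ (this operator is taken to be $0$ if $K=1$). **Algorithms.** $\mathbb C^d$ is encoded in $\lceil\log_2 d\rceil$ qubits by the binary encoding of its basis. A circuit starts with one copy of the state $\rho$ in its main register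 and all other qubits in $|0\rangle$. It is a finite sequence of steps of the following kinds: arbitrary one- and two-qubit gates; replacing an ancilla qubit by a fresh $|0\rangle$; replacing the content of a register by a fresh copy of some $|\phi_i^{\rm in}\rangle$ or $|\phi_i^{\rm out}\rangle$. At the end the observable $O$ is measured once on the main register, the ancilla qubits are measured in the computational basis, and a real number is computed from the outcomes. A random circuit is a probability distribution on finitely many circuits. The estimate is the mean of the numbers returned by $N$ independent shots, each of which draws a circuit at random and runs it once; $N$ is the number of measurements. **Theorem S4.** Under the assumptions above, $0\le\lambda_\perp<1$. Moreover, there is a universal constant $C>0$, and for every $\delta\in(0,1)$ a constant $C'>0$ depending only on $\delta$, such that the following holds. Let $d$, $K\ge1$, $d_{\rm eff}$, $\Lambda\in[0,1)$, $\varepsilon>0$ and a Hermitian $d\times d$ matrix $O$ (with operator norm $\|O\|$) be given. Then there are $T,N\in\mathbb N$ and a random circuit, depending only on these data and $\delta$, with $$T\le \frac{C}{1-\Lambda}\max\Big\{1,\log\frac{\|O\|^2d_{\rm eff}}{\varepsilon^2}\Big\},\qquad N\le C'\max\Big\{1,\frac{\|O\|^2}{\varepsilon^2}\Big\}$$ (the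 logarithm being read as $0$ if its argument is $0$), in which every circuit uses at most $C\,T^2$ copies of input and output states and at most $C\,T^2\log d$ one- and two-qubit gates, and such that the following is true. For all $U$ and $|\phi_i^{\rm in}\rangle$ as above with $\dim\mathcal H_{\rm in}=d_{\rm eff}$ and $\lambda_\perp\le\Lambda$ (in particular for $\Lambda=\lambda_\perp$), and for every density matrix $\rho$ supported on $\mathcal H_{\rm in}$, the estimate is within $\varepsilon$ of $\mathrm{tr}[OU\rho U^\dagger]$ with probability at least $1-\delta$. -/

import Mathlib

open scoped Matrix Kronecker ComplexOrder
open MeasureTheory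

namespace UQE

noncomputable section

/-! ### States, observables and the input data -/

/-- The rank-one operator `|v⟩⟨v|`. -/
def ketbra {d : ℕ} (v : EuclideanSpace ℂ (Fin d)) : Matrix (Fin d) (Fin d) ℂ :=
  Matrix.vecMulVec v.ofLp (star v.ofLp)

/-- The matrix of the orthogonal projection onto a subspace of `ℂ^d`. -/
def projMatrix {d : ℕ} (H : Submodule ℂ (EuclideanSpace ℂ (Fin d))) :
    Matrix (Fin d) (Fin d) ℂ :=
  (Matrix.toEuclideanCLM (n := Fin d) (𝕜 := ℂ)).symm H.starProjection

/-- `L(H)`: the operators on `ℂ^d` supported on the subspace `H`, that is, vanishing on `Hᗮ` and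
with range in `H`. -/
def operatorsOn {d : ℕ} (H : Submodule ℂ (EuclideanSpace ℂ (Fin d))) :
    Set (Matrix (Fin d) (Fin d) ℂ) :=
  {X | projMatrix H * X * projMatrix H = X}

/-- The operator (spectral) norm of a matrix acting on the Hilbert space `ℂ^d`. -/
def opNorm {d : ℕ} (X : Matrix (Fin d) (Fin d) ℂ) : ℝ :=
  ‖Matrix.toEuclideanCLM (n := Fin d) (𝕜 := ℂ) X‖

/-- A density matrix. -/
def IsDensity {d : ℕ} (ρ : Matrix (Fin d) (Fin d) ℂ) : Prop :=
  ρ.PosSemidef ∧ ρ.trace = 1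

/-- The span `H_in` of the input states. -/
def inputSpace {d K : ℕ} (φ : Fin (K + 1) → EuclideanSpace ℂ (Fin d)) :
    Submodule ℂ (EuclideanSpace ℂ (Fin d)) :=
  Submodule.span ℂ (Set.range φ)

/-- The condition for emulation: the complex associative algebra generated by the input states
(as rank-one projectors) is the algebra of all operators supported on their span. -/
def GeneratesFullAlgebra {d K : ℕ} (φ : Fin (K + 1) → EuclideanSpace ℂ (Fin d)) : Prop :=
  (NonUnitalAlgebra.adjoin ℂ (Set.range fun i => ketbra (φ i)) :
    Set (Matrix (Fin d) (Fin d) ℂ)) = operatorsOn (inputSpace φ)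

/-- `P_⊥`, the projector onto the part of `H_in` orthogonal to the reference state `φ 0`. -/
def perpProj {d K : ℕ} (φ : Fin (K + 1) → EuclideanSpace ℂ (Fin d)) :
    Matrix (Fin d) (Fin d) ℂ :=
  projMatrix (inputSpace φ ⊓ (Submodule.span ℂ {φ 0})ᗮ)

/-- `A_k = P_⊥ - 2 P_⊥ |φ_k⟩⟨φ_k| P_⊥`. -/
def perpReflection {d K : ℕ} (φ : Fin (K + 1) → EuclideanSpace ℂ (Fin d)) (k : Fin (K + 1)) :
    Matrix (Fin d) (Fin d) ℂ :=
  perpProj φ - (2 : ℂ) • (perpProj φ * ketbra (φ k) * perpProj φ)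

/-- The average of `A_k ⊗ A_k^*` over the non-reference inputs (`^*` is the entrywise complex
conjugate). There are `K + 1` inputs in total, `K` of them different from the reference. -/
def perpOperator {d K : ℕ} (φ : Fin (K + 1) → EuclideanSpace ℂ (Fin d)) :
    Matrix (Fin d × Fin d) (Fin d × Fin d) ℂ :=
  (K : ℂ)⁻¹ • ∑ k : Fin K,
    perpReflection φ k.succ ⊗ₖ (perpReflection φ k.succ).map (starRingEnd ℂ)

/-- `λ_⊥`, the largest eigenvalue of the (Hermitian) operator `perpOperator φ`. -/
def lambdaPerp {d K : ℕ} (φ : Fin (K + 1) → EuclideanSpace ℂ (Fin d)) : ℝ :=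
  sSup {μ : ℝ | Module.End.HasEigenvalue (Matrix.toLin' (perpOperator φ)) (μ : ℂ)}

/-! ### Encoding of `ℂ^d` into qubits -/

/-- The number `⌈log₂ d⌉` of qubits that carry a `d`-dimensional system. -/
def numQubits (d : ℕ) : ℕ := Nat.clog 2 d

/-- The binary encoding of a basis label of `ℂ^d`. -/
def encode {d : ℕ} (i : Fin d) : Fin (numQubits d) → Fin 2 :=
  finFunctionFinEquiv.symm (Fin.castLE (Nat.le_pow_clog Nat.one_lt_two d) i)

/-- The isometry `ℂ^d → (ℂ²)^{⊗ numQubits d}` given by the binary encoding. -/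
def encodeMatrix (d : ℕ) : Matrix (Fin (numQubits d) → Fin 2) (Fin d) ℂ :=
  fun b i => if b = encode i then 1 else 0

/-- An operator on `ℂ^d` seen as an operator on the qubits (zero off the code space). -/
def encodeOp {d : ℕ} (X : Matrix (Fin d) (Fin d) ℂ) :
    Matrix (Fin (numQubits d) → Fin 2) (Fin (numQubits d) → Fin 2) ℂ :=
  encodeMatrix d * X * (encodeMatrix d)ᴴ

theorem encodeOp_isHermitian {d : ℕ} {X : Matrix (Fin d) (Fin d) ℂ} (hX : X.IsHermitian) :
    (encodeOp X).IsHermitian :=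
  Matrix.isHermitian_mul_mul_conjTranspose _ hX

/-! ### Circuits -/

/-- The wires: `s + 1` registers of `n` qubits each (register `0` is the main one) and `a`
single ancilla qubits. -/
abbrev Wire (n s a : ℕ) : Type := (Fin (s + 1) × Fin n) ⊕ Fin a

/-- Computational basis labels. -/
abbrev Config (n s a : ℕ) : Type := Wire n s a → Fin 2

/-- Operators on the Hilbert space of all wires. -/
abbrev Op (n s a : ℕ) : Type := Matrix (Config n s a) (Config n s a) ℂ

/-- One step of a circuit. `K + 1` is the number of input states, and of output states. -/
inductive Instr (K n s a : ℕ) : Type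
  /-- a one-qubit gate -/
  | gate1 (w : Wire n s a) (u : Matrix.unitaryGroup (Fin 2) ℂ)
  /-- a two-qubit gate -/
  | gate2 (w w' : Wire n s a) (hw : w ≠ w') (u : Matrix.unitaryGroup (Fin 2 × Fin 2) ℂ)
  /-- discard an ancilla qubit and bring in a fresh one in state `|0⟩` -/
  | fresh (i : Fin a)
  /-- discard the content of a register and bring in a fresh copy of the `i`-th input state -/
  | loadIn (j : Fin (s + 1)) (i : Fin (K + 1))
  /-- discard the content of a register and bring in a fresh copy of the `i`-th output state -/
  | loadOut (j : Fin (s + 1)) (i : Fin (K + 1))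

/-- The number of elementary gates of an instruction. -/
def Instr.gates {K n s a : ℕ} : Instr K n s a → ℕ
  | .gate1 _ _ => 1
  | .gate2 _ _ _ _ => 1
  | .fresh _ => 0
  | .loadIn _ _ => 0
  | .loadOut _ _ => 0

/-- The number of copies of input or output states that an instruction consumes. -/
def Instr.copies {K n s a : ℕ} : Instr K n s a → ℕ
  | .gate1 _ _ => 0
  | .gate2 _ _ _ _ => 0
  | .fresh _ => 0
  | .loadIn _ _ => 1
  | .loadOut _ _ => 1

/-- A one-qubit operator acting on wire `w`, tensored with the identity on the other wires. -/
def gate1Op {n s a : ℕ} (w : Wire n s a) (u : Matrix (Fin 2) (Fin 2) ℂ) : Op n s a :=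
  fun b b' => if ∀ v, v ≠ w → b v = b' v then u (b w) (b' w) else 0

/-- A two-qubit operator acting on wires `w, w'`, tensored with the identity on the others. -/
def gate2Op {n s a : ℕ} (w w' : Wire n s a) (u : Matrix (Fin 2 × Fin 2) (Fin 2 × Fin 2) ℂ) :
    Op n s a :=
  fun b b' => if ∀ v, v ≠ w → v ≠ w' → b v = b' v then u (b w, b w') (b' w, b' w') else 0

/-- Overwrite register `j` of a basis label. -/
def setReg {n s a : ℕ} (j : Fin (s + 1)) (b : Config n s a) (c : Fin n → Fin 2) : Config n s a
  | .inl (i, k) => if i = j then c k else b (.inl (i, k))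
  | .inr i => b (.inr i)

/-- Trace out register `j` and put it in state `σ`. -/
def loadReg {n s a : ℕ} (j : Fin (s + 1)) (σ : Matrix (Fin n → Fin 2) (Fin n → Fin 2) ℂ)
    (X : Op n s a) : Op n s a :=
  fun b b' => σ (fun k => b (.inl (j, k))) (fun k => b' (.inl (j, k))) *
    ∑ c : Fin n → Fin 2, X (setReg j b c) (setReg j b' c)

/-- Trace out ancilla `i` and put it in state `|0⟩`. -/
def freshAnc {n s a : ℕ} (i : Fin a) (X : Op n s a) : Op n s a :=
  fun b b' => if b (.inr i) = 0 ∧ b' (.inr i) = 0 then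
    ∑ x : Fin 2, X (Function.update b (.inr i) x) (Function.update b' (.inr i) x) else 0

/-- The quantum channel of an instruction, for given input and output states. -/
def Instr.apply {d K s a : ℕ} (φin φout : Fin (K + 1) → EuclideanSpace ℂ (Fin d)) :
    Instr K (numQubits d) s a → Op (numQubits d) s a → Op (numQubits d) s a
  | .gate1 w u, X => gate1Op w u.1 * X * (gate1Op w u.1)ᴴ
  | .gate2 w w' _ u, X => gate2Op w w' u.1 * X * (gate2Op w w' u.1)ᴴ
  | .fresh i, X => freshAnc i X
  | .loadIn j i, X => loadReg j (encodeOp (ketbra (φin i))) X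
  | .loadOut j i, X => loadReg j (encodeOp (ketbra (φout i))) X

/-- A circuit for `d`-dimensional systems with access to `K + 1` input/output pairs. It runs the
instructions in order; then the observable is measured on the main register and the ancillas are
measured in the computational basis; `post` is the classical post-processing of the two outcomes.
A circuit holds no information on the states that it is run on. -/
structure Circuit (d K : ℕ) : Type where
  s : ℕ
  a : ℕ
  instrs : List (Instr K (numQubits d) s a)
  post : ℝ → (Fin a → Fin 2) → ℝ

namespace Circuit

variable {d K : ℕ}

/-- The number of one- and two-qubit gates. -/
def gates (c : Circuit d K) : ℕ := (c.instrs.map Instr.gates).sum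

/-- The number of copies of input and output states. -/
def copies (c : Circuit d K) : ℕ := (c.instrs.map Instr.copies).sum

/-- The initial state: `ρ` on the main register, everything else in `|0⟩`. -/
def initial (c : Circuit d K) (ρ : Matrix (Fin d) (Fin d) ℂ) : Op (numQubits d) c.s c.a :=
  fun b b' =>
    if (∀ (j : Fin (c.s + 1)) (k : Fin (numQubits d)), j ≠ 0 →
          b (.inl (j, k)) = 0 ∧ b' (.inl (j, k)) = 0) ∧
        (∀ i : Fin c.a, b (.inr i) = 0 ∧ b' (.inr i) = 0)
    then encodeOp ρ (fun k => b (.inl (0, k))) (fun k => b' (.inl (0, k))) else 0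

/-- The state after all instructions. -/
def final (c : Circuit d K) (φin φout : Fin (K + 1) → EuclideanSpace ℂ (Fin d))
    (ρ : Matrix (Fin d) (Fin d) ℂ) : Op (numQubits d) c.s c.a :=
  c.instrs.foldl (fun X I => I.apply φin φout X) (c.initial ρ)

/-- `|v⟩⟨v|` on the main register, `|x⟩⟨x|` on the ancillas, identity on the other registers. -/
def effect (c : Circuit d K) (v : (Fin (numQubits d) → Fin 2) → ℂ) (x : Fin c.a → Fin 2) :
    Op (numQubits d) c.s c.a :=
  fun b b' =>
    if (∀ (j : Fin (c.s + 1)) (k : Fin (numQubits d)), j ≠ 0 → b (.inl (j, k)) = b' (.inl (j, k))) ∧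
        (∀ i : Fin c.a, b (.inr i) = x i ∧ b' (.inr i) = x i)
    then v (fun k => b (.inl (0, k))) * star (v (fun k => b' (.inl (0, k)))) else 0

/-- The law of the post-processed result of one run, when the observable `O` is measured on the
main register. The measurement of `O` is written in an orthonormal eigenbasis; only the eigenvalue
is reported, so the law does not depend on the basis. -/
def law (c : Circuit d K) {O : Matrix (Fin d) (Fin d) ℂ} (hO : O.IsHermitian)
    (φin φout : Fin (K + 1) → EuclideanSpace ℂ (Fin d)) (ρ : Matrix (Fin d) (Fin d) ℂ) :
    Measure ℝ :=
  ∑ e : Fin (numQubits d) → Fin 2, ∑ x : Fin c.a → Fin 2,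
    ENNReal.ofReal
      (c.effect ((encodeOp_isHermitian hO).eigenvectorBasis e).ofLp x * c.final φin φout ρ).trace.re •
    Measure.dirac (c.post ((encodeOp_isHermitian hO).eigenvalues e) x)

end Circuit

/-- A random circuit: finitely many circuits, drawn with given probabilities. -/
structure RandomCircuit (d K : ℕ) : Type 1 where
  ι : Type
  [fintype : Fintype ι]
  prob : PMF ι
  circuit : ι → Circuit d K

attribute [instance] RandomCircuit.fintype

/-- The law of the result of one shot: draw a circuit, run it once, post-process. -/
def RandomCircuit.law {d K : ℕ} (R : RandomCircuit d K) {O : Matrix (Fin d) (Fin d) ℂ}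
    (hO : O.IsHermitian) (φin φout : Fin (K + 1) → EuclideanSpace ℂ (Fin d))
    (ρ : Matrix (Fin d) (Fin d) ℂ) : Measure ℝ :=
  ∑ i : R.ι, R.prob i • (R.circuit i).law hO φin φout ρ

/-- The probability that the sample mean of `N` independent shots is within `ε` of `t`. -/
def RandomCircuit.successProb {d K : ℕ} (R : RandomCircuit d K) (N : ℕ)
    {O : Matrix (Fin d) (Fin d) ℂ} (hO : O.IsHermitian)
    (φin φout : Fin (K + 1) → EuclideanSpace ℂ (Fin d))
    (ρ : Matrix (Fin d) (Fin d) ℂ) (ε t : ℝ) : ℝ :=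
  (Measure.pi fun _ : Fin N => R.law hO φin φout ρ).real
    {y | |(∑ j, y j) / N - t| ≤ ε}

end

end UQE

/-!
The unknown unitary is emulated by a coherent search for the reference state `φ 0`. Let
`σ_k = |φ_k⟩⟨φ_k|`, and let a random list of reflections `R_k = 1 - 2σ_k` be applied to the main
register, with a coherent measurement of `σ_0` before each of them; once the reference state has
been found, the remaining steps only multiply by a sign. At the end the main register is, up to a
small error, in the reference state, and the record of the measurements holds the information on
`ρ`. The register is then overwritten with the reference output `U φ_0`, and all steps are undone
with output states in the place of input states. As `U` intertwines the two kinds of steps, a run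
in which all records return to `0` applies `U G`, where `G` (`returnOp`) is the effect of finding
the reference state (`protocol_apply`).

On the input space, `1 - G` is the effect of never finding the reference state, and its average
over the list is obtained from `P_⊥` by iterating `X ↦ (X + avg_k A_k X A_k) / 2`. The spectrum of
`X ↦ avg_k A_k X A_k` lies in `[-1, λ_⊥]`, so this average decays like `((1 + λ_⊥) / 2)^T` in
Hilbert–Schmidt norm (`norm_hsVec_walkAvg_missEffect_le`), and so does the bias
(`norm_trace_sub_walkAvg_le`). That `λ_⊥ < 1` is a commutant argument: a fixed point commutes with
all `σ_k`, hence with all operators on the input space, but it vanishes on `φ 0`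
(`eq_zero_of_perpMap_eq`).

The reflections are not given as gates; only copies of the states are. The partial swap by an angle
`θ` of the main register with a fresh copy of `σ` is the rotation `exp (-iθσ)` up to an error of
order `θ²`, and this error is itself a linear combination of partial swaps (`ctlRotation_eq`). Thus
the rotation is exactly a signed mixture of channels of circuits, of total weight `1 + O(θ²)`. A
reflection is a product of `3T` rotations by `π / (3T)`, and the protocol has `O(T)` reflections;
so the weight of the whole protocol is `(1 + O(T⁻²))^(O(T²)) = O(1)` (`rotationWeight_pow_le`). A
signed mixture is sampled by a random circuit, with the sign and the weight in the post-processing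
(`Implements.exists_randomCircuit`), so that a single shot has a mean with small bias and is bounded
by a constant times `‖O‖`; Chebyshev's inequality gives the number of shots.
-/

namespace UQE

noncomputable section

/-! ### The Hilbert–Schmidt and operator norms -/

/-- A matrix seen as a vector of `ℂ^d ⊗ ℂ^d`; its norm is the Hilbert–Schmidt norm. -/
def hsVec {d : ℕ} : Matrix (Fin d) (Fin d) ℂ →ₗ[ℂ] EuclideanSpace ℂ (Fin d × Fin d) where
  toFun X := WithLp.toLp 2 fun p => X p.1 p.2
  map_add' _ _ := rfl
  map_smul' _ _ := rfl

variable {d : ℕ}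

theorem hsVec_apply (X : Matrix (Fin d) (Fin d) ℂ) (p : Fin d × Fin d) :
    hsVec X p = X p.1 p.2 := rfl

theorem inner_hsVec (X Y : Matrix (Fin d) (Fin d) ℂ) :
    inner ℂ (hsVec X) (hsVec Y) = (Xᴴ * Y).trace := by
  simp only [PiLp.inner_apply, hsVec_apply, Matrix.trace, Matrix.diag, Matrix.mul_apply,
    Matrix.conjTranspose_apply, RCLike.inner_apply, Fintype.sum_prod_type]
  rw [Finset.sum_comm]
  simp [mul_comm]

theorem norm_sq_hsVec (X : Matrix (Fin d) (Fin d) ℂ) :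
    ‖hsVec X‖ ^ 2 = ∑ i, ∑ j, ‖X i j‖ ^ 2 := by
  rw [EuclideanSpace.norm_sq_eq, Fintype.sum_prod_type]; rfl

theorem norm_sq_hsVec_eq_trace (X : Matrix (Fin d) (Fin d) ℂ) :
    ((‖hsVec X‖ ^ 2 : ℝ) : ℂ) = (Xᴴ * X).trace := by
  rw [← inner_hsVec, inner_self_eq_norm_sq_to_K]; norm_cast

theorem norm_hsVec_conjTranspose (X : Matrix (Fin d) (Fin d) ℂ) :
    ‖hsVec Xᴴ‖ = ‖hsVec X‖ := by
  rw [← sq_eq_sq₀ (norm_nonneg _) (norm_nonneg _), norm_sq_hsVec, norm_sq_hsVec, Finset.sum_comm]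
  simp

theorem norm_mulVec_le (B : Matrix (Fin d) (Fin d) ℂ) (v : Fin d → ℂ) :
    ‖WithLp.toLp 2 (B *ᵥ v)‖ ≤ opNorm B * ‖WithLp.toLp 2 v‖ :=
  (Matrix.toEuclideanCLM (n := Fin d) (𝕜 := ℂ) B).le_opNorm (WithLp.toLp 2 v)

theorem opNorm_nonneg (B : Matrix (Fin d) (Fin d) ℂ) : 0 ≤ opNorm B := norm_nonneg _

theorem opNorm_mul_le (A B : Matrix (Fin d) (Fin d) ℂ) : opNorm (A * B) ≤ opNorm A * opNorm B := by
  simp only [opNorm, map_mul]; exact norm_mul_le _ _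

theorem opNorm_conjTranspose (A : Matrix (Fin d) (Fin d) ℂ) : opNorm Aᴴ = opNorm A := by
  rw [opNorm, ← Matrix.star_eq_conjTranspose, map_star]
  exact ContinuousLinearMap.adjoint.norm_map (Matrix.toEuclideanCLM (n := Fin d) (𝕜 := ℂ) A)

theorem opNorm_mul_le_one {A B : Matrix (Fin d) (Fin d) ℂ} (hA : opNorm A ≤ 1)
    (hB : opNorm B ≤ 1) : opNorm (A * B) ≤ 1 :=
  (opNorm_mul_le A B).trans (mul_le_one₀ hA (opNorm_nonneg B) hB)

theorem opNorm_le_one_of_conjTranspose_mul_self {A : Matrix (Fin d) (Fin d) ℂ} (h : Aᴴ * A = 1) :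
    opNorm A ≤ 1 := by
  have h1 : opNorm A * opNorm A = opNorm (1 : Matrix (Fin d) (Fin d) ℂ) := by
    rw [← h, opNorm, opNorm, map_mul, ← Matrix.star_eq_conjTranspose, map_star]
    exact (CStarRing.norm_star_mul_self).symm
  have h2 : opNorm (1 : Matrix (Fin d) (Fin d) ℂ) ≤ 1 := by
    rw [opNorm, map_one]; exact ContinuousLinearMap.norm_id_le
  nlinarith [opNorm_nonneg A]

theorem norm_hsVec_mul_le (B X : Matrix (Fin d) (Fin d) ℂ) :
    ‖hsVec (B * X)‖ ≤ opNorm B * ‖hsVec X‖ := by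
  have hcol : ∀ Y : Matrix (Fin d) (Fin d) ℂ,
      ‖hsVec Y‖ ^ 2 = ∑ j, ‖WithLp.toLp 2 fun i => Y i j‖ ^ 2 := fun Y => by
    rw [norm_sq_hsVec, Finset.sum_comm]; simp [EuclideanSpace.norm_sq_eq]
  refine le_of_sq_le_sq ?_ (mul_nonneg (opNorm_nonneg _) (norm_nonneg _))
  rw [mul_pow, hcol, hcol, Finset.mul_sum]
  refine Finset.sum_le_sum fun j _ => ?_
  rw [← mul_pow]
  exact pow_le_pow_left₀ (norm_nonneg _) (norm_mulVec_le B fun i => X i j) 2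

theorem norm_hsVec_mul_le' (X B : Matrix (Fin d) (Fin d) ℂ) :
    ‖hsVec (X * B)‖ ≤ opNorm B * ‖hsVec X‖ := by
  rw [← norm_hsVec_conjTranspose, Matrix.conjTranspose_mul, ← opNorm_conjTranspose,
    ← norm_hsVec_conjTranspose X]
  exact norm_hsVec_mul_le _ _

theorem norm_hsVec_mul_le_mul (A B : Matrix (Fin d) (Fin d) ℂ) :
    ‖hsVec (A * B)‖ ≤ ‖hsVec A‖ * ‖hsVec B‖ := by
  have key : ∀ Y : Matrix (Fin d) (Fin d) ℂ, ‖hsVec Y‖ =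
      @norm _ (Matrix.frobeniusNormedAddCommGroup (m := Fin d) (n := Fin d) (α := ℂ)).toNorm Y := by
    intro Y
    rw [Matrix.frobenius_norm_def, EuclideanSpace.norm_eq, Real.sqrt_eq_rpow, Fintype.sum_prod_type]
    simp [hsVec_apply]
  rw [key, key, key]
  exact Matrix.frobenius_norm_mul A B

theorem exists_eq_conjTranspose_mul_self {n : Type*} [Fintype n] [DecidableEq n]
    {Z : Matrix n n ℂ} (hZ : Z.PosSemidef) : ∃ B : Matrix n n ℂ, Z = Bᴴ * B := by
  open scoped MatrixOrder in
  refine ⟨CFC.sqrt Z, ?_⟩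
  rw [← Matrix.star_eq_conjTranspose, (CFC.sqrt_nonneg Z).isSelfAdjoint.star_eq,
    CFC.sqrt_mul_sqrt_self Z hZ.nonneg]

theorem norm_trace_mul_le (A B : Matrix (Fin d) (Fin d) ℂ) :
    ‖(A * B).trace‖ ≤ ‖hsVec A‖ * ‖hsVec B‖ := by
  have h := norm_inner_le_norm (𝕜 := ℂ) (hsVec Aᴴ) (hsVec B)
  rwa [inner_hsVec, Matrix.conjTranspose_conjTranspose, norm_hsVec_conjTranspose] at h

/-- Hölder's inequality for the trace pairing of an operator with a positive one. -/
theorem norm_trace_mul_le_of_posSemidef (X : Matrix (Fin d) (Fin d) ℂ)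
    {Z : Matrix (Fin d) (Fin d) ℂ} (hZ : Z.PosSemidef) :
    ‖(X * Z).trace‖ ≤ opNorm X * Z.trace.re := by
  obtain ⟨B, rfl⟩ := exists_eq_conjTranspose_mul_self hZ
  have h1 : (X * (Bᴴ * B)).trace = (B * (X * Bᴴ)).trace := by
    rw [← Matrix.mul_assoc, Matrix.trace_mul_comm]
  have h2 : (Bᴴ * B).trace.re = ‖hsVec B‖ * ‖hsVec B‖ := by
    rw [← norm_sq_hsVec_eq_trace, Complex.ofReal_re, sq]
  rw [h1, h2]
  refine (norm_trace_mul_le _ _).trans ?_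
  have := norm_hsVec_mul_le X Bᴴ
  rw [norm_hsVec_conjTranspose] at this
  nlinarith [norm_nonneg (hsVec B)]

theorem norm_hsVec_le_one_of_isDensity {ρ : Matrix (Fin d) (Fin d) ℂ} (hρ : IsDensity ρ) :
    ‖hsVec ρ‖ ≤ 1 := by
  obtain ⟨B, hB⟩ := exists_eq_conjTranspose_mul_self hρ.1
  have h1 : ‖hsVec B‖ ^ 2 = 1 := by
    have := norm_sq_hsVec_eq_trace B
    rw [← hB, hρ.2] at this
    exact_mod_cast this
  have h2 := norm_hsVec_mul_le_mul Bᴴ B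
  rw [norm_hsVec_conjTranspose, ← hB] at h2
  nlinarith

/-! ### Projections and rank-one operators -/

theorem toEuclideanCLM_projMatrix (H : Submodule ℂ (EuclideanSpace ℂ (Fin d))) :
    Matrix.toEuclideanCLM (n := Fin d) (𝕜 := ℂ) (projMatrix H) = H.starProjection :=
  StarAlgEquiv.apply_symm_apply _ _

theorem projMatrix_mulVec (H : Submodule ℂ (EuclideanSpace ℂ (Fin d)))
    (v : EuclideanSpace ℂ (Fin d)) : projMatrix H *ᵥ v.ofLp = (H.starProjection v).ofLp := by
  rw [← toEuclideanCLM_projMatrix, Matrix.ofLp_toEuclideanCLM]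

theorem projMatrix_conjTranspose (H : Submodule ℂ (EuclideanSpace ℂ (Fin d))) :
    (projMatrix H)ᴴ = projMatrix H := by
  refine EquivLike.injective (Matrix.toEuclideanCLM (n := Fin d) (𝕜 := ℂ)) ?_
  rw [← Matrix.star_eq_conjTranspose, map_star, toEuclideanCLM_projMatrix]
  exact isSelfAdjoint_starProjection H

theorem projMatrix_mul_self (H : Submodule ℂ (EuclideanSpace ℂ (Fin d))) :
    projMatrix H * projMatrix H = projMatrix H := by
  refine EquivLike.injective (Matrix.toEuclideanCLM (n := Fin d) (𝕜 := ℂ)) ?_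
  rw [map_mul, toEuclideanCLM_projMatrix]
  exact H.isIdempotentElem_starProjection

theorem opNorm_projMatrix_le (H : Submodule ℂ (EuclideanSpace ℂ (Fin d))) :
    opNorm (projMatrix H) ≤ 1 := by
  rw [opNorm, toEuclideanCLM_projMatrix]; exact H.starProjection_norm_le

theorem trace_projMatrix (H : Submodule ℂ (EuclideanSpace ℂ (Fin d))) :
    (projMatrix H).trace = Module.finrank ℂ H := by
  have h : LinearMap.IsProj H (H.starProjection : EuclideanSpace ℂ (Fin d) →ₗ[ℂ] _) :=
    ⟨fun x => H.starProjection_apply_mem x, fun x hx => Submodule.starProjection_eq_self_iff.mpr hx⟩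
  rw [← h.trace, ← toEuclideanCLM_projMatrix, Matrix.coe_toEuclideanCLM_eq_toEuclideanLin,
    Matrix.toEuclideanLin, Matrix.toLpLin_eq_toLin, Matrix.trace_toLin_eq]

theorem ketbra_apply (v : EuclideanSpace ℂ (Fin d)) (i j : Fin d) :
    ketbra v i j = v i * star (v j) := rfl

theorem ketbra_conjTranspose (v : EuclideanSpace ℂ (Fin d)) : (ketbra v)ᴴ = ketbra v := by
  ext i j; simp [ketbra_apply, mul_comm]

theorem mul_ketbra (A : Matrix (Fin d) (Fin d) ℂ) (v : EuclideanSpace ℂ (Fin d)) :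
    A * ketbra v = Matrix.vecMulVec (A *ᵥ v.ofLp) (star v.ofLp) := by
  rw [ketbra, Matrix.mul_vecMulVec]

theorem star_dotProduct_self (v : EuclideanSpace ℂ (Fin d)) (hv : ‖v‖ = 1) :
    star v.ofLp ⬝ᵥ v.ofLp = 1 := by
  have h := inner_self_eq_norm_sq_to_K (𝕜 := ℂ) v
  rw [hv, EuclideanSpace.inner_eq_star_dotProduct, dotProduct_comm] at h
  simpa using h

theorem ketbra_mulVec_self (v : EuclideanSpace ℂ (Fin d)) (hv : ‖v‖ = 1) :
    ketbra v *ᵥ v.ofLp = v.ofLp := by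
  rw [ketbra, Matrix.vecMulVec_mulVec, star_dotProduct_self v hv]; simp

theorem ketbra_mul_self (v : EuclideanSpace ℂ (Fin d)) (hv : ‖v‖ = 1) :
    ketbra v * ketbra v = ketbra v := by
  rw [mul_ketbra, ketbra_mulVec_self v hv]; rfl

theorem trace_ketbra (v : EuclideanSpace ℂ (Fin d)) (hv : ‖v‖ = 1) : (ketbra v).trace = 1 := by
  rw [ketbra, Matrix.trace_vecMulVec, dotProduct_comm, star_dotProduct_self v hv]

theorem ketbra_posSemidef (v : EuclideanSpace ℂ (Fin d)) : (ketbra v).PosSemidef :=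
  Matrix.posSemidef_vecMulVec_self_star _

theorem ketbra_mul_mul_ketbra (v : EuclideanSpace ℂ (Fin d)) (Z : Matrix (Fin d) (Fin d) ℂ) :
    ketbra v * Z * ketbra v = (ketbra v * Z).trace • ketbra v := by
  rw [ketbra, Matrix.vecMulVec_mul, Matrix.vecMulVec_mul_vecMulVec, Matrix.trace_vecMulVec,
    Matrix.vecMulVec_smul, dotProduct_comm]

theorem projMatrix_mul_ketbra {H : Submodule ℂ (EuclideanSpace ℂ (Fin d))}
    {v : EuclideanSpace ℂ (Fin d)} (hv : v ∈ H) : projMatrix H * ketbra v = ketbra v := by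
  rw [mul_ketbra, projMatrix_mulVec, Submodule.starProjection_eq_self_iff.mpr hv]; rfl

theorem ketbra_mul_projMatrix {H : Submodule ℂ (EuclideanSpace ℂ (Fin d))}
    {v : EuclideanSpace ℂ (Fin d)} (hv : v ∈ H) : ketbra v * projMatrix H = ketbra v := by
  have h := congrArg Matrix.conjTranspose (projMatrix_mul_ketbra hv)
  rwa [Matrix.conjTranspose_mul, ketbra_conjTranspose, projMatrix_conjTranspose] at h

theorem opNorm_reflection_le (v : EuclideanSpace ℂ (Fin d)) (hv : ‖v‖ = 1) :
    opNorm (1 - (2 : ℂ) • ketbra v) ≤ 1 := by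
  apply opNorm_le_one_of_conjTranspose_mul_self
  have h : (1 - (2 : ℂ) • ketbra v)ᴴ = 1 - (2 : ℂ) • ketbra v := by
    simp [Matrix.conjTranspose_sub, Matrix.conjTranspose_smul, ketbra_conjTranspose]
  rw [h]
  simp only [sub_mul, mul_sub, one_mul, mul_one, smul_mul_assoc, mul_smul_comm,
    ketbra_mul_self v hv]
  module

variable {K : ℕ} {φ : Fin (K + 1) → EuclideanSpace ℂ (Fin d)}

theorem mem_inputSpace (φ : Fin (K + 1) → EuclideanSpace ℂ (Fin d)) (k : Fin (K + 1)) :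
    φ k ∈ inputSpace φ := Submodule.subset_span ⟨k, rfl⟩

theorem perpProj_eq (hφ : ‖φ 0‖ = 1) :
    perpProj φ = projMatrix (inputSpace φ) - ketbra (φ 0) := by
  refine EquivLike.injective (Matrix.toEuclideanCLM (n := Fin d) (𝕜 := ℂ)) ?_
  rw [perpProj, toEuclideanCLM_projMatrix, map_sub, toEuclideanCLM_projMatrix]
  ext1 v
  have hk : Matrix.toEuclideanCLM (n := Fin d) (𝕜 := ℂ) (ketbra (φ 0)) v =
      inner ℂ (φ 0) v • φ 0 := by
    apply WithLp.ofLp_injective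
    rw [Matrix.ofLp_toEuclideanCLM, ketbra, Matrix.vecMulVec_mulVec,
      EuclideanSpace.inner_eq_star_dotProduct, dotProduct_comm]
    ext i; simp [mul_comm]
  have h0 : φ 0 ∈ inputSpace φ := mem_inputSpace φ 0
  have hin : inner ℂ (φ 0) (φ 0) = (1 : ℂ) := by
    rw [inner_self_eq_norm_sq_to_K, hφ]; simp
  rw [sub_apply, hk]
  have hsub : ∀ w ∈ inputSpace φ, inner ℂ w (v - (inputSpace φ).starProjection v) = 0 :=
    fun w hw => (Submodule.mem_orthogonal _ _).mp
      (Submodule.sub_starProjection_mem_orthogonal (K := inputSpace φ) v) w hw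
  refine Submodule.eq_starProjection_of_mem_orthogonal ?_ ?_
  · refine ⟨Submodule.sub_mem _ (Submodule.starProjection_apply_mem _ v)
      (Submodule.smul_mem _ _ h0), ?_⟩
    rw [SetLike.mem_coe, Submodule.mem_orthogonal_singleton_iff_inner_right, inner_sub_right,
      inner_smul_right, hin]
    have := hsub _ h0
    rw [inner_sub_right] at this
    linear_combination -this
  · rw [Submodule.mem_orthogonal]
    rintro w ⟨hw1, hw2⟩
    rw [SetLike.mem_coe, Submodule.mem_orthogonal_singleton_iff_inner_left] at hw2
    rw [← sub_add, inner_add_right, hsub w hw1, inner_smul_right, hw2]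
    simp

theorem perpProj_mul_ketbra_zero (hφ : ‖φ 0‖ = 1) : perpProj φ * ketbra (φ 0) = 0 := by
  rw [perpProj_eq hφ, sub_mul, projMatrix_mul_ketbra (mem_inputSpace φ 0), ketbra_mul_self _ hφ,
    sub_self]

theorem perpProj_conjTranspose (φ : Fin (K + 1) → EuclideanSpace ℂ (Fin d)) :
    (perpProj φ)ᴴ = perpProj φ := projMatrix_conjTranspose _

theorem perpProj_mul_self (φ : Fin (K + 1) → EuclideanSpace ℂ (Fin d)) :
    perpProj φ * perpProj φ = perpProj φ := projMatrix_mul_self _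

theorem ketbra_zero_mul_perpProj (hφ : ‖φ 0‖ = 1) : ketbra (φ 0) * perpProj φ = 0 := by
  have h := congrArg Matrix.conjTranspose (perpProj_mul_ketbra_zero hφ)
  rwa [Matrix.conjTranspose_mul, ketbra_conjTranspose, perpProj_conjTranspose,
    Matrix.conjTranspose_zero] at h

theorem perpReflection_eq (φ : Fin (K + 1) → EuclideanSpace ℂ (Fin d)) (k : Fin (K + 1)) :
    perpReflection φ k = perpProj φ * (1 - (2 : ℂ) • ketbra (φ k)) * perpProj φ := by
  rw [perpReflection, mul_sub, sub_mul, mul_one, perpProj_mul_self, mul_smul_comm, smul_mul_assoc]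

theorem perpReflection_conjTranspose (φ : Fin (K + 1) → EuclideanSpace ℂ (Fin d))
    (k : Fin (K + 1)) : (perpReflection φ k)ᴴ = perpReflection φ k := by
  simp [perpReflection_eq, Matrix.conjTranspose_mul, perpProj_conjTranspose, ketbra_conjTranspose,
    Matrix.conjTranspose_sub, Matrix.conjTranspose_smul, mul_assoc]

theorem perpReflection_zero (hφ : ‖φ 0‖ = 1) : perpReflection φ 0 = perpProj φ := by
  rw [perpReflection, perpProj_mul_ketbra_zero hφ]; simp

theorem perpProj_mul_perpReflection (φ : Fin (K + 1) → EuclideanSpace ℂ (Fin d))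
    (k : Fin (K + 1)) : perpProj φ * perpReflection φ k = perpReflection φ k := by
  rw [perpReflection_eq, ← mul_assoc, ← mul_assoc, perpProj_mul_self]

theorem perpReflection_mul_perpProj (φ : Fin (K + 1) → EuclideanSpace ℂ (Fin d))
    (k : Fin (K + 1)) : perpReflection φ k * perpProj φ = perpReflection φ k := by
  rw [perpReflection_eq, mul_assoc, perpProj_mul_self]

theorem opNorm_perpReflection_le (k : Fin (K + 1)) (hφ : ‖φ k‖ = 1) :
    opNorm (perpReflection φ k) ≤ 1 := by
  rw [perpReflection_eq]
  exact opNorm_mul_le_one (opNorm_mul_le_one (opNorm_projMatrix_le _) (opNorm_reflection_le _ hφ))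
    (opNorm_projMatrix_le _)

/-! ### The spectral gap of the averaged reflections -/

variable {d K : ℕ} {φ : Fin (K + 1) → EuclideanSpace ℂ (Fin d)}

/-- The map `X ↦ avg_k A_k X A_k` on matrices; `perpOperator` is its matrix. -/
def perpMap (φ : Fin (K + 1) → EuclideanSpace ℂ (Fin d)) (X : Matrix (Fin d) (Fin d) ℂ) :
    Matrix (Fin d) (Fin d) ℂ :=
  (K : ℂ)⁻¹ • ∑ k : Fin K, perpReflection φ k.succ * X * perpReflection φ k.succ

theorem kronecker_mulVec_hsVec (A X : Matrix (Fin d) (Fin d) ℂ) :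
    (A ⊗ₖ A.map (starRingEnd ℂ)) *ᵥ (hsVec X).ofLp = (hsVec (A * X * Aᴴ)).ofLp := by
  ext ⟨i, j⟩
  simp only [Matrix.mulVec, dotProduct, Matrix.kroneckerMap_apply, hsVec_apply, Matrix.mul_apply,
    Fintype.sum_prod_type, Matrix.map_apply, Matrix.conjTranspose_apply, Finset.sum_mul]
  rw [Finset.sum_comm]
  refine Finset.sum_congr rfl fun _ _ => Finset.sum_congr rfl fun _ _ => ?_
  rw [starRingEnd_apply]; ring

theorem perpOperator_mulVec_hsVec (φ : Fin (K + 1) → EuclideanSpace ℂ (Fin d))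
    (X : Matrix (Fin d) (Fin d) ℂ) :
    perpOperator φ *ᵥ (hsVec X).ofLp = (hsVec (perpMap φ X)).ofLp := by
  rw [perpOperator, perpMap, Matrix.smul_mulVec, Matrix.sum_mulVec, map_smul, map_sum,
    WithLp.ofLp_smul, WithLp.ofLp_sum]
  simp only [kronecker_mulVec_hsVec, perpReflection_conjTranspose]

theorem perpOperator_isHermitian (φ : Fin (K + 1) → EuclideanSpace ℂ (Fin d)) :
    (perpOperator φ).IsHermitian := by
  rw [Matrix.IsHermitian, perpOperator, Matrix.conjTranspose_smul, Matrix.conjTranspose_sum]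
  congr 1
  · simp
  · refine Finset.sum_congr rfl fun k _ => ?_
    have h := perpReflection_conjTranspose φ k.succ
    ext ⟨i, j⟩ ⟨i', j'⟩
    have h1 := congrFun (congrFun h i) i'
    have h2 := congrFun (congrFun h j) j'
    simp only [Matrix.conjTranspose_apply] at h1 h2
    simp only [Matrix.conjTranspose_apply, Matrix.kroneckerMap_apply, Matrix.map_apply, star_mul',
      starRingEnd_apply, star_star]
    rw [h1, ← h2, star_star]

theorem hsVec_surjective (x : Fin d × Fin d → ℂ) :
    ∃ X : Matrix (Fin d) (Fin d) ℂ, (hsVec X).ofLp = x :=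
  ⟨Matrix.of fun i j => x (i, j), rfl⟩

theorem hsVec_eq_zero {X : Matrix (Fin d) (Fin d) ℂ} (h : ‖hsVec X‖ = 0) : X = 0 := by
  have h0 := norm_eq_zero.mp h
  ext i j
  exact congrArg (fun v : EuclideanSpace ℂ (Fin d × Fin d) => v (i, j)) h0

theorem norm_hsVec_conj_le {A : Matrix (Fin d) (Fin d) ℂ} (hA : opNorm A ≤ 1)
    (X : Matrix (Fin d) (Fin d) ℂ) : ‖hsVec (A * X * A)‖ ≤ ‖hsVec X‖ :=
  (norm_hsVec_mul_le' _ _).trans <|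
    (mul_le_of_le_one_left (norm_nonneg _) hA).trans <|
      (norm_hsVec_mul_le _ _).trans (mul_le_of_le_one_left (norm_nonneg _) hA)

theorem norm_hsVec_perpMap_le (hφ : ∀ i, ‖φ i‖ = 1) (X : Matrix (Fin d) (Fin d) ℂ) :
    ‖hsVec (perpMap φ X)‖ ≤ ‖hsVec X‖ := by
  rw [perpMap, map_smul, map_sum, norm_smul]
  have h : ‖∑ k : Fin K, hsVec (perpReflection φ k.succ * X * perpReflection φ k.succ)‖ ≤
      K * ‖hsVec X‖ := by
    refine (norm_sum_le _ _).trans ?_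
    refine (Finset.sum_le_sum fun k _ =>
      norm_hsVec_conj_le (opNorm_perpReflection_le _ (hφ _)) X).trans ?_
    simp
  rw [norm_inv, Complex.norm_natCast]
  rcases Nat.eq_zero_or_pos K with rfl | hK
  · simp
  · have hK' : (0 : ℝ) < K := by exact_mod_cast hK
    rw [inv_mul_le_iff₀ hK']
    exact h

theorem hasEigenvalue_perpOperator_iff (μ : ℂ) :
    Module.End.HasEigenvalue (Matrix.toLin' (perpOperator φ)) μ ↔
      ∃ X : Matrix (Fin d) (Fin d) ℂ, X ≠ 0 ∧ perpMap φ X = μ • X := by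
  constructor
  · intro h
    obtain ⟨x, hx⟩ := h.exists_hasEigenvector
    obtain ⟨X, rfl⟩ := hsVec_surjective x
    have h1 := hx.apply_eq_smul
    rw [Matrix.toLin'_apply, perpOperator_mulVec_hsVec] at h1
    refine ⟨X, fun h0 => hx.2 (by rw [h0, map_zero]; rfl), ?_⟩
    ext i j
    exact congrFun h1 (i, j)
  · rintro ⟨X, hX, h⟩
    refine Module.End.hasEigenvalue_of_hasEigenvector (x := (hsVec X).ofLp)
      ⟨Module.End.mem_eigenspace_iff.mpr ?_, fun h0 => hX ?_⟩
    · rw [Matrix.toLin'_apply, perpOperator_mulVec_hsVec, h]; rfl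
    · ext i j; exact congrFun h0 (i, j)

theorem abs_le_one_of_hasEigenvalue (hφ : ∀ i, ‖φ i‖ = 1) {μ : ℝ}
    (h : Module.End.HasEigenvalue (Matrix.toLin' (perpOperator φ)) (μ : ℂ)) : |μ| ≤ 1 := by
  obtain ⟨X, hX, h⟩ := (hasEigenvalue_perpOperator_iff _).mp h
  have h1 := norm_hsVec_perpMap_le hφ X
  rw [h, map_smul, norm_smul, Complex.norm_real, Real.norm_eq_abs] at h1
  have h2 : 0 < ‖hsVec X‖ :=
    lt_of_le_of_ne (norm_nonneg _) fun h0 => hX (hsVec_eq_zero h0.symm)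
  exact le_of_mul_le_mul_right (by linarith) h2

/-- The projection on the reference state is in the kernel of the averaged reflections. -/
theorem hasEigenvalue_zero (hφ : ∀ i, ‖φ i‖ = 1) :
    Module.End.HasEigenvalue (Matrix.toLin' (perpOperator φ)) ((0 : ℝ) : ℂ) := by
  refine (hasEigenvalue_perpOperator_iff _).mpr ⟨ketbra (φ 0), fun h => ?_, ?_⟩
  · have := trace_ketbra _ (hφ 0)
    rw [h] at this; simp at this
  · simp only [perpMap, perpReflection_eq, mul_assoc]
    simp [← mul_assoc (perpProj φ) (ketbra (φ 0)), perpProj_mul_ketbra_zero (hφ 0)]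

/-- If the average of the contractions `A_k X A_k` is `X`, then all of them are equal to `X`. -/
theorem conj_eq_of_perpMap_eq (hφ : ∀ i, ‖φ i‖ = 1) {X : Matrix (Fin d) (Fin d) ℂ}
    (h : perpMap φ X = X) (k : Fin K) :
    perpReflection φ k.succ * X * perpReflection φ k.succ = X := by
  set Y : Fin K → Matrix (Fin d) (Fin d) ℂ :=
    fun k => perpReflection φ k.succ * X * perpReflection φ k.succ with hY
  have hK : (K : ℂ) ≠ 0 := by
    have := k.pos
    exact_mod_cast this.ne'
  have hsum : ∑ k, Y k = (K : ℂ) • X := by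
    conv_rhs => rw [← h]
    rw [perpMap, smul_smul, mul_inv_cancel₀ hK, one_smul]
  have h1 : ∀ k, ‖hsVec (Y k - X)‖ ^ 2 ≤
      2 * ‖hsVec X‖ ^ 2 - 2 * (inner ℂ (hsVec (Y k)) (hsVec X)).re := fun k => by
    have h3 : ‖hsVec (Y k)‖ ≤ ‖hsVec X‖ :=
      norm_hsVec_conj_le (opNorm_perpReflection_le _ (hφ _)) X
    have h4 := @norm_sub_sq ℂ _ _ _ _ (hsVec (Y k)) (hsVec X)
    rw [map_sub, h4]
    have h5 := pow_le_pow_left₀ (norm_nonneg _) h3 2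
    simp only [RCLike.re_to_complex]
    linarith
  have h2 : ∑ k, ‖hsVec (Y k - X)‖ ^ 2 ≤ 0 := by
    refine (Finset.sum_le_sum fun k _ => h1 k).trans (le_of_eq ?_)
    rw [Finset.sum_sub_distrib, ← Finset.mul_sum, ← Finset.mul_sum, ← Complex.re_sum,
      ← sum_inner, ← map_sum, hsum,
      map_smul, inner_smul_left, inner_self_eq_norm_sq_to_K]
    simp only [Finset.sum_const, Finset.card_univ, Fintype.card_fin, nsmul_eq_mul, map_natCast]
    have : ((K : ℂ) * (‖hsVec X‖ : ℂ) ^ 2).re = K * ‖hsVec X‖ ^ 2 := by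
      rw [← Complex.ofReal_pow, ← Complex.ofReal_natCast, ← Complex.ofReal_mul, Complex.ofReal_re]
    erw [this]; ring
  have h3 := (Finset.sum_eq_zero_iff_of_nonneg fun k _ => sq_nonneg _).mp
    (le_antisymm h2 (Finset.sum_nonneg fun k _ => sq_nonneg ‖hsVec (Y k - X)‖)) k
    (Finset.mem_univ k)
  exact sub_eq_zero.mp (hsVec_eq_zero (pow_eq_zero_iff two_ne_zero |>.mp h3))

/-- A fixed point `X = P X P` of conjugation with `P - 2 PσP`, for a projection `P` and a rank-one
projection `σ`, commutes with `σ`. Depending on `c = tr PσP`, either `σ` is orthogonal to `P`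
(`c = 0`), or below `P` (`c = 1`), or else `X` vanishes on the range of `PσP`. -/
theorem commute_ketbra_of_conj_eq {P X : Matrix (Fin d) (Fin d) ℂ} (hP : Pᴴ = P) (hP2 : P * P = P)
    (hPX : P * X = X) (hXP : X * P = X) (v : EuclideanSpace ℂ (Fin d)) (hv : ‖v‖ = 1)
    (h : (P - (2 : ℂ) • (P * ketbra v * P)) * X * (P - (2 : ℂ) • (P * ketbra v * P)) = X) :
    Commute (ketbra v) X := by
  set σ := ketbra v with hσ
  set c := (σ * P).trace with hc
  have hσ1 : σᴴ = σ := ketbra_conjTranspose v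
  have hσ2 : σ * σ = σ := ketbra_mul_self v hv
  have hσPσ : σ * P * σ = c • σ := ketbra_mul_mul_ketbra v P
  set F := P * σ * P with hF
  have hFF : F * F = c • F := by
    have : F * F = P * (σ * (P * P) * σ) * P := by simp only [hF, mul_assoc]
    rw [this, hP2, hσPσ, hF, mul_smul_comm, smul_mul_assoc]
  have hFP : F * P = F := by rw [hF, mul_assoc, hP2]
  have hPF : P * F = F := by rw [hF, ← mul_assoc, ← mul_assoc, hP2]
  have hFX : F * X + X * F = (2 : ℂ) • (F * X * F) := by
    have e : (P - (2 : ℂ) • F) * X * (P - (2 : ℂ) • F) =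
        X + (2 : ℂ) • ((2 : ℂ) • (F * X * F) - (F * X + X * F)) := by
      have e1 : (P - (2 : ℂ) • F) * X = X - (2 : ℂ) • (F * X) := by
        rw [sub_mul, hPX, smul_mul_assoc]
      rw [e1, mul_sub, sub_mul, hXP, smul_mul_assoc, mul_assoc, hXP, mul_smul_comm, sub_mul,
        smul_mul_assoc]
      module
    rw [e] at h
    have h2 := add_eq_left.mp h
    rw [smul_eq_zero_iff_right two_ne_zero] at h2
    exact (sub_eq_zero.mp h2).symm
  have hL : c • (F * X) = (2 * c - 1) • (F * X * F) := by
    have h1 := congrArg (F * ·) hFX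
    simp only [mul_add, mul_smul_comm, ← mul_assoc, hFF, smul_mul_assoc] at h1
    rw [← sub_eq_zero] at h1 ⊢
    rw [← h1]; module
  have hR : c • (X * F) = (2 * c - 1) • (F * X * F) := by
    have h1 := congrArg (· * F) hFX
    simp only [add_mul, smul_mul_assoc, mul_assoc, hFF, mul_smul_comm] at h1
    simp only [mul_assoc]
    rw [← sub_eq_zero] at h1 ⊢
    rw [← h1]; module
  have hσX : σ * X = σ * P * X := by rw [mul_assoc, hPX]
  have hXσ : X * σ = X * P * σ := by rw [hXP]
  by_cases hc0 : c = 0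
  · have h0 : ‖hsVec (σ * P)‖ ^ 2 = 0 := by
      have := norm_sq_hsVec_eq_trace (σ * P)
      rw [Matrix.conjTranspose_mul, hσ1, hP, Matrix.trace_mul_comm, mul_assoc σ P, ← mul_assoc P P,
        hP2, ← mul_assoc, hσPσ, hc0, zero_smul, Matrix.trace_zero] at this
      exact_mod_cast this
    have h1 : σ * P = 0 := hsVec_eq_zero (pow_eq_zero_iff two_ne_zero |>.mp h0)
    have h2 : P * σ = 0 := by
      have := congrArg Matrix.conjTranspose h1
      rwa [Matrix.conjTranspose_mul, hσ1, hP, Matrix.conjTranspose_zero] at this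
    rw [commute_iff_eq, hσX, hXσ, h1, mul_assoc, h2, zero_mul, mul_zero]
  by_cases hc1 : c = 1
  · have hPσ : P * σ = σ := by
      have h0 : ‖hsVec (P * σ - σ)‖ ^ 2 = 0 := by
        have := norm_sq_hsVec_eq_trace (P * σ - σ)
        rw [Matrix.conjTranspose_sub, Matrix.conjTranspose_mul, hσ1, hP, mul_sub, sub_mul, sub_mul,
          mul_assoc σ P, ← mul_assoc P P, hP2, ← mul_assoc, hσPσ, hσ2, hc1, one_smul] at this
        simp only [sub_self, Matrix.trace_zero] at this
        exact_mod_cast this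
      exact sub_eq_zero.mp (hsVec_eq_zero (pow_eq_zero_iff two_ne_zero |>.mp h0))
    have hσP : σ * P = σ := by
      have := congrArg Matrix.conjTranspose hPσ
      rwa [Matrix.conjTranspose_mul, hσ1, hP] at this
    have hFσ : F = σ := by rw [hF, hPσ, hσP]
    rw [hc1, hFσ, one_smul] at hL hR
    exact hL.trans hR.symm
  · have h0 : F * X * F = 0 := by
      have h1 := congrArg (· * F) hL
      simp only [smul_mul_assoc, mul_assoc, hFF, mul_smul_comm] at h1
      rw [← mul_assoc, smul_smul, ← sub_eq_zero, ← sub_smul, smul_eq_zero] at h1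
      refine h1.resolve_left fun h2 => ?_
      have : c * (c - 1) = 0 := by linear_combination (-1 / 2 : ℂ) * h2
      rcases mul_eq_zero.mp this with h3 | h3
      · exact hc0 h3
      · exact hc1 (sub_eq_zero.mp h3)
    rw [h0, smul_zero, smul_eq_zero_iff_right hc0] at hL hR
    have h1 : σ * X = 0 := by
      have h2 := congrArg (σ * ·) hL
      simp only [hF, ← mul_assoc, hσPσ, mul_zero, smul_mul_assoc] at h2
      rw [smul_eq_zero_iff_right hc0] at h2
      rw [hσX, h2]
    have h2 : X * σ = 0 := by
      have h2 := congrArg (· * σ) hR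
      simp only [hF, mul_assoc, zero_mul] at h2
      rw [← mul_assoc σ P σ, hσPσ, mul_smul_comm, mul_smul_comm, smul_eq_zero_iff_right hc0] at h2
      rw [hXσ, mul_assoc, h2]
    rw [commute_iff_eq, h1, h2]

/-- Under the condition for emulation the averaged reflections have no fixed point: it would
commute with all operators on the input space and vanish on the reference state. -/
theorem eq_zero_of_perpMap_eq (hφ : ∀ i, ‖φ i‖ = 1) (hgen : GeneratesFullAlgebra φ)
    {X : Matrix (Fin d) (Fin d) ℂ} (h : perpMap φ X = X) : X = 0 := by
  have hP := perpProj_conjTranspose φ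
  have hP2 := perpProj_mul_self φ
  have hPX : perpProj φ * X = X := by
    conv_rhs => rw [← h]
    conv_lhs => rw [← h]
    simp only [perpMap, mul_smul_comm, Finset.mul_sum, ← mul_assoc, perpProj_mul_perpReflection]
  have hXP : X * perpProj φ = X := by
    conv_rhs => rw [← h]
    conv_lhs => rw [← h]
    simp only [perpMap, smul_mul_assoc, Finset.sum_mul, mul_assoc, perpReflection_mul_perpProj]
  have hX0 : X * ketbra (φ 0) = 0 := by
    rw [← hXP, mul_assoc, perpProj_mul_ketbra_zero (hφ 0), mul_zero]
  have h0X : ketbra (φ 0) * X = 0 := by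
    rw [← hPX, ← mul_assoc, ketbra_zero_mul_perpProj (hφ 0), zero_mul]
  have hcomm : ∀ k, Commute (ketbra (φ k)) X := by
    intro k
    refine Fin.cases ?_ (fun k => ?_) k
    · rw [commute_iff_eq, hX0, h0X]
    · exact commute_ketbra_of_conj_eq hP hP2 hPX hXP _ (hφ _) (conj_eq_of_perpMap_eq hφ h k)
  have hall : ∀ Y ∈ operatorsOn (inputSpace φ), Commute Y X := by
    intro Y hY
    rw [← hgen] at hY
    induction hY using NonUnitalAlgebra.adjoin_induction with
    | mem x hx => obtain ⟨k, rfl⟩ := hx; exact hcomm k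
    | add x y _ _ hx hy => exact hx.add_left hy
    | zero => exact Commute.zero_left X
    | mul x y _ _ hx hy => exact hx.mul_left hy
    | smul r x _ hx => exact hx.smul_left r
  have hXφ : X *ᵥ (φ 0).ofLp = 0 := by
    rw [← ketbra_mulVec_self _ (hφ 0), Matrix.mulVec_mulVec, hX0, Matrix.zero_mulVec]
  have hker : ∀ ψ ∈ inputSpace φ, X *ᵥ ψ.ofLp = 0 := by
    intro ψ hψ
    have hmem : Matrix.vecMulVec ψ.ofLp (star (φ 0).ofLp) ∈ operatorsOn (inputSpace φ) := by
      have h1 : projMatrix (inputSpace φ) *ᵥ ψ.ofLp = ψ.ofLp := by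
        rw [projMatrix_mulVec, Submodule.starProjection_eq_self_iff.mpr hψ]
      have h2 : projMatrix (inputSpace φ) *ᵥ (φ 0).ofLp = (φ 0).ofLp := by
        rw [projMatrix_mulVec, Submodule.starProjection_eq_self_iff.mpr (mem_inputSpace φ 0)]
      have h3 : star (φ 0).ofLp ᵥ* projMatrix (inputSpace φ) = star (φ 0).ofLp := by
        conv_rhs => rw [← h2]
        rw [Matrix.star_mulVec, projMatrix_conjTranspose]
      change _ * _ * _ = _
      rw [Matrix.mul_vecMulVec, h1, Matrix.vecMulVec_mul, h3]
    have h1 := congrArg (fun Y => Y *ᵥ (φ 0).ofLp) (hall _ hmem).eq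
    simp only [← Matrix.mulVec_mulVec, hXφ, Matrix.mulVec_zero, Matrix.vecMulVec_mulVec,
      star_dotProduct_self _ (hφ 0)] at h1
    simpa using h1.symm
  have hXin : X * projMatrix (inputSpace φ) = 0 := by
    refine Matrix.ext_iff_mulVec.mpr fun v => ?_
    have h1 := projMatrix_mulVec (inputSpace φ) (WithLp.toLp 2 v)
    rw [← Matrix.mulVec_mulVec, h1, hker _ (Submodule.starProjection_apply_mem _ _),
      Matrix.zero_mulVec]
  have hPin : perpProj φ * projMatrix (inputSpace φ) = perpProj φ := by
    rw [perpProj_eq (hφ 0), sub_mul, projMatrix_mul_self,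
      ketbra_mul_projMatrix (mem_inputSpace φ 0)]
  calc X = perpProj φ * X * perpProj φ := by rw [hPX, hXP]
    _ = perpProj φ * X * projMatrix (inputSpace φ) * perpProj φ := by
        have h4 := congrArg Matrix.conjTranspose hPin
        rw [Matrix.conjTranspose_mul, hP, projMatrix_conjTranspose] at h4
        rw [mul_assoc _ (projMatrix _), h4]
    _ = 0 := by rw [mul_assoc (perpProj φ), hXin, mul_zero, zero_mul]

theorem finite_setOf_hasEigenvalue (φ : Fin (K + 1) → EuclideanSpace ℂ (Fin d)) :
    {μ : ℝ | Module.End.HasEigenvalue (Matrix.toLin' (perpOperator φ)) (μ : ℂ)}.Finite :=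
  Set.Finite.preimage Complex.ofReal_injective.injOn
    (Module.End.finite_hasEigenvalue (Matrix.toLin' (perpOperator φ)))

theorem le_lambdaPerp {μ : ℝ}
    (h : Module.End.HasEigenvalue (Matrix.toLin' (perpOperator φ)) (μ : ℂ)) : μ ≤ lambdaPerp φ :=
  le_csSup (finite_setOf_hasEigenvalue φ).bddAbove h

theorem lambdaPerp_nonneg (hφ : ∀ i, ‖φ i‖ = 1) : 0 ≤ lambdaPerp φ :=
  le_lambdaPerp (hasEigenvalue_zero hφ)

theorem lambdaPerp_lt_one (hφ : ∀ i, ‖φ i‖ = 1) (hgen : GeneratesFullAlgebra φ) :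
    lambdaPerp φ < 1 := by
  have hmem : lambdaPerp φ ∈
      {μ : ℝ | Module.End.HasEigenvalue (Matrix.toLin' (perpOperator φ)) (μ : ℂ)} :=
    Set.Nonempty.csSup_mem ⟨0, hasEigenvalue_zero hφ⟩ (finite_setOf_hasEigenvalue φ)
  refine lt_of_le_of_ne ((le_abs_self _).trans (abs_le_one_of_hasEigenvalue hφ hmem)) fun h1 => ?_
  rw [h1] at hmem
  obtain ⟨X, hX, h⟩ := (hasEigenvalue_perpOperator_iff _).mp hmem
  exact hX (eq_zero_of_perpMap_eq hφ hgen (by simpa using h))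

/-- The spectrum of the averaged reflections lies in `[-1, λ_⊥]`, so that the sum with the identity
has norm at most `1 + λ_⊥`. -/
theorem norm_hsVec_add_perpMap_le (hφ : ∀ i, ‖φ i‖ = 1) (X : Matrix (Fin d) (Fin d) ℂ) :
    ‖hsVec (X + perpMap φ X)‖ ≤ (1 + lambdaPerp φ) * ‖hsVec X‖ := by
  have hM := perpOperator_isHermitian φ
  set b := hM.eigenvectorBasis
  have hinner : ∀ i, inner ℂ (b i) (hsVec (X + perpMap φ X)) =
      ((1 + hM.eigenvalues i : ℝ) : ℂ) * inner ℂ (b i) (hsVec X) := by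
    intro i
    have h1 : inner ℂ (b i) (hsVec (perpMap φ X)) =
        (hM.eigenvalues i : ℂ) * inner ℂ (b i) (hsVec X) := by
      have h2 : hsVec (perpMap φ X) =
          Matrix.toEuclideanCLM (n := Fin d × Fin d) (𝕜 := ℂ) (perpOperator φ) (hsVec X) := by
        apply WithLp.ofLp_injective
        rw [Matrix.ofLp_toEuclideanCLM, perpOperator_mulVec_hsVec]
      have h3 : Matrix.toEuclideanCLM (n := Fin d × Fin d) (𝕜 := ℂ) (perpOperator φ) (b i) =
          (hM.eigenvalues i : ℂ) • b i := by
        apply WithLp.ofLp_injective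
        rw [Matrix.ofLp_toEuclideanCLM, hM.mulVec_eigenvectorBasis]; rfl
      have h4 : IsSelfAdjoint
          (Matrix.toEuclideanCLM (n := Fin d × Fin d) (𝕜 := ℂ) (perpOperator φ)) := by
        rw [IsSelfAdjoint, ← map_star, Matrix.star_eq_conjTranspose, hM.eq]
      rw [h2, ← ContinuousLinearMap.adjoint_inner_left, h4.adjoint_eq, h3, inner_smul_left,
        Complex.conj_ofReal]
    rw [map_add, inner_add_right, h1]; push_cast; ring
  have heig : ∀ i, |1 + hM.eigenvalues i| ≤ 1 + lambdaPerp φ := by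
    intro i
    have hev : Module.End.HasEigenvalue (Matrix.toLin' (perpOperator φ))
        (hM.eigenvalues i : ℂ) := by
      refine Module.End.hasEigenvalue_of_hasEigenvector (x := (b i).ofLp)
        ⟨Module.End.mem_eigenspace_iff.mpr ?_, fun h0 => ?_⟩
      · rw [Matrix.toLin'_apply, hM.mulVec_eigenvectorBasis]; rfl
      · have h1 := b.norm_eq_one i
        rw [show b i = 0 from WithLp.ofLp_injective 2 h0, norm_zero] at h1
        exact zero_ne_one h1
    have h1 := abs_le.mp (abs_le_one_of_hasEigenvalue hφ hev)
    rw [abs_of_nonneg (by linarith)]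
    linarith [le_lambdaPerp hev]
  have hl := lambdaPerp_nonneg hφ
  refine le_of_sq_le_sq ?_ (by positivity)
  rw [mul_pow, ← b.sum_sq_norm_inner_right, ← b.sum_sq_norm_inner_right (hsVec X), Finset.mul_sum]
  refine Finset.sum_le_sum fun i _ => ?_
  rw [hinner, norm_mul, mul_pow, Complex.norm_real, Real.norm_eq_abs]
  exact mul_le_mul_of_nonneg_right (pow_le_pow_left₀ (abs_nonneg _) (heig i) 2) (sq_nonneg _)

/-! ### The lazy random walk of reflections -/

/-- The law of one step of the walk: with probability `1/2` the reference state, otherwise a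
uniformly random other input. Choosing the reference is a lazy step, since the reflection about it
acts on its orthogonal complement as the identity; laziness makes the averaged map positive, so that
only its largest eigenvalue matters. For `K = 0` (where `K * (2 * K)⁻¹ = 0`) the law is the point
mass at the reference. -/
def walkWeight (K : ℕ) : Fin (K + 1) → ℝ :=
  Fin.cons (1 - K * (2 * K : ℝ)⁻¹) fun _ => (2 * K : ℝ)⁻¹

theorem walkWeight_zero_of_pos {K : ℕ} (hK : 0 < K) : walkWeight K 0 = 1 / 2 := by
  have : (K : ℝ) ≠ 0 := by exact_mod_cast hK.ne'
  simp only [walkWeight, Fin.cons_zero]; field_simp; norm_num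

theorem walkWeight_succ {K : ℕ} (k : Fin K) : walkWeight K k.succ = (2 * K : ℝ)⁻¹ := by
  simp [walkWeight]

theorem walkWeight_nonneg {K : ℕ} (k : Fin (K + 1)) : 0 ≤ walkWeight K k := by
  refine Fin.cases ?_ (fun k => ?_) k
  · rcases Nat.eq_zero_or_pos K with rfl | hK
    · simp [walkWeight]
    · rw [walkWeight_zero_of_pos hK]; norm_num
  · rw [walkWeight_succ]; positivity

theorem sum_walkWeight (K : ℕ) : ∑ k, walkWeight K k = 1 := by
  rw [Fin.sum_univ_succ]
  simp [walkWeight]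

/-- The expectation of `F` over the random list of the first `T` steps of the walk. -/
def walkAvg {V : Type*} [AddCommGroup V] [Module ℂ V] (K : ℕ) :
    ℕ → (List (Fin (K + 1)) → V) → V
  | 0, F => F []
  | T + 1, F => ∑ k, (walkWeight K k : ℂ) • walkAvg K T fun ks => F (k :: ks)

section walkAvg

variable {V W : Type*} [AddCommGroup V] [Module ℂ V] [AddCommGroup W] [Module ℂ W] {K : ℕ}

theorem map_walkAvg (f : V →ₗ[ℂ] W) (T : ℕ) (F : List (Fin (K + 1)) → V) :
    f (walkAvg K T F) = walkAvg K T fun ks => f (F ks) := by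
  induction T generalizing F with
  | zero => rfl
  | succ T ih => simp only [walkAvg, map_sum, map_smul, ih]

theorem walkAvg_congr {T : ℕ} {F G : List (Fin (K + 1)) → V}
    (h : ∀ ks, ks.length = T → F ks = G ks) : walkAvg K T F = walkAvg K T G := by
  induction T generalizing F G with
  | zero => exact h [] rfl
  | succ T ih =>
    simp only [walkAvg]
    exact Finset.sum_congr rfl fun k _ => by
      rw [ih fun ks hks => h (k :: ks) (by simp [hks])]

theorem walkAvg_add (T : ℕ) (F G : List (Fin (K + 1)) → V) :
    walkAvg K T (fun ks => F ks + G ks) = walkAvg K T F + walkAvg K T G := by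
  induction T generalizing F G with
  | zero => rfl
  | succ T ih => simp only [walkAvg, ih, smul_add, Finset.sum_add_distrib]

theorem walkAvg_neg (T : ℕ) (F : List (Fin (K + 1)) → V) :
    walkAvg K T (fun ks => -F ks) = -walkAvg K T F :=
  (map_walkAvg (-LinearMap.id) T F).symm

theorem walkAvg_const (T : ℕ) (v : V) : walkAvg K T (fun _ => v) = v := by
  induction T with
  | zero => rfl
  | succ T ih =>
    simp only [walkAvg, ih]
    rw [← Finset.sum_smul, ← Complex.ofReal_sum, sum_walkWeight]; simp

theorem norm_walkAvg_le {T : ℕ} {f g : List (Fin (K + 1)) → ℂ} (h : ∀ ks, ‖f ks‖ ≤ (g ks).re) :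
    ‖walkAvg K T f‖ ≤ (walkAvg K T g).re := by
  induction T generalizing f g with
  | zero => exact h []
  | succ T ih =>
    simp only [walkAvg, Complex.re_sum]
    refine (norm_sum_le _ _).trans (Finset.sum_le_sum fun k _ => ?_)
    rw [norm_smul, Complex.norm_real, Real.norm_of_nonneg (walkWeight_nonneg k), smul_eq_mul,
      Complex.re_ofReal_mul]
    exact mul_le_mul_of_nonneg_left (ih fun ks => h (k :: ks)) (walkWeight_nonneg k)

end walkAvg

variable {d K : ℕ}

/-- The Kraus operator, on the part of the input space orthogonal to the reference state, of the
event that a walk along the given list of reflections never finds the reference state. -/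
def missOp (φ : Fin (K + 1) → EuclideanSpace ℂ (Fin d)) :
    List (Fin (K + 1)) → Matrix (Fin d) (Fin d) ℂ
  | [] => perpProj φ
  | k :: ks => missOp φ ks * perpReflection φ k

/-- The effect `missOpᴴ * missOp` of never finding the reference state. -/
def missEffect (φ : Fin (K + 1) → EuclideanSpace ℂ (Fin d)) (ks : List (Fin (K + 1))) :
    Matrix (Fin d) (Fin d) ℂ :=
  (missOp φ ks)ᴴ * missOp φ ks

variable {φ : Fin (K + 1) → EuclideanSpace ℂ (Fin d)}

theorem missEffect_nil : missEffect φ [] = perpProj φ := by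
  rw [missEffect, missOp, perpProj_conjTranspose, perpProj_mul_self]

theorem missEffect_cons (k : Fin (K + 1)) (ks : List (Fin (K + 1))) :
    missEffect φ (k :: ks) = perpReflection φ k * missEffect φ ks * perpReflection φ k := by
  simp only [missEffect, missOp, Matrix.conjTranspose_mul, perpReflection_conjTranspose, mul_assoc]

theorem missEffect_conjTranspose (ks : List (Fin (K + 1))) :
    (missEffect φ ks)ᴴ = missEffect φ ks := by
  simp [missEffect, Matrix.conjTranspose_mul]

theorem perpProj_mul_missEffect (ks : List (Fin (K + 1))) :
    perpProj φ * missEffect φ ks = missEffect φ ks := by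
  cases ks with
  | nil => rw [missEffect_nil, perpProj_mul_self]
  | cons k ks => rw [missEffect_cons, ← mul_assoc, ← mul_assoc, perpProj_mul_perpReflection]

theorem missEffect_mul_perpProj (ks : List (Fin (K + 1))) :
    missEffect φ ks * perpProj φ = missEffect φ ks := by
  cases ks with
  | nil => rw [missEffect_nil, perpProj_mul_self]
  | cons k ks => rw [missEffect_cons, mul_assoc, perpReflection_mul_perpProj]

theorem opNorm_missOp_le (hφ : ∀ i, ‖φ i‖ = 1) (ks : List (Fin (K + 1))) :
    opNorm (missOp φ ks) ≤ 1 := by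
  induction ks with
  | nil => exact opNorm_projMatrix_le _
  | cons k ks ih => exact opNorm_mul_le_one ih (opNorm_perpReflection_le k (hφ k))

theorem perpProj_eq_zero {φ : Fin (0 + 1) → EuclideanSpace ℂ (Fin d)} : perpProj φ = 0 := by
  have h : inputSpace φ ⊓ (Submodule.span ℂ {φ 0})ᗮ = ⊥ := by
    have : Set.range φ = {φ 0} := by
      ext v; constructor
      · rintro ⟨i, rfl⟩
        rw [show i = 0 from Fin.ext (by omega)]; rfl
      · rintro rfl; exact ⟨0, rfl⟩
    rw [inputSpace, this, Submodule.inf_orthogonal_eq_bot]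
  rw [perpProj, h, projMatrix, Submodule.starProjection_bot, map_zero]

/-- On average over the walk, the effect of missing the reference state decays exponentially: one
more step is half the sum of the identity and the averaged reflections. -/
theorem norm_hsVec_walkAvg_missEffect_le (hφ : ∀ i, ‖φ i‖ = 1) (T : ℕ) :
    ‖hsVec (walkAvg K T (missEffect φ))‖ ≤
      ((1 + lambdaPerp φ) / 2) ^ T * √(Module.finrank ℂ (inputSpace φ)) := by
  have hl := lambdaPerp_nonneg hφ
  induction T with
  | zero =>
    rw [pow_zero, one_mul]
    apply Real.le_sqrt_of_sq_le
    have h1 := norm_sq_hsVec_eq_trace (perpProj φ)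
    rw [perpProj_conjTranspose, perpProj_mul_self, perpProj, trace_projMatrix] at h1
    have h2 : ‖hsVec (perpProj φ)‖ ^ 2 =
        (Module.finrank ℂ (inputSpace φ ⊓ (Submodule.span ℂ {φ 0})ᗮ :
          Submodule ℂ (EuclideanSpace ℂ (Fin d))) : ℝ) := by exact_mod_cast h1
    rw [walkAvg, missEffect_nil, h2]
    exact_mod_cast Submodule.finrank_mono inf_le_left
  | succ T ih =>
    set S := walkAvg K T (missEffect φ) with hS
    have hPS : perpProj φ * S * perpProj φ = S := by
      have := map_walkAvg ((LinearMap.mulRight ℂ (perpProj φ)).comp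
        (LinearMap.mulLeft ℂ (perpProj φ))) T (missEffect φ)
      simpa only [LinearMap.comp_apply, LinearMap.mulRight_apply, LinearMap.mulLeft_apply,
        perpProj_mul_missEffect, missEffect_mul_perpProj] using this
    have hstep : ∀ k, walkAvg K T (fun ks => missEffect φ (k :: ks)) =
        perpReflection φ k * S * perpReflection φ k := by
      intro k
      have := map_walkAvg ((LinearMap.mulRight ℂ (perpReflection φ k)).comp
        (LinearMap.mulLeft ℂ (perpReflection φ k))) T (missEffect φ)
      simp only [LinearMap.comp_apply, LinearMap.mulRight_apply, LinearMap.mulLeft_apply] at this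
      simp only [missEffect_cons]
      exact this.symm
    have hrec : walkAvg K (T + 1) (missEffect φ) = (1 / 2 : ℂ) • (S + perpMap φ S) := by
      simp only [walkAvg, hstep]
      rcases Nat.eq_zero_or_pos K with rfl | hK
      · have h0 : S = 0 := by rw [← hPS, perpProj_eq_zero, mul_zero]
        simp [h0, perpMap]
      · rw [Fin.sum_univ_succ, walkWeight_zero_of_pos hK, perpReflection_zero (hφ 0), hPS, smul_add,
          perpMap, smul_smul, Finset.smul_sum]
        congr 1
        · simp
        · refine Finset.sum_congr rfl fun k _ => ?_
          rw [walkWeight_succ]; congr 1; push_cast; rw [mul_inv]; norm_num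
    rw [hrec, map_smul, norm_smul, pow_succ]
    have h1 := norm_hsVec_add_perpMap_le hφ S
    have h2 : ‖(1 / 2 : ℂ)‖ = 1 / 2 := by norm_num
    rw [h2]
    have h3 := mul_le_mul_of_nonneg_left ih (by positivity : 0 ≤ (1 + lambdaPerp φ) / 2)
    linarith

/-- The operator to which the coherent walk compresses: `G = σ₀` without steps, and
`G ↦ σ₀ G σ₀ + Q R_k G R_k Q` with one more first step, where `σ₀` projects on the reference state,
`Q = 1 - σ₀` and `R_k = 1 - 2σ_k`. On the input space it is the effect of finding the reference
state. -/
def returnOp {n : Type*} [Fintype n] [DecidableEq n] (σ : Fin (K + 1) → Matrix n n ℂ) :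
    List (Fin (K + 1)) → Matrix n n ℂ
  | [] => σ 0
  | k :: ks => σ 0 * returnOp σ ks * σ 0 +
      (1 - σ 0) * (1 - (2 : ℂ) • σ k) * returnOp σ ks * (1 - (2 : ℂ) • σ k) * (1 - σ 0)

theorem returnOp_conjTranspose {n : Type*} [Fintype n] [DecidableEq n]
    {σ : Fin (K + 1) → Matrix n n ℂ} (hσ : ∀ k, (σ k)ᴴ = σ k) (ks : List (Fin (K + 1))) :
    (returnOp σ ks)ᴴ = returnOp σ ks := by
  induction ks with
  | nil => exact hσ 0
  | cons k ks ih =>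
    simp [returnOp, Matrix.conjTranspose_mul, Matrix.conjTranspose_sub, Matrix.conjTranspose_smul,
      hσ, ih, mul_assoc]

/-- On the input space the effects of finding and of missing the reference state are
complementary. -/
theorem returnOp_mul_projMatrix (hφ : ∀ i, ‖φ i‖ = 1) (ks : List (Fin (K + 1))) :
    returnOp (fun k => ketbra (φ k)) ks * projMatrix (inputSpace φ) =
      projMatrix (inputSpace φ) - missEffect φ ks := by
  set P := projMatrix (inputSpace φ) with hP
  have hPP : P * P = P := projMatrix_mul_self _
  have hσP : ∀ k, ketbra (φ k) * P = ketbra (φ k) := fun k =>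
    ketbra_mul_projMatrix (mem_inputSpace φ k)
  have hPσ : ∀ k, P * ketbra (φ k) = ketbra (φ k) := fun k =>
    projMatrix_mul_ketbra (mem_inputSpace φ k)
  have hperp : perpProj φ = P - ketbra (φ 0) := perpProj_eq (hφ 0)
  have hPperp : P * perpProj φ = perpProj φ := by rw [hperp, mul_sub, hPP, hPσ]
  induction ks with
  | nil => rw [returnOp, hσP, missEffect_nil, hperp]; abel
  | cons k ks ih =>
    set G := returnOp (fun k => ketbra (φ k)) ks
    set S := missEffect φ ks with hS
    set R := (1 - (2 : ℂ) • ketbra (φ k)) with hR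
    set Q := 1 - ketbra (φ 0) with hQ
    have hRP : R * P = P * R := by
      simp only [hR, sub_mul, mul_sub, smul_mul_assoc, mul_smul_comm, hσP, hPσ, one_mul, mul_one]
    have hRR : R * R = 1 := by
      simp only [hR, sub_mul, mul_sub, one_mul, mul_one, smul_mul_assoc, mul_smul_comm,
        ketbra_mul_self _ (hφ k)]
      module
    have hQP : Q * P = perpProj φ := by rw [hQ, sub_mul, one_mul, hσP, hperp]
    have hSσ : S * ketbra (φ 0) = 0 := by
      rw [hS, ← missEffect_mul_perpProj, mul_assoc, perpProj_mul_ketbra_zero (hφ 0), mul_zero]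
    have hA : perpReflection φ k = perpProj φ * R * perpProj φ := perpReflection_eq φ k
    have hPS : perpProj φ * S = S := perpProj_mul_missEffect ks
    have hSP : S * perpProj φ = S := missEffect_mul_perpProj ks
    have hPinS : P * S = S := by rw [← hPS, ← mul_assoc, hPperp]
    clear_value Q R
    have h1 : ketbra (φ 0) * G * ketbra (φ 0) = ketbra (φ 0) := by
      rw [← hPσ 0, mul_assoc, ← mul_assoc G, ih, hPσ, sub_mul, hPσ, hSσ, sub_zero,
        ketbra_mul_self _ (hφ 0)]
    have h2 : Q * R * G * R * Q * P = perpProj φ - perpReflection φ k * S * perpReflection φ k := by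
      calc Q * R * G * R * Q * P = Q * R * (G * (R * (Q * P))) := by simp only [mul_assoc]
        _ = Q * R * (G * P * (R * perpProj φ)) := by
            rw [hQP, mul_assoc G, ← mul_assoc P, ← hRP, mul_assoc R, hPperp]
        _ = Q * (R * P) * R * perpProj φ - Q * (R * (S * (R * perpProj φ))) := by
            rw [ih]; simp only [sub_mul, mul_sub, mul_assoc]
        _ = perpProj φ - Q * (R * (S * (R * perpProj φ))) := by
            rw [hRP, ← mul_assoc, hQP, mul_assoc (perpProj φ), hRR, mul_one, perpProj_mul_self]
        _ = perpProj φ - Q * (R * P) * (perpProj φ * S * (perpProj φ * (R * perpProj φ))) := by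
            rw [hPS, ← mul_assoc S (perpProj φ), hSP]
            simp only [mul_assoc]
            rw [← mul_assoc P S, hPinS]
        _ = perpProj φ - perpReflection φ k * S * perpReflection φ k := by
            rw [hRP, ← mul_assoc Q, hQP, hA]; simp only [mul_assoc]
    rw [returnOp, missEffect_cons, add_mul, ← hR, ← hQ, h1, hσP, h2, hperp]
    abel

/-- The compressed walk acts on the input space as the identity, up to the small average of the
effect of missing the reference state. -/
theorem norm_trace_sub_walkAvg_le (hφ : ∀ i, ‖φ i‖ = 1) {ρ : Matrix (Fin d) (Fin d) ℂ}
    (hρ : IsDensity ρ) (hin : ρ ∈ operatorsOn (inputSpace φ)) (X : Matrix (Fin d) (Fin d) ℂ)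
    (T : ℕ) :
    ‖walkAvg K T (fun ks => (X * (returnOp (fun k => ketbra (φ k)) ks * ρ *
        returnOp (fun k => ketbra (φ k)) ks)).trace) - (X * ρ).trace‖ ≤
      3 * opNorm X * (((1 + lambdaPerp φ) / 2) ^ T * √(Module.finrank ℂ (inputSpace φ))) := by
  have hrho : projMatrix (inputSpace φ) * ρ * projMatrix (inputSpace φ) = ρ := hin
  have hPρ : projMatrix (inputSpace φ) * ρ = ρ := by
    conv_rhs => rw [← hrho]
    conv_lhs => rw [← hrho]
    simp only [← mul_assoc, projMatrix_mul_self]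
  have hρP : ρ * projMatrix (inputSpace φ) = ρ := by
    conv_rhs => rw [← hrho]
    conv_lhs => rw [← hrho]
    simp only [mul_assoc, projMatrix_mul_self]
  have hterm : ∀ ks, (X * (returnOp (fun k => ketbra (φ k)) ks * ρ *
      returnOp (fun k => ketbra (φ k)) ks)).trace =
      (X * ρ).trace + (-(X * (missEffect φ ks * ρ)).trace + (-((X * (ρ * missEffect φ ks)).trace) +
        (X * (missEffect φ ks * ρ * missEffect φ ks)).trace)) := by
    intro ks
    have h1 : returnOp (fun k => ketbra (φ k)) ks * ρ = ρ - missEffect φ ks * ρ := by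
      conv_lhs => rw [← hPρ, ← mul_assoc, returnOp_mul_projMatrix hφ, sub_mul, hPρ]
    have h2 : ρ * returnOp (fun k => ketbra (φ k)) ks = ρ - ρ * missEffect φ ks := by
      have h3 := congrArg Matrix.conjTranspose (returnOp_mul_projMatrix hφ ks)
      rw [Matrix.conjTranspose_mul, Matrix.conjTranspose_sub, projMatrix_conjTranspose,
        missEffect_conjTranspose,
        returnOp_conjTranspose (fun k => ketbra_conjTranspose (φ k))] at h3
      conv_lhs => rw [← hρP, mul_assoc, h3, mul_sub, hρP]
    rw [h1, sub_mul, h2, mul_assoc, h2]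
    simp only [mul_sub, Matrix.trace_sub, mul_assoc]
    ring
  simp only [hterm]
  rw [walkAvg_add, walkAvg_add, walkAvg_add, walkAvg_const, walkAvg_neg, walkAvg_neg]
  set S := walkAvg K T (missEffect φ) with hS
  have hb := norm_hsVec_walkAvg_missEffect_le hφ T
  rw [← hS] at hb
  set b := ((1 + lambdaPerp φ) / 2) ^ T * √(Module.finrank ℂ (inputSpace φ))
  have hr := norm_hsVec_le_one_of_isDensity hρ
  have hprod : ∀ Y : Matrix (Fin d) (Fin d) ℂ, ‖hsVec (ρ * Y)‖ ≤ opNorm Y := fun Y =>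
    (norm_hsVec_mul_le' ρ Y).trans (mul_le_of_le_one_right (opNorm_nonneg Y) hr)
  have hprod' : ∀ Y : Matrix (Fin d) (Fin d) ℂ, ‖hsVec (Y * ρ)‖ ≤ opNorm Y := fun Y =>
    (norm_hsVec_mul_le Y ρ).trans (mul_le_of_le_one_right (opNorm_nonneg Y) hr)
  have h1 : walkAvg K T (fun ks => (X * (missEffect φ ks * ρ)).trace) = (S * (ρ * X)).trace := by
    have := map_walkAvg ((Matrix.traceLinearMap (Fin d) ℂ ℂ).comp
      (LinearMap.mulRight ℂ (ρ * X))) T (missEffect φ)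
    simp only [LinearMap.comp_apply, LinearMap.mulRight_apply, Matrix.traceLinearMap_apply] at this
    rw [this]
    refine walkAvg_congr fun ks _ => ?_
    rw [Matrix.trace_mul_comm, mul_assoc]
  have h2 : walkAvg K T (fun ks => (X * (ρ * missEffect φ ks)).trace) = (X * ρ * S).trace := by
    have := map_walkAvg ((Matrix.traceLinearMap (Fin d) ℂ ℂ).comp
      (LinearMap.mulLeft ℂ (X * ρ))) T (missEffect φ)
    simp only [LinearMap.comp_apply, LinearMap.mulLeft_apply, Matrix.traceLinearMap_apply] at this
    rw [this]
    exact walkAvg_congr fun ks _ => by rw [mul_assoc]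
  have h3 : ‖walkAvg K T (fun ks => (X * (missEffect φ ks * ρ * missEffect φ ks)).trace)‖ ≤
      opNorm X * (S * ρ).trace.re := by
    have hm := map_walkAvg (((opNorm X : ℂ) • Matrix.traceLinearMap (Fin d) ℂ ℂ).comp
      (LinearMap.mulRight ℂ ρ)) T (missEffect φ)
    simp only [LinearMap.comp_apply, LinearMap.mulRight_apply, Matrix.traceLinearMap_apply,
      LinearMap.smul_apply] at hm
    rw [← Complex.re_ofReal_mul, ← smul_eq_mul, hS, hm]
    refine norm_walkAvg_le fun ks => ?_
    -- with `B = missOp`, the trace is that of `B X Bᴴ` against the positive operator `B ρ Bᴴ`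
    have e1 : (X * (missEffect φ ks * ρ * missEffect φ ks)).trace =
        (missOp φ ks * X * (missOp φ ks)ᴴ * (missOp φ ks * ρ * (missOp φ ks)ᴴ)).trace := by
      simp only [missEffect, ← mul_assoc]
      rw [Matrix.trace_mul_comm]
      simp only [← mul_assoc]
    have e2 : (missEffect φ ks * ρ).trace = (missOp φ ks * ρ * (missOp φ ks)ᴴ).trace := by
      rw [missEffect, mul_assoc, Matrix.trace_mul_comm]
    rw [e1, smul_eq_mul, Complex.re_ofReal_mul, e2]
    have hpos : (missOp φ ks * ρ * (missOp φ ks)ᴴ).PosSemidef :=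
      hρ.1.mul_mul_conjTranspose_same _
    refine (norm_trace_mul_le_of_posSemidef _ hpos).trans
      (mul_le_mul_of_nonneg_right ?_ (Complex.le_def.mp hpos.trace_nonneg).1)
    have hm := opNorm_missOp_le hφ ks
    refine (opNorm_mul_le _ _).trans ?_
    rw [opNorm_conjTranspose]
    refine (mul_le_of_le_one_right (opNorm_nonneg _) hm).trans ((opNorm_mul_le _ _).trans ?_)
    exact mul_le_of_le_one_left (opNorm_nonneg _) hm
  have hX := opNorm_nonneg X
  have hSn := norm_nonneg (hsVec S)
  have b1 : ‖(S * (ρ * X)).trace‖ ≤ opNorm X * b := by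
    refine (norm_trace_mul_le _ _).trans ?_
    rw [mul_comm]
    exact mul_le_mul (hprod X) hb hSn hX
  have b2 : ‖(X * ρ * S).trace‖ ≤ opNorm X * b :=
    (norm_trace_mul_le _ _).trans (mul_le_mul (hprod' X) hb hSn hX)
  have b3 : (S * ρ).trace.re ≤ b := by
    refine ((Complex.re_le_norm _).trans (norm_trace_mul_le _ _)).trans ?_
    exact (mul_le_of_le_one_right hSn hr).trans hb
  rw [h1, h2, add_sub_cancel_left]
  refine (norm_add_le _ _).trans ?_
  refine (add_le_add_right (norm_add_le _ _) _).trans ?_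
  rw [norm_neg, norm_neg]
  have := mul_le_mul_of_nonneg_left b3 hX
  linarith

/-! ### Operators of one- and two-qubit gates -/

section Gates

variable {n s a : ℕ}

theorem gate1Op_mul_apply (w : Wire n s a) (u : Matrix (Fin 2) (Fin 2) ℂ) (X : Op n s a)
    (c c' : Config n s a) :
    (gate1Op w u * X) c c' = ∑ e : Fin 2, u (c w) e * X (Function.update c w e) c' := by
  rw [Matrix.mul_apply]
  symm
  refine Fintype.sum_of_injective (fun e => Function.update c w e)
    (Function.update_injective c w) _ _ ?_ ?_
  · intro c'' hc
    rw [gate1Op, if_neg, zero_mul]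
    refine fun h => hc ⟨c'' w, ?_⟩
    ext v
    by_cases hv : v = w
    · subst hv; simp
    · simp [hv, h v hv]
  · intro e
    rw [gate1Op, if_pos fun v hv => by simp [hv]]
    simp

theorem gate1Op_conj_apply (w : Wire n s a) (u : Matrix (Fin 2) (Fin 2) ℂ) (X : Op n s a)
    (c c' : Config n s a) :
    (gate1Op w u * X * (gate1Op w u)ᴴ) c c' = ∑ e : Fin 2, ∑ e' : Fin 2,
      u (c w) e * X (Function.update c w e) (Function.update c' w e') * star (u (c' w) e') := by
  have h : gate1Op w u * X * (gate1Op w u)ᴴ = (gate1Op w u * (gate1Op w u * X)ᴴ)ᴴ := by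
    rw [Matrix.conjTranspose_mul, Matrix.conjTranspose_conjTranspose]
  rw [h, Matrix.conjTranspose_apply, gate1Op_mul_apply, star_sum, Finset.sum_comm]
  refine Finset.sum_congr rfl fun e' _ => ?_
  rw [Matrix.conjTranspose_apply, gate1Op_mul_apply, star_mul', star_star, mul_comm,
    Finset.sum_mul]

/-- The operator that permutes (or, for a general `f`, pulls back along `f`) the basis labels. -/
def pullOp (f : Config n s a → Config n s a) : Op n s a := fun c c' => if f c = c' then 1 else 0

theorem pullOp_mul_apply (f : Config n s a → Config n s a) (X : Op n s a) (c c' : Config n s a) :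
    (pullOp f * X) c c' = X (f c) c' := by
  simp [Matrix.mul_apply, pullOp]

theorem mul_pullOp_conjTranspose_apply (f : Config n s a → Config n s a) (X : Op n s a)
    (c c' : Config n s a) : (X * (pullOp f)ᴴ) c c' = X c (f c') := by
  simp [Matrix.mul_apply, pullOp, apply_ite]

theorem pullOp_conj (f : Config n s a → Config n s a) (X : Op n s a) :
    pullOp f * X * (pullOp f)ᴴ = X.submatrix f f := by
  ext c c'
  rw [mul_pullOp_conjTranspose_apply, pullOp_mul_apply, Matrix.submatrix_apply]

/-- A family of two-qubit operators on the wires `w, w'`, selected by the value of wire `v`. -/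
def selectOp (v w w' : Wire n s a) (F : Fin 2 → Matrix (Fin 2 × Fin 2) (Fin 2 × Fin 2) ℂ) :
    Op n s a :=
  fun c c' => if ∀ x, x ≠ w → x ≠ w' → c x = c' x then F (c v) (c w, c w') (c' w, c' w') else 0

theorem gate2Op_eq_selectOp (v w w' : Wire n s a) (u : Matrix (Fin 2 × Fin 2) (Fin 2 × Fin 2) ℂ) :
    gate2Op w w' u = selectOp v w w' fun _ => u := rfl

theorem selectOp_mul_of_update {v w w' : Wire n s a} (hww' : w ≠ w')
    (F G : Fin 2 → Matrix (Fin 2 × Fin 2) (Fin 2 × Fin 2) ℂ)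
    (hG : ∀ (c : Config n s a) x x',
      G (Function.update (Function.update c w x) w' x' v) = G (c v)) :
    selectOp v w w' F * selectOp v w w' G = selectOp v w w' (F * G) := by
  ext c c'
  rw [Matrix.mul_apply]
  have key : ∀ p : Fin 2 × Fin 2,
      F (c v) (c w, c w') p * selectOp v w w' G
        (Function.update (Function.update c w p.1) w' p.2) c' =
      selectOp v w w' F c (Function.update (Function.update c w p.1) w' p.2) *
        selectOp v w w' G (Function.update (Function.update c w p.1) w' p.2) c' := by
    intro p
    congr 1
    rw [selectOp, if_pos fun x hx hx' => by simp [hx, hx']]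
    simp [hww']
  rw [← Fintype.sum_of_injective
    (fun p : Fin 2 × Fin 2 => Function.update (Function.update c w p.1) w' p.2) ?_ _ _ ?_ key]
  · by_cases hc : ∀ x, x ≠ w → x ≠ w' → c x = c' x
    · simp only [selectOp]
      rw [if_pos hc, Pi.mul_apply, Matrix.mul_apply]
      refine Finset.sum_congr rfl fun p _ => ?_
      rw [if_pos fun x hx hx' => by simp [hx, hx', hc x hx hx']]
      rw [hG]
      simp [hww']
    · simp only [selectOp]
      rw [if_neg hc]
      refine Finset.sum_eq_zero fun p _ => ?_
      rw [if_neg fun h => hc fun x hx hx' => by simpa [hx, hx'] using h x hx hx', mul_zero]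
  · intro p q h
    have h1 := congrFun h w
    have h2 := congrFun h w'
    simp only [Function.update_self, ne_eq, hww', not_false_eq_true, Function.update_of_ne] at h1 h2
    exact Prod.ext h1 h2
  · intro c'' hc
    rw [selectOp, if_neg, zero_mul]
    refine fun h => hc ⟨(c'' w, c'' w'), ?_⟩
    ext x
    by_cases hx' : x = w'
    · subst hx'; simp
    · by_cases hx : x = w
      · subst hx; simp [hx']
      · simp [hx, hx', h x hx hx']

theorem selectOp_mul {v w w' : Wire n s a} (hvw : v ≠ w) (hvw' : v ≠ w') (hww' : w ≠ w')
    (F G : Fin 2 → Matrix (Fin 2 × Fin 2) (Fin 2 × Fin 2) ℂ) :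
    selectOp v w w' F * selectOp v w w' G = selectOp v w w' (F * G) :=
  selectOp_mul_of_update hww' F G fun c x x' => by simp [hvw, hvw']

theorem gate2Op_mul {w w' : Wire n s a} (hww' : w ≠ w')
    (u v : Matrix (Fin 2 × Fin 2) (Fin 2 × Fin 2) ℂ) :
    gate2Op w w' u * gate2Op w w' v = (gate2Op w w' (u * v) : Op n s a) :=
  selectOp_mul_of_update (v := w) hww' (fun _ => u) (fun _ => v) fun _ _ _ => rfl

/-- The two-qubit operator that applies `F x` to the second qubit if the first one is `x`. -/
def ctl (F : Fin 2 → Matrix (Fin 2) (Fin 2) ℂ) : Matrix (Fin 2 × Fin 2) (Fin 2 × Fin 2) ℂ :=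
  fun p q => if p.1 = q.1 then F p.1 p.2 q.2 else 0

theorem ctl_mul (F G : Fin 2 → Matrix (Fin 2) (Fin 2) ℂ) : ctl F * ctl G = ctl (F * G) := by
  ext ⟨x, y⟩ ⟨x', y'⟩
  by_cases h : x = x'
  · subst h
    simp [ctl, Matrix.mul_apply, Fintype.sum_prod_type]
  · simp [ctl, Matrix.mul_apply, Fintype.sum_prod_type, h]

theorem ctl_one : ctl 1 = 1 := by
  ext ⟨x, y⟩ ⟨x', y'⟩
  by_cases h : x = x' <;> simp [ctl, Matrix.one_apply, h]

theorem ctl_conjTranspose (F : Fin 2 → Matrix (Fin 2) (Fin 2) ℂ) :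
    (ctl F)ᴴ = ctl fun x => (F x)ᴴ := by
  ext ⟨x, y⟩ ⟨x', y'⟩
  by_cases h : x = x'
  · subst h; simp [ctl]
  · simp [ctl, h, Ne.symm h]

theorem ctl_mem_unitaryGroup {F : Fin 2 → Matrix (Fin 2) (Fin 2) ℂ} (hF : ∀ x, F x * (F x)ᴴ = 1) :
    ctl F ∈ Matrix.unitaryGroup (Fin 2 × Fin 2) ℂ := by
  rw [Matrix.mem_unitaryGroup_iff, Matrix.star_eq_conjTranspose, ctl_conjTranspose, ctl_mul,
    ← ctl_one]
  congr 1
  funext x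
  exact hF x

/-- The Pauli matrix `X`. -/
def pauliX : Matrix (Fin 2) (Fin 2) ℂ := !![0, 1; 1, 0]

/-- A square root of `X`. -/
def sqrtX : Matrix (Fin 2) (Fin 2) ℂ :=
  !![(1 + Complex.I) / 2, (1 - Complex.I) / 2; (1 - Complex.I) / 2, (1 + Complex.I) / 2]

/-- The Hadamard matrix. -/
def hadamard : Matrix (Fin 2) (Fin 2) ℂ := (1 / √2 : ℂ) • !![1, 1; 1, -1]

theorem pauliX_mul_self : pauliX * pauliX = 1 := by
  ext i j; fin_cases i <;> fin_cases j <;> simp [pauliX]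

theorem pauliX_conjTranspose : pauliXᴴ = pauliX := by
  ext i j; fin_cases i <;> fin_cases j <;> simp [pauliX]

theorem sqrtX_mul_self : sqrtX * sqrtX = pauliX := by
  have h := Complex.I_sq
  ext i j
  fin_cases i <;> fin_cases j <;> simp [pauliX, sqrtX, Matrix.mul_apply] <;> ring_nf <;>
    simp only [h] <;> norm_num

theorem sqrtX_mul_conjTranspose : sqrtX * sqrtXᴴ = 1 := by
  have h := Complex.I_sq
  have h2 : (starRingEnd ℂ) 2 = 2 := Complex.conj_ofNat 2
  ext i j
  fin_cases i <;> fin_cases j <;> simp [sqrtX, Matrix.mul_apply, h2] <;> ring_nf <;>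
    simp only [h] <;> norm_num

theorem sqrtX_conjTranspose_mul : sqrtXᴴ * sqrtX = 1 :=
  mul_eq_one_comm.mp sqrtX_mul_conjTranspose

theorem sqrt_two_inv_mul_self : (1 / √2 : ℂ) * (1 / √2 : ℂ) = 1 / 2 := by
  rw [div_mul_div_comm, one_mul, ← Complex.ofReal_mul, Real.mul_self_sqrt (by norm_num)]; norm_num

theorem hadamard_conjTranspose : hadamardᴴ = hadamard := by
  ext i j; fin_cases i <;> fin_cases j <;> simp [hadamard]

theorem hadamard_mul_self : hadamard * hadamard = 1 := by
  rw [hadamard, smul_mul_smul_comm, sqrt_two_inv_mul_self]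
  ext i j; fin_cases i <;> fin_cases j <;> simp <;> norm_num

theorem hadamard_mem_unitaryGroup : hadamard ∈ Matrix.unitaryGroup (Fin 2) ℂ := by
  rw [Matrix.mem_unitaryGroup_iff, Matrix.star_eq_conjTranspose, hadamard_conjTranspose,
    hadamard_mul_self]

/-- The controlled-NOT gate with the first qubit as its control. -/
def cnot : Matrix (Fin 2 × Fin 2) (Fin 2 × Fin 2) ℂ := ctl ![1, pauliX]

/-- The controlled-NOT gate with the second qubit as its control. -/
def cnotRev : Matrix (Fin 2 × Fin 2) (Fin 2 × Fin 2) ℂ := cnot.submatrix Prod.swap Prod.swap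

/-- The swap of two qubits. -/
def swap2 : Matrix (Fin 2 × Fin 2) (Fin 2 × Fin 2) ℂ := fun p q => if p = q.swap then 1 else 0

theorem cnot_mul_self : cnot * cnot = 1 := by
  rw [cnot, ctl_mul, ← ctl_one]
  congr 1
  funext x
  fin_cases x <;> simp [pauliX_mul_self]

theorem cnot_conjTranspose : cnotᴴ = cnot := by
  rw [cnot, ctl_conjTranspose]
  congr 1
  funext x
  fin_cases x <;> simp [pauliX_conjTranspose]

theorem cnotRev_mul_self : cnotRev * cnotRev = 1 := by
  have h := Matrix.submatrix_mul_equiv cnot cnot Prod.swap (Equiv.prodComm _ _) Prod.swap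
  rw [cnot_mul_self, Matrix.submatrix_one _ Prod.swap_injective] at h
  exact h

theorem cnotRev_conjTranspose : cnotRevᴴ = cnotRev := by
  rw [cnotRev, Matrix.conjTranspose_submatrix, cnot_conjTranspose]

theorem cnotRev_mul_cnot_mul_cnotRev : cnotRev * cnot * cnotRev = swap2 := by
  ext ⟨x, y⟩ ⟨x', y'⟩
  fin_cases x <;> fin_cases y <;> fin_cases x' <;> fin_cases y' <;>
    simp [Matrix.mul_apply, Fintype.sum_prod_type, cnotRev, cnot, ctl, pauliX, swap2]

/-- `A` on the first qubit. -/
def onFst (A : Matrix (Fin 2) (Fin 2) ℂ) : Matrix (Fin 2 × Fin 2) (Fin 2 × Fin 2) ℂ :=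
  fun p q => if p.2 = q.2 then A p.1 q.1 else 0

theorem pauliX_conj_ctl (A B : Matrix (Fin 2) (Fin 2) ℂ) :
    onFst pauliX * ctl ![A, B] * onFst pauliX = ctl ![B, A] := by
  ext ⟨x, y⟩ ⟨x', y'⟩
  fin_cases x <;> fin_cases x' <;>
    simp [Matrix.mul_apply, Fintype.sum_prod_type, onFst, ctl, pauliX]

/-- The decomposition of the swap that makes it controllable: without the gates `onFst pauliX` and
`ctl ![sqrtX, sqrtX]`, which are the ones to be controlled, the product is the identity. -/
theorem swap2_eq : swap2 = cnotRev * ctl ![sqrtX, sqrtX] * onFst pauliX * ctl ![1, sqrtXᴴ] *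
    onFst pauliX * (ctl ![1, sqrtX] * cnotRev) := by
  have h : ctl ![sqrtX, sqrtX] * (onFst pauliX * ctl ![1, sqrtXᴴ] * onFst pauliX) *
      ctl ![1, sqrtX] = cnot := by
    rw [pauliX_conj_ctl, ctl_mul, ctl_mul, cnot]
    congr 1
    funext x
    fin_cases x <;> simp [sqrtX_mul_conjTranspose, sqrtX_mul_self]
  rw [← cnotRev_mul_cnot_mul_cnotRev, ← h]
  simp only [mul_assoc]

theorem gate2Op_ctl_eq_selectOp_fst {v w w' : Wire n s a} (hvw : v ≠ w) (hvw' : v ≠ w')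
    (hww' : w ≠ w') (A : Matrix (Fin 2) (Fin 2) ℂ) :
    gate2Op v w (ctl ![1, A]) = selectOp v w w' ![1, onFst A] := by
  ext c c'
  simp only [gate2Op, selectOp]
  by_cases hc : ∀ x, x ≠ w → x ≠ w' → c x = c' x
  · rw [if_pos hc]
    have hv := hc v hvw hvw'
    by_cases h' : c w' = c' w'
    · rw [if_pos fun x _ hx => by
        by_cases hx' : x = w'
        · rw [hx', h']
        · exact hc x hx hx']
      simp only [ctl, ← hv, h']
      generalize c v = y
      fin_cases y <;> simp [onFst, Matrix.one_apply]
    · rw [if_neg fun h => h' (h w' hvw'.symm hww'.symm)]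
      generalize c v = y
      fin_cases y <;> simp [onFst, h']
  · rw [if_neg hc]
    by_cases hv : c v = c' v
    · rw [if_neg fun h => hc fun x hx _ => by
        by_cases hxv : x = v
        · rw [hxv, hv]
        · exact h x hxv hx]
    · simp [ctl, hv]

theorem gate2Op_ctl_eq_selectOp_snd {v w w' : Wire n s a} (hvw : v ≠ w) (hvw' : v ≠ w')
    (hww' : w ≠ w') (A : Matrix (Fin 2) (Fin 2) ℂ) :
    gate2Op v w' (ctl ![1, A]) = selectOp v w w' ![1, ctl ![A, A]] := by
  ext c c'
  simp only [gate2Op, selectOp]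
  by_cases hc : ∀ x, x ≠ w → x ≠ w' → c x = c' x
  · rw [if_pos hc]
    have hv := hc v hvw hvw'
    by_cases h' : c w = c' w
    · rw [if_pos fun x _ hx => by
        by_cases hx' : x = w
        · rw [hx', h']
        · exact hc x hx' hx]
      simp only [ctl, ← hv, h']
      generalize c v = y
      generalize c' w = z
      fin_cases y <;> fin_cases z <;> simp [ctl, Matrix.one_apply]
    · rw [if_neg fun h => h' (h w hvw.symm hww')]
      generalize c v = y
      fin_cases y <;> simp [ctl, h']
  · rw [if_neg hc]
    by_cases hv : c v = c' v
    · rw [if_neg fun h => hc fun x _ hx => by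
        by_cases hxv : x = v
        · rw [hxv, hv]
        · exact h x hxv hx]
    · simp [ctl, hv]

/-- The controlled swap of two qubits on basis labels. -/
def fredkinMap (v w w' : Wire n s a) (c : Config n s a) : Config n s a :=
  if c v = 1 then c ∘ Equiv.swap w w' else c

theorem selectOp_swap2 {v w w' : Wire n s a} (hww' : w ≠ w') :
    selectOp v w w' ![1, swap2] = pullOp (fredkinMap v w w') := by
  ext c c'
  simp only [selectOp, pullOp]
  by_cases hc : ∀ x, x ≠ w → x ≠ w' → c x = c' x
  · rw [if_pos hc]
    by_cases hv : c v = 1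
    · rw [fredkinMap, if_pos hv, hv]
      simp only [Matrix.cons_val_one, swap2, Matrix.cons_val_fin_one]
      refine if_congr ?_ rfl rfl
      simp only [Prod.swap_prod_mk, Prod.mk.injEq]
      constructor
      · rintro ⟨h1, h2⟩
        ext x
        by_cases hx : x = w
        · subst hx; simp [h2]
        · by_cases hx' : x = w'
          · subst hx'; simp [h1]
          · simp [Equiv.swap_apply_of_ne_of_ne hx hx', hc x hx hx']
      · intro h
        have h1 := congrFun h w
        have h2 := congrFun h w'
        simp only [Function.comp_apply, Equiv.swap_apply_left, Equiv.swap_apply_right] at h1 h2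
        exact ⟨h2, h1⟩
    · have hv0 : c v = 0 := by omega
      rw [fredkinMap, if_neg hv, hv0]
      simp only [Matrix.cons_val_zero, Matrix.one_apply]
      refine if_congr ?_ rfl rfl
      rw [Prod.mk.injEq]
      constructor
      · rintro ⟨h1, h2⟩
        ext x
        by_cases hx : x = w
        · rw [hx, h1]
        · by_cases hx' : x = w'
          · rw [hx', h2]
          · rw [hc x hx hx']
      · rintro rfl; exact ⟨rfl, rfl⟩
  · rw [if_neg hc, if_neg]
    intro h
    refine hc fun x hx hx' => ?_
    rw [← h, fredkinMap]
    split_ifs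
    · simp [Equiv.swap_apply_of_ne_of_ne hx hx']
    · rfl

/-- The six two-qubit gates of a controlled swap. -/
theorem fredkin_decomposition {v w w' : Wire n s a} (hvw : v ≠ w) (hvw' : v ≠ w') (hww' : w ≠ w') :
    gate2Op w w' cnotRev * gate2Op v w' (ctl ![1, sqrtX]) * gate2Op v w cnot *
      gate2Op w w' (ctl ![1, sqrtXᴴ]) * gate2Op v w cnot *
      gate2Op w w' (ctl ![1, sqrtX] * cnotRev) =
    pullOp (fredkinMap v w w') := by
  rw [cnot, gate2Op_ctl_eq_selectOp_fst hvw hvw' hww', gate2Op_ctl_eq_selectOp_snd hvw hvw' hww',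
    gate2Op_eq_selectOp v, gate2Op_eq_selectOp v, gate2Op_eq_selectOp v]
  simp only [selectOp_mul hvw hvw' hww']
  rw [← selectOp_swap2 hww']
  congr 1
  funext x
  fin_cases x
  · simp only [Pi.mul_apply, Fin.zero_eta, Matrix.cons_val_zero, mul_one]
    rw [mul_assoc, ← mul_assoc (ctl _) (ctl _), ctl_mul]
    have : (![1, sqrtXᴴ] * ![1, sqrtX] : Fin 2 → Matrix (Fin 2) (Fin 2) ℂ) = 1 := by
      funext x
      fin_cases x <;> simp [sqrtX_conjTranspose_mul]
    rw [this, ctl_one, one_mul, cnotRev_mul_self]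
  · simp only [Pi.mul_apply, Fin.mk_one, Matrix.cons_val_one, Matrix.cons_val_fin_one]
    exact swap2_eq.symm

theorem gate2Op_smul_add_smul {w w' : Wire n s a} (α β : ℂ)
    (u v : Matrix (Fin 2 × Fin 2) (Fin 2 × Fin 2) ℂ) :
    gate2Op w w' (α • u + β • v) = α • gate2Op w w' u + β • gate2Op w w' v := by
  ext c c'
  simp only [gate2Op, Matrix.add_apply, Matrix.smul_apply]
  split_ifs <;> simp

theorem gate2Op_one (w w' : Wire n s a) : gate2Op w w' 1 = (1 : Op n s a) := by
  ext c c'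
  simp only [gate2Op, Matrix.one_apply, Prod.mk.injEq]
  by_cases h : c = c'
  · subst h; simp
  · rw [if_neg h]
    split_ifs with h1 h2
    · refine absurd (funext fun x => ?_) h
      by_cases hx : x = w
      · rw [hx, h2.1]
      · by_cases hx' : x = w'
        · rw [hx', h2.2]
        · exact h1 x hx hx'
    · rfl
    · rfl

/-- The controlled-NOT gate on basis labels. -/
def cnotMap (w w' : Wire n s a) (c : Config n s a) : Config n s a :=
  if c w = 1 then Function.update c w' (Fin.rev (c w')) else c

theorem gate2Op_cnot {w w' : Wire n s a} (hww' : w ≠ w') :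
    gate2Op w w' cnot = pullOp (cnotMap w w') := by
  ext c c'
  have hX : ∀ y z : Fin 2, pauliX y z = if Fin.rev y = z then 1 else 0 := by
    intro y z; fin_cases y <;> fin_cases z <;> simp [pauliX]
  simp only [gate2Op, pullOp, cnot, ctl]
  by_cases hw : c w = c' w
  · rw [if_pos hw]
    by_cases hc : ∀ x, x ≠ w → x ≠ w' → c x = c' x
    · rw [if_pos hc]
      by_cases hv : c w = 1
      · rw [cnotMap, if_pos hv, hv]
        simp only [Matrix.cons_val_one, Matrix.cons_val_fin_one, hX]
        refine if_congr ?_ rfl rfl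
        constructor
        · intro h
          ext x
          by_cases hx' : x = w'
          · subst hx'; simp [h]
          · by_cases hx : x = w
            · subst hx; simp [hx', hw]
            · simp [hx', hc x hx hx']
        · rintro rfl; simp
      · have hv0 : c w = 0 := by omega
        rw [cnotMap, if_neg hv, hv0]
        simp only [Matrix.cons_val_zero, Matrix.one_apply]
        refine if_congr ?_ rfl rfl
        constructor
        · intro h
          ext x
          by_cases hx' : x = w'
          · rw [hx', h]
          · by_cases hx : x = w
            · rw [hx, hw]
            · rw [hc x hx hx']
        · rintro rfl; rfl
    · rw [if_neg hc, if_neg]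
      intro h
      refine hc fun x hx hx' => ?_
      rw [← h, cnotMap]
      split_ifs <;> simp [hx']
  · rw [if_neg hw, ite_self, if_neg]
    intro h
    apply hw
    rw [← h, cnotMap]
    split_ifs <;> simp [hww']

end Gates

/-! ### Reduced states -/

/-- A basis label of two registers, one kickback ancilla and `m` record ancillas: `u` on the main
register, `r` on the second register, `b` on the kickback ancilla and `x` on the records. -/
def cfg {n m : ℕ} (u r : Fin n → Fin 2) (b : Fin 2) (x : Fin m → Fin 2) : Config n 1 (m + 1)
  | .inl (j, k) => if j = 0 then u k else r k
  | .inr i => Fin.cons (α := fun _ => Fin 2) b x i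

/-- Operators on the main register and `m` record ancillas, as block matrices indexed by the basis
labels of the records. -/
abbrev BlockState (n m : ℕ) : Type :=
  (Fin m → Fin 2) → (Fin m → Fin 2) → Matrix (Fin n → Fin 2) (Fin n → Fin 2) ℂ

/-- The partial trace over the second register and the kickback ancilla. -/
def reduced {n m : ℕ} (X : Op n 1 (m + 1)) : BlockState n m := fun x y =>
  Matrix.of fun u v => ∑ r, ∑ b, X (cfg u r b x) (cfg v r b y)

section Reduced

variable {n m : ℕ} (u r : Fin n → Fin 2) (b : Fin 2) (x : Fin m → Fin 2)

theorem reduced_apply (X : Op n 1 (m + 1)) (x y : Fin m → Fin 2) (u v : Fin n → Fin 2) :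
    reduced X x y u v = ∑ r, ∑ b, X (cfg u r b x) (cfg v r b y) := rfl

@[simp] theorem cfg_main (k : Fin n) : cfg u r b x (.inl (0, k)) = u k := rfl

@[simp] theorem cfg_second (k : Fin n) : cfg u r b x (.inl (1, k)) = r k := rfl

@[simp] theorem cfg_kick : cfg u r b x (.inr 0) = b := rfl

@[simp] theorem cfg_record (t : Fin m) : cfg u r b x (.inr t.succ) = x t := rfl

theorem eq_cfg (c : Config n 1 (m + 1)) :
    c = cfg (fun k => c (.inl (0, k))) (fun k => c (.inl (1, k))) (c (.inr 0))
      (fun t => c (.inr t.succ)) := by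
  ext v
  rcases v with ⟨j, k⟩ | i
  · fin_cases j <;> rfl
  · refine Fin.cases ?_ (fun t => ?_) i <;> rfl

theorem config_ext {c c' : Config n 1 (m + 1)} (h0 : ∀ k, c (.inl (0, k)) = c' (.inl (0, k)))
    (h1 : ∀ k, c (.inl (1, k)) = c' (.inl (1, k))) (hk : c (.inr 0) = c' (.inr 0))
    (hr : ∀ t : Fin m, c (.inr t.succ) = c' (.inr t.succ)) : c = c' := by
  rw [eq_cfg c, eq_cfg c']
  simp only [h0, h1, hk, hr]

theorem update_cfg_kick (e : Fin 2) :
    Function.update (cfg u r b x) (.inr 0) e = cfg u r e x := by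
  apply config_ext <;> simp

theorem update_cfg_record (t : Fin m) (e : Fin 2) :
    Function.update (cfg u r b x) (.inr t.succ) e = cfg u r b (Function.update x t e) := by
  apply config_ext <;> simp [Function.update_apply, (Fin.succ_ne_zero t).symm]

theorem setReg_zero_cfg (c : Fin n → Fin 2) : setReg 0 (cfg u r b x) c = cfg c r b x := by
  apply config_ext <;> intros <;> rfl

theorem setReg_one_cfg (c : Fin n → Fin 2) : setReg 1 (cfg u r b x) c = cfg u c b x := by
  apply config_ext <;> intros <;> rfl

theorem reduced_gate1_record (t : Fin m) (g : Matrix (Fin 2) (Fin 2) ℂ) (X : Op n 1 (m + 1))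
    (x y : Fin m → Fin 2) :
    reduced (gate1Op (.inr t.succ) g * X * (gate1Op (.inr t.succ) g)ᴴ) x y =
      ∑ e, ∑ e', (g (x t) e * star (g (y t) e')) •
        reduced X (Function.update x t e) (Function.update y t e') := by
  ext u v
  simp only [reduced_apply, gate1Op_conj_apply, update_cfg_record, cfg_record, Matrix.sum_apply,
    Matrix.smul_apply, smul_eq_mul, Finset.mul_sum]
  simp only [Fin.sum_univ_two, ← Finset.sum_add_distrib]
  exact Finset.sum_congr rfl fun r _ => by ring

theorem reduced_loadReg_zero (σ : Matrix (Fin n → Fin 2) (Fin n → Fin 2) ℂ) (X : Op n 1 (m + 1))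
    (x y : Fin m → Fin 2) :
    reduced (loadReg 0 σ X) x y = (reduced X x y).trace • σ := by
  ext u v
  simp only [reduced_apply, loadReg, cfg_main, setReg_zero_cfg, Matrix.smul_apply, smul_eq_mul,
    Matrix.trace, Matrix.diag_apply]
  simp only [← Finset.mul_sum]
  rw [mul_comm]
  congr 1
  simp only [Fin.sum_univ_two, Finset.sum_add_distrib]
  congr 1 <;> exact Finset.sum_comm

end Reduced

/-! ### Programs and the partial swap -/

/-- Circuits on two registers, one kickback ancilla and `m` record ancillas. -/
abbrev Prog (d K m : ℕ) : Type := List (Instr K (numQubits d) 1 (m + 1))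

section Programs

variable {d K m : ℕ}

/-- The channel of a program. -/
def runProg (φin φout : Fin (K + 1) → EuclideanSpace ℂ (Fin d)) (p : Prog d K m)
    (X : Op (numQubits d) 1 (m + 1)) : Op (numQubits d) 1 (m + 1) :=
  p.foldl (fun X I => I.apply φin φout X) X

/-- The number of copies of input and output states that a program uses. -/
def copiesOf (p : Prog d K m) : ℕ := (p.map Instr.copies).sum

/-- The number of gates of a program. -/
def gatesOf (p : Prog d K m) : ℕ := (p.map Instr.gates).sum

variable (φin φout : Fin (K + 1) → EuclideanSpace ℂ (Fin d))

theorem runProg_append (p q : Prog d K m) (X : Op (numQubits d) 1 (m + 1)) :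
    runProg φin φout (p ++ q) X = runProg φin φout q (runProg φin φout p X) :=
  List.foldl_append

theorem runProg_cons (I : Instr K (numQubits d) 1 (m + 1)) (p : Prog d K m)
    (X : Op (numQubits d) 1 (m + 1)) :
    runProg φin φout (I :: p) X = runProg φin φout p (I.apply φin φout X) := rfl

theorem runProg_nil (X : Op (numQubits d) 1 (m + 1)) : runProg φin φout [] X = X := rfl

theorem copiesOf_append (p q : Prog d K m) : copiesOf (p ++ q) = copiesOf p + copiesOf q := by
  simp [copiesOf]

theorem gatesOf_append (p q : Prog d K m) : gatesOf (p ++ q) = gatesOf p + gatesOf q := by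
  simp [gatesOf]

/-- The swap of the `k`-th qubits of the two registers, controlled by the kickback ancilla. -/
def fredkinProg (k : Fin (numQubits d)) : Prog d K m :=
  let main : Wire (numQubits d) 1 (m + 1) := .inl (0, k)
  let second : Wire (numQubits d) 1 (m + 1) := .inl (1, k)
  let kick : Wire (numQubits d) 1 (m + 1) := .inr 0
  have hms : main ≠ second := by simp [main, second]
  have hcnot : cnot ∈ Matrix.unitaryGroup (Fin 2 × Fin 2) ℂ := by
    rw [Matrix.mem_unitaryGroup_iff, Matrix.star_eq_conjTranspose, cnot_conjTranspose,
      cnot_mul_self]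
  have hrev : cnotRev ∈ Matrix.unitaryGroup (Fin 2 × Fin 2) ℂ := by
    rw [Matrix.mem_unitaryGroup_iff, Matrix.star_eq_conjTranspose, cnotRev_conjTranspose,
      cnotRev_mul_self]
  have hsq : ctl ![1, sqrtX] ∈ Matrix.unitaryGroup (Fin 2 × Fin 2) ℂ :=
    ctl_mem_unitaryGroup fun x => by fin_cases x <;> simp [sqrtX_mul_conjTranspose]
  have hsq' : ctl ![1, sqrtXᴴ] ∈ Matrix.unitaryGroup (Fin 2 × Fin 2) ℂ :=
    ctl_mem_unitaryGroup fun x => by fin_cases x <;> simp [sqrtX_conjTranspose_mul]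
  [.gate2 main second hms ⟨_, mul_mem hsq hrev⟩,
    .gate2 kick main (by simp [kick, main]) ⟨_, hcnot⟩,
    .gate2 main second hms ⟨_, hsq'⟩,
    .gate2 kick main (by simp [kick, main]) ⟨_, hcnot⟩,
    .gate2 kick second (by simp [kick, second]) ⟨_, hsq⟩,
    .gate2 main second hms ⟨_, hrev⟩]

/-- The swap, controlled by the kickback ancilla, of the qubits of the two registers with positions
in `l`, on basis labels. -/
def ctlSwapMap {n m : ℕ} (l : List (Fin n)) (c : Config n 1 (m + 1)) : Config n 1 (m + 1)
  | .inl (j, k) => if c (.inr 0) = 1 ∧ k ∈ l then c (.inl (j.rev, k)) else c (.inl (j, k))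
  | .inr i => c (.inr i)

theorem fredkinMap_eq_ctlSwapMap {n m : ℕ} (k : Fin n) :
    fredkinMap (.inr 0) (.inl (0, k)) (.inl (1, k)) = ctlSwapMap (m := m) [k] := by
  funext c
  have hr0 : Fin.rev (0 : Fin (1 + 1)) = 1 := rfl
  have hr1 : Fin.rev (1 : Fin (1 + 1)) = 0 := rfl
  by_cases hc : c (.inr 0) = 1
  · rw [fredkinMap, if_pos hc]
    apply config_ext
    · intro k'
      by_cases h : k' = k
      · subst h; simp [ctlSwapMap, hc]
      · simp only [ctlSwapMap, hc, List.mem_singleton, h, and_false, if_false, Function.comp_apply]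
        rw [Equiv.swap_apply_of_ne_of_ne] <;> simp [h]
    · intro k'
      by_cases h : k' = k
      · subst h; simp [ctlSwapMap, hc, hr1]
      · simp only [ctlSwapMap, hc, List.mem_singleton, h, and_false, if_false, Function.comp_apply]
        rw [Equiv.swap_apply_of_ne_of_ne] <;> simp [h]
    · simp only [ctlSwapMap, Function.comp_apply]
      rw [Equiv.swap_apply_of_ne_of_ne] <;> simp
    · intro t
      simp only [ctlSwapMap, Function.comp_apply]
      rw [Equiv.swap_apply_of_ne_of_ne] <;> simp
  · rw [fredkinMap, if_neg hc]
    apply config_ext <;> simp [ctlSwapMap, hc]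

theorem ctlSwapMap_cons {n m : ℕ} {k : Fin n} {l : List (Fin n)} (hk : k ∉ l)
    (c : Config n 1 (m + 1)) : ctlSwapMap [k] (ctlSwapMap l c) = ctlSwapMap (k :: l) c := by
  funext v
  rcases v with ⟨j, k'⟩ | i
  · by_cases hc : c (.inr 0) = 1
    · by_cases h : k' = k
      · subst h; simp [ctlSwapMap, hc, hk]
      · simp [ctlSwapMap, hc, h]
    · simp [ctlSwapMap, hc]
  · rfl

theorem runProg_fredkinProg (k : Fin (numQubits d)) (X : Op (numQubits d) 1 (m + 1)) :
    runProg φin φout (fredkinProg k) X = X.submatrix (ctlSwapMap [k]) (ctlSwapMap [k]) := by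
  rw [← fredkinMap_eq_ctlSwapMap, ← pullOp_conj,
    ← fredkin_decomposition (by simp) (by simp) (by simp)]
  simp only [fredkinProg, runProg, List.foldl_cons, List.foldl_nil, Instr.apply,
    Matrix.conjTranspose_mul, mul_assoc]

/-- The swap of the two registers, controlled by the kickback ancilla. -/
def ctlSwapProg : Prog d K m := (List.finRange (numQubits d)).flatMap fredkinProg

theorem runProg_flatMap_fredkinProg (l : List (Fin (numQubits d))) (hl : l.Nodup)
    (X : Op (numQubits d) 1 (m + 1)) :
    runProg φin φout (l.flatMap fredkinProg) X = X.submatrix (ctlSwapMap l) (ctlSwapMap l) := by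
  induction l generalizing X with
  | nil =>
    have : ctlSwapMap (m := m) ([] : List (Fin (numQubits d))) = id := by
      funext c v
      rcases v with ⟨j, k'⟩ | i
      · simp [ctlSwapMap]
      · rfl
    rw [this]; rfl
  | cons k l ih =>
    rw [List.nodup_cons] at hl
    rw [List.flatMap_cons, runProg_append, ih hl.2, runProg_fredkinProg, Matrix.submatrix_submatrix]
    have : ctlSwapMap [k] ∘ ctlSwapMap l = ctlSwapMap (m := m) (k :: l) :=
      funext fun c => ctlSwapMap_cons hl.1 c
    rw [this]

theorem ctlSwapMap_finRange_cfg {n m : ℕ} (u r : Fin n → Fin 2) (b : Fin 2) (x : Fin m → Fin 2) :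
    ctlSwapMap (List.finRange n) (cfg u r b x) = if b = 1 then cfg r u b x else cfg u r b x := by
  have hr1 : Fin.rev (1 : Fin (1 + 1)) = 0 := rfl
  split_ifs with h
  · apply config_ext <;> simp [ctlSwapMap, h, hr1]
  · apply config_ext <;> simp [ctlSwapMap, h]

theorem copiesOf_ctlSwapProg : copiesOf (ctlSwapProg : Prog d K m) = 0 := by
  rw [ctlSwapProg]
  induction List.finRange (numQubits d) with
  | nil => rfl
  | cons k l ih => rw [List.flatMap_cons, copiesOf_append, ih]; rfl

theorem gatesOf_ctlSwapProg : gatesOf (ctlSwapProg : Prog d K m) = 6 * numQubits d := by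
  rw [ctlSwapProg]
  conv_rhs => rw [← List.length_finRange (n := numQubits d)]
  induction List.finRange (numQubits d) with
  | nil => rfl
  | cons k l ih =>
    rw [List.flatMap_cons, gatesOf_append, ih, List.length_cons, mul_add, add_comm]; rfl

/-- `exp (-iβ V)` for the controlled-NOT gate `V`. -/
def rotCnot (β : ℝ) : Matrix (Fin 2 × Fin 2) (Fin 2 × Fin 2) ℂ :=
  (Real.cos β : ℂ) • 1 + (-(Complex.I * Real.sin β)) • cnot

theorem rotCnot_mem_unitaryGroup (β : ℝ) : rotCnot β ∈ Matrix.unitaryGroup (Fin 2 × Fin 2) ℂ := by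
  rw [Matrix.mem_unitaryGroup_iff, Matrix.star_eq_conjTranspose, rotCnot,
    Matrix.conjTranspose_add, Matrix.conjTranspose_smul, Matrix.conjTranspose_smul,
    cnot_conjTranspose, Matrix.conjTranspose_one]
  have h : (Real.cos β : ℂ) * Real.cos β + Real.sin β * Real.sin β = 1 := by
    norm_cast
    rw [← sq, ← sq, Real.cos_sq_add_sin_sq]
  simp only [mul_add, add_mul, smul_mul_smul_comm, cnot_mul_self, one_mul, mul_one]
  simp only [star_neg, star_mul', Complex.star_def, Complex.conj_I, Complex.conj_ofReal]
  have hI := Complex.I_mul_I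
  generalize (Real.cos β : ℂ) = c at h ⊢
  generalize (Real.sin β : ℂ) = s at h ⊢
  match_scalars
  · linear_combination h - s * s * hI
  · ring

/-- The encoded projector of an input (`o = false`) or output (`o = true`) state. -/
def src (o : Bool) (k : Fin (K + 1)) :
    Matrix (Fin (numQubits d) → Fin 2) (Fin (numQubits d) → Fin 2) ℂ :=
  encodeOp (ketbra (cond o φout φin k))

/-- The instruction that loads an input (`o = false`) or output (`o = true`) state. -/
def load (o : Bool) (j : Fin (1 + 1)) (k : Fin (K + 1)) : Instr K (numQubits d) 1 (m + 1) :=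
  cond o (.loadOut j k) (.loadIn j k)

theorem load_apply (o : Bool) (j : Fin (1 + 1)) (k : Fin (K + 1))
    (X : Op (numQubits d) 1 (m + 1)) :
    (load o j k).apply φin φout X = loadReg j (src φin φout o k) X := by
  cases o <;> rfl

/-- The evolution `exp (-iβ H)`, where `H` swaps the main register with a fresh copy of a state if
the record `t` is `1`, and is the identity if the record is `0`. The kickback ancilla is prepared in
the state `(|0⟩ + |1⟩)/√2` so that a flip of it has no effect; a flip controlled by the record,
conjugated with the swap controlled by the ancilla, is a flip and a swap controlled by the
record. -/
def partialSwapProg (β : ℝ) (o : Bool) (t : Fin m) (k : Fin (K + 1)) : Prog d K m :=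
  [.fresh 0, load o 1 k, .gate1 (.inr 0) ⟨hadamard, hadamard_mem_unitaryGroup⟩] ++
    (ctlSwapProg ++ ([.gate2 (.inr t.succ) (.inr 0) (by simp) ⟨_, rotCnot_mem_unitaryGroup β⟩] ++
      ctlSwapProg))

theorem copiesOf_partialSwapProg (β : ℝ) (o : Bool) (t : Fin m) (k : Fin (K + 1)) :
    copiesOf (partialSwapProg β o t k : Prog d K m) = 1 := by
  rw [partialSwapProg, copiesOf_append, copiesOf_append, copiesOf_append, copiesOf_ctlSwapProg]
  cases o <;> rfl

theorem gatesOf_partialSwapProg (β : ℝ) (o : Bool) (t : Fin m) (k : Fin (K + 1)) :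
    gatesOf (partialSwapProg β o t k : Prog d K m) = 12 * numQubits d + 2 := by
  rw [partialSwapProg, gatesOf_append, gatesOf_append, gatesOf_append, gatesOf_ctlSwapProg]
  have h1 : gatesOf ([.fresh 0, load o 1 k,
      .gate1 (.inr 0) ⟨hadamard, hadamard_mem_unitaryGroup⟩] : Prog d K m) = 1 := by
    cases o <;> rfl
  have h2 : gatesOf ([.gate2 (.inr t.succ) (.inr 0) (by simp)
      ⟨_, rotCnot_mem_unitaryGroup β⟩] : Prog d K m) = 1 := rfl
  rw [h1, h2]; ring

/-- The flip of the kickback ancilla and swap of the registers, controlled by the record `t`, on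
basis labels. -/
theorem ctlSwapMap_cnotMap_ctlSwapMap {n m : ℕ} (t : Fin m) (u r : Fin n → Fin 2) (b : Fin 2)
    (x : Fin m → Fin 2) :
    ctlSwapMap (List.finRange n) (cnotMap (.inr t.succ) (.inr 0)
      (ctlSwapMap (List.finRange n) (cfg u r b x))) =
    if x t = 1 then cfg r u b.rev x else cfg u r b x := by
  have hr1 : Fin.rev (1 : Fin 2) = 0 := rfl
  have hr0 : Fin.rev (0 : Fin 2) = 1 := rfl
  rw [ctlSwapMap_finRange_cfg]
  have hb : b = 0 ∨ b = 1 := by omega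
  rcases hb with rfl | rfl
  · simp only [zero_ne_one, if_false, cnotMap, cfg_record, cfg_kick, hr0]
    split_ifs
    · rw [update_cfg_kick, ctlSwapMap_finRange_cfg, if_pos rfl]
    · rw [ctlSwapMap_finRange_cfg, if_neg zero_ne_one]
  · simp only [if_true, cnotMap, cfg_record, cfg_kick, hr1]
    split_ifs
    · rw [update_cfg_kick, ctlSwapMap_finRange_cfg, if_neg zero_ne_one]
    · rw [ctlSwapMap_finRange_cfg, if_pos rfl]

theorem ctlSwapMap_ctlSwapMap {n m : ℕ} (u r : Fin n → Fin 2) (b : Fin 2) (x : Fin m → Fin 2) :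
    ctlSwapMap (List.finRange n) (ctlSwapMap (List.finRange n) (cfg u r b x)) = cfg u r b x := by
  rw [ctlSwapMap_finRange_cfg]
  split_ifs with h <;> rw [ctlSwapMap_finRange_cfg] <;> simp [h]

end Programs

/-! ### The reduced action of the partial swap -/

section PartialSwap

variable {n m : ℕ}

/-- Multiplication of the blocks from the left, by an operator that depends on the row label. -/
def blockMulLeft (A : (Fin m → Fin 2) → Matrix (Fin n → Fin 2) (Fin n → Fin 2) ℂ) :
    Module.End ℂ (BlockState n m) where
  toFun Y x y := A x * Y x y
  map_add' Y Z := by funext x y; exact mul_add _ _ _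
  map_smul' c Y := by funext x y; exact mul_smul_comm c (A x) (Y x y)

/-- Multiplication of the blocks from the right, by an operator that depends on the column label. -/
def blockMulRight (A : (Fin m → Fin 2) → Matrix (Fin n → Fin 2) (Fin n → Fin 2) ℂ) :
    Module.End ℂ (BlockState n m) where
  toFun Y x y := Y x y * A y
  map_add' Y Z := by funext x y; exact add_mul _ _ _
  map_smul' c Y := by funext x y; exact smul_mul_assoc c (Y x y) (A y)

theorem blockMulLeft_apply (A : (Fin m → Fin 2) → Matrix (Fin n → Fin 2) (Fin n → Fin 2) ℂ)
    (Y : BlockState n m) (x y : Fin m → Fin 2) : blockMulLeft A Y x y = A x * Y x y := rfl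

theorem blockMulRight_apply (A : (Fin m → Fin 2) → Matrix (Fin n → Fin 2) (Fin n → Fin 2) ℂ)
    (Y : BlockState n m) (x y : Fin m → Fin 2) : blockMulRight A Y x y = Y x y * A y := rfl

/-- The projection `|0⟩⟨0| ⊗ 1 + |1⟩⟨1| ⊗ σ` of the record `t` and the main register. -/
def ctlProj (t : Fin m) (σ : Matrix (Fin n → Fin 2) (Fin n → Fin 2) ℂ) (x : Fin m → Fin 2) :
    Matrix (Fin n → Fin 2) (Fin n → Fin 2) ℂ :=
  if x t = 1 then σ else 1

/-- The replacement of the main register by `σ`, controlled coherently by the record `t`: what the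
swap with a fresh register in state `σ`, controlled by the record, does. -/
def swapMap (t : Fin m) (σ : Matrix (Fin n → Fin 2) (Fin n → Fin 2) ℂ) :
    Module.End ℂ (BlockState n m) where
  toFun Y x y :=
    if x t = 1 then if y t = 1 then (Y x y).trace • σ else σ * Y x y
    else if y t = 1 then Y x y * σ else Y x y
  map_add' Y Z := by
    funext x y
    simp only [Pi.add_apply]
    split_ifs
    · rw [Matrix.trace_add, add_smul]
    · rw [mul_add]
    · rw [add_mul]
    · rfl
  map_smul' c Y := by
    funext x y
    simp only [Pi.smul_apply, RingHom.id_apply]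
    split_ifs
    · rw [Matrix.trace_smul, smul_assoc]
    · rw [mul_smul_comm]
    · rw [smul_mul_assoc]
    · rfl

theorem swapMap_apply (t : Fin m) (σ : Matrix (Fin n → Fin 2) (Fin n → Fin 2) ℂ)
    (Y : BlockState n m) (x y : Fin m → Fin 2) :
    swapMap t σ Y x y = if x t = 1 then if y t = 1 then (Y x y).trace • σ else σ * Y x y
      else if y t = 1 then Y x y * σ else Y x y := rfl

/-- The commutator `Y ↦ -i [Π, Y]` with `Π = ctlProj t σ`. -/
def ctlComm (t : Fin m) (σ : Matrix (Fin n → Fin 2) (Fin n → Fin 2) ℂ) :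
    Module.End ℂ (BlockState n m) :=
  Complex.I • (blockMulRight (ctlProj t σ) - blockMulLeft (ctlProj t σ))

/-- The reduced channel of the partial swap by an angle `β`. -/
def partialSwap (β : ℝ) (t : Fin m) (σ : Matrix (Fin n → Fin 2) (Fin n → Fin 2) ℂ) :
    Module.End ℂ (BlockState n m) :=
  ((Real.cos β ^ 2 : ℝ) : ℂ) • 1 + ((Real.sin β ^ 2 : ℝ) : ℂ) • swapMap t σ +
    ((Real.sin β * Real.cos β : ℝ) : ℂ) • ctlComm t σ

theorem partialSwap_apply (β : ℝ) (t : Fin m) (σ : Matrix (Fin n → Fin 2) (Fin n → Fin 2) ℂ)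
    (Y : BlockState n m) (x y : Fin m → Fin 2) :
    partialSwap β t σ Y x y = ((Real.cos β ^ 2 : ℝ) : ℂ) • Y x y +
      ((Real.sin β ^ 2 : ℝ) : ℂ) • swapMap t σ Y x y +
      ((Real.sin β * Real.cos β : ℝ) : ℂ) •
        Complex.I • (Y x y * ctlProj t σ y - ctlProj t σ x * Y x y) := rfl

/-- The entries after conjugation with `p - i q V`, where `V` permutes the basis labels. -/
theorem rotation_conj_apply (f : Config n 1 (m + 1) → Config n 1 (m + 1)) (p q : ℝ)
    (X : Op n 1 (m + 1)) (c c' : Config n 1 (m + 1)) :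
    (((p : ℂ) • (1 : Op n 1 (m + 1)) + (-(Complex.I * q)) • pullOp f) * X *
      ((p : ℂ) • (1 : Op n 1 (m + 1)) + (-(Complex.I * q)) • pullOp f)ᴴ) c c' =
    p ^ 2 * X c c' + q ^ 2 * X (f c) (f c') +
      q * p * (Complex.I * (X c (f c') - X (f c) c')) := by
  have h : ((p : ℂ) • (1 : Op n 1 (m + 1)) + (-(Complex.I * q)) • pullOp f)ᴴ =
      (p : ℂ) • (1 : Op n 1 (m + 1)) + (Complex.I * q) • (pullOp f)ᴴ := by
    simp [Matrix.conjTranspose_add, Matrix.conjTranspose_smul]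
  rw [h]
  simp only [mul_add, add_mul, smul_mul_assoc, mul_smul_comm, one_mul, mul_one, Matrix.add_apply,
    Matrix.smul_apply, smul_eq_mul, mul_pullOp_conjTranspose_apply, pullOp_mul_apply]
  linear_combination (-(q : ℂ) * q * X (f c) (f c')) * Complex.I_mul_I

end PartialSwap

section

variable {d K m : ℕ} (φin φout : Fin (K + 1) → EuclideanSpace ℂ (Fin d))

/-- After the preparation the kickback ancilla is in the state `(|0⟩ + |1⟩)/√2` and the second register
holds a fresh copy, in a product with the reduced state. -/
theorem prepare_apply (o : Bool) (k : Fin (K + 1)) (X : Op (numQubits d) 1 (m + 1))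
    (u r v r' : Fin (numQubits d) → Fin 2) (b b' : Fin 2) (x y : Fin m → Fin 2) :
    runProg φin φout [.fresh 0, load o 1 k,
        .gate1 (.inr 0) ⟨hadamard, hadamard_mem_unitaryGroup⟩] X
      (cfg u r b x) (cfg v r' b' y) =
    1 / 2 * (src φin φout o k r r' * reduced X x y u v) := by
  have hfresh : (Instr.fresh 0 : Instr K (numQubits d) 1 (m + 1)).apply φin φout X =
      freshAnc 0 X := rfl
  have hgate : ∀ Y : Op (numQubits d) 1 (m + 1),
      (Instr.gate1 (.inr 0) ⟨hadamard, hadamard_mem_unitaryGroup⟩ :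
        Instr K (numQubits d) 1 (m + 1)).apply φin φout Y =
      gate1Op (.inr 0) hadamard * Y * (gate1Op (.inr 0) hadamard)ᴴ := fun _ => rfl
  have hh : ∀ b, hadamard b 0 = (1 / √2 : ℂ) := by
    intro b; fin_cases b <;> simp [hadamard]
  rw [runProg_cons, runProg_cons, runProg_cons, runProg_nil, hfresh, load_apply, hgate,
    gate1Op_conj_apply]
  simp only [update_cfg_kick, cfg_kick, loadReg, setReg_one_cfg, cfg_second, freshAnc,
    Fin.sum_univ_two, one_ne_zero, and_false, false_and, and_self, if_false, if_true, mul_zero,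
    zero_mul, add_zero, Finset.sum_const_zero, hh]
  rw [← sqrt_two_inv_mul_self, reduced_apply]
  simp only [Fin.sum_univ_two]
  have hs : star (1 / √2 : ℂ) = 1 / √2 := by simp
  rw [hs]; ring

/-- The partial swap with a fresh register has the reduced action `partialSwap`. -/
theorem reduced_partialSwapProg (β : ℝ) (o : Bool) (t : Fin m) (k : Fin (K + 1))
    (htr : (src φin φout o k).trace = 1) (X : Op (numQubits d) 1 (m + 1)) :
    reduced (runProg φin φout (partialSwapProg β o t k) X) =
      partialSwap β t (src φin φout o k) (reduced X) := by
  have hgate : ∀ Y : Op (numQubits d) 1 (m + 1),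
      runProg φin φout [.gate2 (.inr t.succ) (.inr 0) (by simp) ⟨_, rotCnot_mem_unitaryGroup β⟩] Y =
      gate2Op (.inr t.succ) (.inr 0) (rotCnot β) * Y *
        (gate2Op (.inr t.succ) (.inr 0) (rotCnot β))ᴴ := fun _ => rfl
  have hG : gate2Op (.inr t.succ) (.inr 0) (rotCnot β) =
      (Real.cos β : ℂ) • (1 : Op (numQubits d) 1 (m + 1)) + (-(Complex.I * Real.sin β)) •
        pullOp (cnotMap (.inr t.succ) (.inr 0)) := by
    rw [rotCnot, gate2Op_smul_add_smul, gate2Op_one, gate2Op_cnot (by simp)]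
  have hS : ∀ Y : Op (numQubits d) 1 (m + 1), runProg φin φout ctlSwapProg Y =
      Y.submatrix (ctlSwapMap (List.finRange _)) (ctlSwapMap (List.finRange _)) := fun Y =>
    runProg_flatMap_fredkinProg φin φout _ (List.nodup_finRange _) Y
  funext x y
  ext u v
  rw [partialSwapProg, runProg_append, runProg_append, runProg_append, reduced_apply, hS, hgate, hS,
    hG]
  simp only [Matrix.submatrix_apply, rotation_conj_apply, ctlSwapMap_ctlSwapMap,
    ctlSwapMap_cnotMap_ctlSwapMap]
  set σ := src φin φout o k with hσ
  set Y := reduced X with hY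
  have htr' : ∑ r, σ r r = 1 := htr
  rw [partialSwap_apply, swapMap_apply]
  have e1 : ∑ r, (σ r r * Y x y u v) = Y x y u v := by rw [← Finset.sum_mul, htr', one_mul]
  have e2 : ∑ r, (σ u r * Y x y r v) = (σ * Y x y) u v := rfl
  have e3 : ∑ r, (σ r v * Y x y u r) = (Y x y * σ) u v := by
    rw [Matrix.mul_apply]; exact Finset.sum_congr rfl fun r _ => mul_comm _ _
  have e4 : ∑ r, (σ u v * Y x y r r) = (Y x y).trace * σ u v := by
    rw [← Finset.mul_sum, mul_comm]; rfl
  simp only [ctlProj, Matrix.add_apply, Matrix.smul_apply, Matrix.sub_apply, smul_eq_mul,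
    Complex.ofReal_pow, Complex.ofReal_mul]
  by_cases hx : x t = 1 <;> by_cases hy : y t = 1 <;>
    simp only [hx, hy, if_true, if_false, prepare_apply, Fin.sum_univ_two, ← hσ, ← hY, mul_one,
      one_mul, Matrix.smul_apply, smul_eq_mul] <;>
    [rw [← e4, ← e2, ← e3]; rw [← e2]; rw [← e3]; skip] <;>
    conv_rhs => rw [← e1]
  all_goals
    simp only [Finset.mul_sum, ← Finset.sum_add_distrib, ← Finset.sum_sub_distrib]
    refine Finset.sum_congr rfl fun r _ => ?_
    ring

end

/-! ### The encoding isometry -/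

section Encoding

variable {d : ℕ}

theorem encode_injective : Function.Injective (encode (d := d)) := fun _ _ h =>
  Fin.castLE_injective _ (finFunctionFinEquiv.symm.injective h)

theorem encodeMatrix_conjTranspose_mul_self (d : ℕ) :
    (encodeMatrix d)ᴴ * encodeMatrix d = 1 := by
  ext
  simp only [Matrix.mul_apply, Matrix.conjTranspose_apply, encodeMatrix, Matrix.one_apply,
    apply_ite star, star_one, star_zero, mul_ite, mul_one, mul_zero]
  simp [encode_injective.eq_iff, eq_comm]

theorem encodeOp_mul (X Y : Matrix (Fin d) (Fin d) ℂ) :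
    encodeOp X * encodeOp Y = encodeOp (X * Y) := by
  simp only [encodeOp, Matrix.mul_assoc]
  rw [← Matrix.mul_assoc (encodeMatrix d)ᴴ (encodeMatrix d), encodeMatrix_conjTranspose_mul_self,
    Matrix.one_mul]

theorem mul_encodeMatrix_of_encodeOp (X : Matrix (Fin d) (Fin d) ℂ) :
    encodeOp X * encodeMatrix d = encodeMatrix d * X := by
  rw [encodeOp, Matrix.mul_assoc, encodeMatrix_conjTranspose_mul_self, Matrix.mul_one]

theorem trace_encodeOp (X : Matrix (Fin d) (Fin d) ℂ) : (encodeOp X).trace = X.trace := by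
  rw [encodeOp, Matrix.trace_mul_comm, ← Matrix.mul_assoc, encodeMatrix_conjTranspose_mul_self,
    Matrix.one_mul]

theorem encodeOp_conjTranspose (X : Matrix (Fin d) (Fin d) ℂ) :
    (encodeOp X)ᴴ = encodeOp Xᴴ := by
  simp [encodeOp, Matrix.conjTranspose_mul, Matrix.mul_assoc]

theorem encodeOp_smul (c : ℂ) (X : Matrix (Fin d) (Fin d) ℂ) :
    encodeOp (c • X) = c • encodeOp X := by
  simp [encodeOp]

theorem encodeOp_posSemidef {X : Matrix (Fin d) (Fin d) ℂ} (hX : X.PosSemidef) :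
    (encodeOp X).PosSemidef :=
  hX.mul_mul_conjTranspose_same _

variable {K : ℕ} {φin φout : Fin (K + 1) → EuclideanSpace ℂ (Fin d)}

theorem norm_cond (hin : ∀ i, ‖φin i‖ = 1) (hout : ∀ i, ‖φout i‖ = 1) (o : Bool)
    (k : Fin (K + 1)) : ‖cond o φout φin k‖ = 1 := by
  cases o
  · exact hin k
  · exact hout k

theorem src_mul_self (hin : ∀ i, ‖φin i‖ = 1) (hout : ∀ i, ‖φout i‖ = 1) (o : Bool)
    (k : Fin (K + 1)) : src φin φout o k * src φin φout o k = src φin φout o k := by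
  rw [src, encodeOp_mul, ketbra_mul_self _ (norm_cond hin hout o k)]

theorem trace_src (hin : ∀ i, ‖φin i‖ = 1) (hout : ∀ i, ‖φout i‖ = 1) (o : Bool)
    (k : Fin (K + 1)) : (src φin φout o k).trace = 1 := by
  rw [src, trace_encodeOp, trace_ketbra _ (norm_cond hin hout o k)]

end Encoding

/-! ### Signed mixtures of programs -/

/-- Linear maps on reduced states that depend on the input and output states. -/
abbrev StateMap (d K m : ℕ) : Type :=
  (Fin (K + 1) → EuclideanSpace ℂ (Fin d)) → (Fin (K + 1) → EuclideanSpace ℂ (Fin d)) →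
    Module.End ℂ (BlockState (numQubits d) m)

/-- `Φ` is a linear combination, with real coefficients of total absolute value `γ`, of the reduced
channels of programs with at most `c` copies and `g` gates each. The combination does not depend on
the states. A random choice among the programs, together with signs and the factor `γ` in the
classical post-processing, then gives unbiased estimates of linear functionals of `Φ`. -/
def Implements {d K m : ℕ} (Φ : StateMap d K m) (γ : ℝ) (c g : ℕ) : Prop :=
  ∃ L : List (ℝ × Prog d K m), (L.map fun p => |p.1|).sum = γ ∧
    (∀ p ∈ L, copiesOf p.2 ≤ c ∧ gatesOf p.2 ≤ g) ∧
    ∀ φin φout : Fin (K + 1) → EuclideanSpace ℂ (Fin d), (∀ i, ‖φin i‖ = 1) →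
      (∀ i, ‖φout i‖ = 1) → ∀ X,
        (L.map fun p => (p.1 : ℂ) • reduced (runProg φin φout p.2 X)).sum = Φ φin φout (reduced X)

namespace Implements

variable {d K m : ℕ} {Φ Ψ : StateMap d K m} {γ γ' : ℝ} {c c' g g' : ℕ}

theorem congr (h : Implements Φ γ c g)
    (hΦ : ∀ φin φout : Fin (K + 1) → EuclideanSpace ℂ (Fin d), (∀ i, ‖φin i‖ = 1) →
      (∀ i, ‖φout i‖ = 1) → Φ φin φout = Ψ φin φout) : Implements Ψ γ c g := by
  obtain ⟨L, h1, h2, h3⟩ := h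
  exact ⟨L, h1, h2, fun φin φout hin hout X => by
    rw [h3 φin φout hin hout, hΦ φin φout hin hout]⟩

theorem mono (h : Implements Φ γ c g) (hc : c ≤ c') (hg : g ≤ g') : Implements Φ γ c' g' := by
  obtain ⟨L, h1, h2, h3⟩ := h
  exact ⟨L, h1, fun p hp => ⟨(h2 p hp).1.trans hc, (h2 p hp).2.trans hg⟩, h3⟩

theorem of_prog (p : Prog d K m)
    (h : ∀ φin φout : Fin (K + 1) → EuclideanSpace ℂ (Fin d), (∀ i, ‖φin i‖ = 1) →
      (∀ i, ‖φout i‖ = 1) → ∀ X, reduced (runProg φin φout p X) = Φ φin φout (reduced X)) :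
    Implements Φ 1 (copiesOf p) (gatesOf p) :=
  ⟨[(1, p)], by simp, by simp, fun φin φout hin hout X => by simp [h φin φout hin hout]⟩

theorem one : Implements (1 : StateMap d K m) 1 0 0 :=
  of_prog [] fun _ _ _ _ _ => rfl

theorem zero : Implements (0 : StateMap d K m) 0 c g :=
  ⟨[], by simp, by simp, fun _ _ _ _ _ => rfl⟩

theorem add (h : Implements Φ γ c g) (h' : Implements Ψ γ' c g) :
    Implements (Φ + Ψ) (γ + γ') c g := by
  obtain ⟨L, h1, h2, h3⟩ := h
  obtain ⟨L', h1', h2', h3'⟩ := h'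
  refine ⟨L ++ L', by simp [h1, h1'], fun p hp => ?_, fun φin φout hin hout X => ?_⟩
  · rcases List.mem_append.mp hp with hp | hp
    · exact h2 p hp
    · exact h2' p hp
  · rw [List.map_append, List.sum_append, h3 φin φout hin hout, h3' φin φout hin hout]; rfl

theorem smul (a : ℝ) (h : Implements Φ γ c g) : Implements ((a : ℂ) • Φ) (|a| * γ) c g := by
  obtain ⟨L, h1, h2, h3⟩ := h
  refine ⟨L.map fun p => (a * p.1, p.2), ?_, fun p hp => ?_, fun φin φout hin hout X => ?_⟩
  · rw [List.map_map, ← h1, ← List.sum_map_mul_left]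
    simp [Function.comp_def, abs_mul]
  · obtain ⟨q, hq, rfl⟩ := List.mem_map.mp hp
    exact h2 q hq
  · rw [List.map_map, Pi.smul_apply, Pi.smul_apply, LinearMap.smul_apply,
      ← h3 φin φout hin hout X, List.smul_sum, List.map_map]
    congr 1
    refine List.map_congr_left fun p _ => ?_
    simp [mul_smul]

theorem mul (h : Implements Φ γ c g) (h' : Implements Ψ γ' c' g') :
    Implements (Φ * Ψ) (γ * γ') (c + c') (g + g') := by
  obtain ⟨L, h1, h2, h3⟩ := h
  obtain ⟨L', h1', h2', h3'⟩ := h'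
  refine ⟨L'.flatMap fun p => L.map fun q => (q.1 * p.1, p.2 ++ q.2), ?_, fun r hr => ?_,
    fun φin φout hin hout X => ?_⟩
  · rw [← h1', ← List.sum_map_mul_left, List.map_flatMap, List.flatMap, List.sum_flatten,
      List.map_map]
    congr 1
    refine List.map_congr_left fun p _ => ?_
    rw [Function.comp_apply, List.map_map, ← h1, ← List.sum_map_mul_right]
    simp [Function.comp_def, abs_mul]
  · obtain ⟨p, hp, hr⟩ := List.mem_flatMap.mp hr
    obtain ⟨q, hq, rfl⟩ := List.mem_map.mp hr
    rw [copiesOf_append, gatesOf_append]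
    have e1 := h2 q hq
    have e2 := h2' p hp
    omega
  · rw [Pi.mul_apply, Pi.mul_apply, Module.End.mul_apply, ← h3' φin φout hin hout X,
      List.map_flatMap, List.flatMap, List.sum_flatten, map_list_sum, List.map_map, List.map_map]
    congr 1
    refine List.map_congr_left fun p _ => ?_
    rw [Function.comp_apply, Function.comp_apply, map_smul, ← h3 φin φout hin hout, List.smul_sum,
      List.map_map, List.map_map]
    congr 1
    refine List.map_congr_left fun q _ => ?_
    rw [Function.comp_apply, Function.comp_apply, runProg_append, Complex.ofReal_mul, smul_smul,
      mul_comm]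

theorem pow (h : Implements Φ γ c g) (l : ℕ) : Implements (Φ ^ l) (γ ^ l) (l * c) (l * g) := by
  induction l with
  | zero => simpa using one
  | succ l ih =>
    rw [pow_succ, pow_succ, Nat.succ_mul, Nat.succ_mul]
    exact ih.mul h

theorem sum {ι : Type*} (s : Finset ι) {Φ : ι → StateMap d K m} {γ : ι → ℝ}
    (h : ∀ i, Implements (Φ i) (γ i) c g) : Implements (∑ i ∈ s, Φ i) (∑ i ∈ s, γ i) c g := by
  classical
  induction s using Finset.induction_on with
  | empty => simpa using zero
  | insert i s hi ih => rw [Finset.sum_insert hi, Finset.sum_insert hi]; exact (h i).add ih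

theorem walkAvg {T : ℕ} {F : List (Fin (K + 1)) → StateMap d K m}
    (h : ∀ ks, ks.length = T → Implements (F ks) γ c g) :
    Implements (UQE.walkAvg K T F) γ c g := by
  induction T generalizing F with
  | zero => exact h [] rfl
  | succ T ih =>
    have hw : γ = ∑ k, |walkWeight K k| * γ := by
      rw [← Finset.sum_mul]
      simp only [abs_of_nonneg (walkWeight_nonneg _), sum_walkWeight, one_mul]
    rw [hw, UQE.walkAvg]
    exact sum _ fun k => (ih fun ks hks => h (k :: ks) (by simp [hks])).smul (walkWeight K k)

end Implements

/-! ### Controlled reflections from partial swaps -/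

section Rotation

variable {n m : ℕ} {t : Fin m} {σ : Matrix (Fin n → Fin 2) (Fin n → Fin 2) ℂ}

theorem ctlProj_mul_self (hσ : σ * σ = σ) (x : Fin m → Fin 2) :
    ctlProj t σ x * ctlProj t σ x = ctlProj t σ x := by
  simp only [ctlProj]; split_ifs <;> simp [hσ]

/-- `exp (-iθ Π)` for the projection `Π = ctlProj t σ`. -/
def ctlPhase (θ : ℝ) (t : Fin m) (σ : Matrix (Fin n → Fin 2) (Fin n → Fin 2) ℂ)
    (x : Fin m → Fin 2) : Matrix (Fin n → Fin 2) (Fin n → Fin 2) ℂ :=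
  1 + (Complex.exp (-(θ * Complex.I)) - 1) • ctlProj t σ x

/-- Conjugation with `exp (-iθ Π)`. -/
def ctlRotation (θ : ℝ) (t : Fin m) (σ : Matrix (Fin n → Fin 2) (Fin n → Fin 2) ℂ) :
    Module.End ℂ (BlockState n m) :=
  blockMulLeft (ctlPhase θ t σ) * blockMulRight (ctlPhase (-θ) t σ)

theorem ctlRotation_apply (θ : ℝ) (Y : BlockState n m) (x y : Fin m → Fin 2) :
    ctlRotation θ t σ Y x y = ctlPhase θ t σ x * (Y x y * ctlPhase (-θ) t σ y) := rfl

theorem ctlPhase_mul (hσ : σ * σ = σ) (θ θ' : ℝ) (x : Fin m → Fin 2) :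
    ctlPhase θ t σ x * ctlPhase θ' t σ x = ctlPhase (θ + θ') t σ x := by
  simp only [ctlPhase, mul_add, add_mul, one_mul, mul_one, smul_mul_smul_comm, ctlProj_mul_self hσ]
  have h : Complex.exp (-(((θ + θ' : ℝ) : ℂ) * Complex.I)) =
      Complex.exp (-(θ * Complex.I)) * Complex.exp (-(θ' * Complex.I)) := by
    rw [← Complex.exp_add]; congr 1; push_cast; ring
  rw [h]
  module

theorem ctlRotation_mul (hσ : σ * σ = σ) (θ θ' : ℝ) :
    ctlRotation θ t σ * ctlRotation θ' t σ = ctlRotation (θ + θ') t σ := by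
  refine LinearMap.ext fun Y => ?_
  funext x y
  rw [Module.End.mul_apply, ctlRotation_apply, ctlRotation_apply, ctlRotation_apply,
    ← ctlPhase_mul hσ, neg_add, add_comm (-θ), ← ctlPhase_mul hσ]
  simp only [mul_assoc]

theorem ctlRotation_zero : ctlRotation 0 t σ = 1 := by
  refine LinearMap.ext fun Y => ?_
  funext x y
  simp [ctlRotation_apply, ctlPhase]

theorem ctlRotation_pow (hσ : σ * σ = σ) (θ : ℝ) (l : ℕ) :
    ctlRotation θ t σ ^ l = ctlRotation (l * θ) t σ := by
  induction l with
  | zero => simp [ctlRotation_zero]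
  | succ l ih => rw [pow_succ, ih, ctlRotation_mul hσ]; push_cast; congr 1; ring

/-- The difference of two opposite partial swaps is the commutator. -/
theorem partialSwap_sub_partialSwap :
    partialSwap (Real.pi / 4) t σ - partialSwap (-(Real.pi / 4)) t σ = ctlComm t σ := by
  have h : Real.sin (Real.pi / 4) * Real.cos (Real.pi / 4) = 1 / 2 := by
    rw [Real.sin_pi_div_four, Real.cos_pi_div_four, div_mul_div_comm,
      Real.mul_self_sqrt (by norm_num)]
    norm_num
  rw [partialSwap, partialSwap, Real.cos_neg, Real.sin_neg, neg_sq, neg_mul, h]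
  push_cast
  module

/-- The rotation by `θ` is the partial swap by `θ` up to corrections of second order in `θ`, which
are again combinations of partial swaps. -/
theorem ctlRotation_eq (hσ : σ * σ = σ) (θ : ℝ) (hθ : 0 < Real.cos θ) :
    ctlRotation θ t σ =
      (((Real.cos θ)⁻¹ : ℝ) : ℂ) • partialSwap θ t σ + ((1 - Real.cos θ : ℝ) : ℂ) • 1 +
      ((-(Real.sin θ ^ 2 * (Real.cos θ)⁻¹) : ℝ) : ℂ) • partialSwap (Real.pi / 2) t σ +
      ((1 - Real.cos θ : ℝ) : ℂ) •
        ((partialSwap (Real.pi / 4) t σ + ((-1 : ℝ) : ℂ) • partialSwap (-(Real.pi / 4)) t σ) *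
        (partialSwap (Real.pi / 4) t σ + ((-1 : ℝ) : ℂ) • partialSwap (-(Real.pi / 4)) t σ)) := by
  have hc : partialSwap (Real.pi / 4) t σ + ((-1 : ℝ) : ℂ) • partialSwap (-(Real.pi / 4)) t σ =
      ctlComm t σ := by
    rw [← partialSwap_sub_partialSwap]; push_cast; module
  have hhalf : partialSwap (Real.pi / 2) t σ = swapMap t σ := by
    simp [partialSwap]
  rw [hc, hhalf, partialSwap]
  set S := swapMap t σ
  -- both sides are polynomials in the commuting left and right multiplications by `Π`
  have hcomm2 : ctlComm t σ * ctlComm t σ =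
      (2 : ℂ) • (blockMulLeft (ctlProj t σ) * blockMulRight (ctlProj t σ)) -
        blockMulLeft (ctlProj t σ) - blockMulRight (ctlProj t σ) := by
    refine LinearMap.ext fun Y => ?_
    funext x y
    have e1 := ctlProj_mul_self (t := t) hσ x
    have e2 := ctlProj_mul_self (t := t) hσ y
    simp only [ctlComm, Module.End.mul_apply, LinearMap.smul_apply, LinearMap.sub_apply,
      Pi.smul_apply, Pi.sub_apply, blockMulLeft_apply, blockMulRight_apply, map_smul, map_sub]
    rw [mul_assoc, e2, ← mul_assoc (ctlProj t σ x) (ctlProj t σ x), e1, mul_assoc, smul_sub,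
      smul_smul, smul_smul, Complex.I_mul_I]
    module
  have hrot : ctlRotation θ t σ = 1 + (Complex.exp (-(θ * Complex.I)) - 1) •
      blockMulLeft (ctlProj t σ) + (Complex.exp (θ * Complex.I) - 1) •
      blockMulRight (ctlProj t σ) + ((Complex.exp (-(θ * Complex.I)) - 1) *
      (Complex.exp (θ * Complex.I) - 1)) •
      (blockMulLeft (ctlProj t σ) * blockMulRight (ctlProj t σ)) := by
    refine LinearMap.ext fun Y => ?_
    funext x y
    rw [ctlRotation_apply, ctlPhase, ctlPhase]
    simp only [LinearMap.add_apply, Pi.add_apply, LinearMap.smul_apply, Pi.smul_apply,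
      Module.End.mul_apply, Module.End.one_apply, blockMulLeft_apply, blockMulRight_apply, mul_add,
      add_mul, one_mul, mul_one, smul_mul_assoc, mul_smul_comm, Complex.ofReal_neg, neg_mul,
      neg_neg]
    module
  rw [hrot, hcomm2, ctlComm]
  have hexp : Complex.exp (θ * Complex.I) = Real.cos θ + Real.sin θ * Complex.I := by
    rw [Complex.exp_mul_I, Complex.ofReal_cos, Complex.ofReal_sin]
  have hexp' : Complex.exp (-(θ * Complex.I)) = Real.cos θ - Real.sin θ * Complex.I := by
    rw [← neg_mul, ← Complex.ofReal_neg, Complex.exp_mul_I, ← Complex.ofReal_cos,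
      ← Complex.ofReal_sin, Real.cos_neg, Real.sin_neg]
    push_cast; ring
  have hsc : (Real.sin θ : ℂ) ^ 2 + (Real.cos θ : ℂ) ^ 2 = 1 := by
    rw [← Complex.ofReal_pow, ← Complex.ofReal_pow, ← Complex.ofReal_add, Real.sin_sq_add_cos_sq,
      Complex.ofReal_one]
  have hI := Complex.I_sq
  have hc0 : (Real.cos θ : ℂ) ≠ 0 := by exact_mod_cast hθ.ne'
  rw [hexp, hexp']
  simp only [Complex.ofReal_inv, Complex.ofReal_neg, Complex.ofReal_mul, Complex.ofReal_sub,
    Complex.ofReal_pow, Complex.ofReal_one]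
  generalize (Real.cos θ : ℂ) = c at *
  generalize (Real.sin θ : ℂ) = s at *
  match_scalars
  · field_simp; ring
  · field_simp; ring
  · field_simp; ring
  · linear_combination (-s ^ 2) * hI + hsc
  · field_simp; ring

/-- The total weight of the decomposition of a rotation into partial swaps in `ctlRotation_eq`; the
square of the difference of two partial swaps contributes `4`. -/
def rotationWeight (θ : ℝ) : ℝ :=
  (Real.cos θ)⁻¹ + (1 - Real.cos θ) + Real.sin θ ^ 2 * (Real.cos θ)⁻¹ + 4 * (1 - Real.cos θ)

theorem rotationWeight_le {θ : ℝ} (h0 : 0 ≤ θ) (h1 : θ ≤ Real.pi / 3) :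
    rotationWeight θ ≤ 1 + 6 * θ ^ 2 := by
  have hc : 1 / 2 ≤ Real.cos θ := by
    rw [← Real.cos_pi_div_three]
    exact Real.cos_le_cos_of_nonneg_of_le_pi h0 (by linarith [Real.pi_pos]) h1
  have hq := Real.one_sub_sq_div_two_le_cos (x := θ)
  have hs : Real.sin θ ^ 2 ≤ θ ^ 2 :=
    pow_le_pow_left₀ (Real.sin_nonneg_of_nonneg_of_le_pi h0 (by linarith [Real.pi_pos]))
      (Real.sin_le h0) 2
  have hinv : (Real.cos θ)⁻¹ ≤ 2 := by
    rw [inv_le_comm₀ (by linarith) two_pos]; linarith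
  have hinv1 : (Real.cos θ)⁻¹ - 1 = (1 - Real.cos θ) * (Real.cos θ)⁻¹ := by
    rw [sub_mul, mul_inv_cancel₀ (by linarith), one_mul]
  have h2 : (1 - Real.cos θ) * (Real.cos θ)⁻¹ ≤ (1 - Real.cos θ) * 2 :=
    mul_le_mul_of_nonneg_left hinv (by linarith [Real.cos_le_one θ])
  have h3 : Real.sin θ ^ 2 * (Real.cos θ)⁻¹ ≤ θ ^ 2 * 2 :=
    mul_le_mul hs hinv (by positivity) (by positivity)
  rw [rotationWeight]
  nlinarith

theorem one_le_rotationWeight {θ : ℝ} (hc : 0 < Real.cos θ) : 1 ≤ rotationWeight θ := by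
  have h1 := (one_le_inv₀ hc).mpr (Real.cos_le_one θ)
  have h2 := Real.cos_le_one θ
  have h3 : 0 ≤ Real.sin θ ^ 2 * (Real.cos θ)⁻¹ := by positivity
  rw [rotationWeight]
  linarith

end Rotation

section

variable {d K m : ℕ}

theorem implements_partialSwap (β : ℝ) (o : Bool) (t : Fin m) (k : Fin (K + 1)) :
    Implements (fun φin φout : Fin (K + 1) → EuclideanSpace ℂ (Fin d) =>
      partialSwap β t (src φin φout o k)) 1 1 (12 * numQubits d + 2) := by
  have := Implements.of_prog (Φ := fun φin φout : Fin (K + 1) → EuclideanSpace ℂ (Fin d) =>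
    partialSwap β t (src φin φout o k)) (partialSwapProg β o t k) fun φin φout hin hout X =>
      reduced_partialSwapProg φin φout β o t k (trace_src hin hout o k) X
  rwa [copiesOf_partialSwapProg, gatesOf_partialSwapProg] at this

theorem implements_ctlRotation {θ : ℝ} (hθ : 0 < Real.cos θ) (o : Bool) (t : Fin m)
    (k : Fin (K + 1)) :
    Implements (fun φin φout : Fin (K + 1) → EuclideanSpace ℂ (Fin d) =>
      ctlRotation θ t (src φin φout o k)) (rotationWeight θ) 2 (24 * numQubits d + 4) := by
  have hE := fun β => implements_partialSwap (d := d) β o t k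
  have hE' := fun β => (hE β).mono (c' := 2) (g' := 24 * numQubits d + 4) (by omega) (by omega)
  have hD := (hE (Real.pi / 4)).add ((hE (-(Real.pi / 4))).smul (-1))
  have hDD := (hD.mul hD).mono (c' := 2) (g' := 24 * numQubits d + 4) (by omega) (by omega)
  have h1 := (Implements.one (d := d) (K := K) (m := m)).mono (c' := 2)
    (g' := 24 * numQubits d + 4) (by omega) (by omega)
  have hall := ((((hE' θ).smul (Real.cos θ)⁻¹).add (h1.smul (1 - Real.cos θ))).add
    ((hE' (Real.pi / 2)).smul (-(Real.sin θ ^ 2 * (Real.cos θ)⁻¹)))).add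
    (hDD.smul (1 - Real.cos θ))
  have hw : |(Real.cos θ)⁻¹| * 1 + |1 - Real.cos θ| * 1 +
      |-(Real.sin θ ^ 2 * (Real.cos θ)⁻¹)| * 1 +
      |1 - Real.cos θ| * ((1 + |(-1 : ℝ)| * 1) * (1 + |(-1 : ℝ)| * 1)) = rotationWeight θ := by
    rw [abs_neg, abs_neg, abs_of_pos (inv_pos.mpr hθ),
      abs_of_nonneg (sub_nonneg.mpr (Real.cos_le_one θ)),
      abs_of_nonneg (by positivity : 0 ≤ Real.sin θ ^ 2 * (Real.cos θ)⁻¹), abs_one,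
      rotationWeight]
    ring
  rw [hw] at hall
  refine hall.congr fun φin φout hin hout => ?_
  rw [ctlRotation_eq (src_mul_self hin hout o k) θ hθ]
  rfl

/-- The reflection `1 - 2Π`, with `Π = ctlProj t σ`, as a product of `L` small rotations. -/
theorem implements_reflection {L : ℕ} (hL : 3 ≤ L) (o : Bool) (t : Fin m) (k : Fin (K + 1)) :
    Implements (fun φin φout : Fin (K + 1) → EuclideanSpace ℂ (Fin d) =>
      ctlRotation Real.pi t (src φin φout o k)) (rotationWeight (Real.pi / L) ^ L) (L * 2)
      (L * (24 * numQubits d + 4)) := by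
  have hL' : (3 : ℝ) ≤ L := by exact_mod_cast hL
  have hθ : 0 < Real.cos (Real.pi / L) := by
    refine Real.cos_pos_of_mem_Ioo ⟨?_, ?_⟩
    · have : 0 < Real.pi / L := by positivity
      linarith [Real.pi_pos]
    · exact div_lt_div_of_pos_left Real.pi_pos two_pos (by linarith)
  refine ((implements_ctlRotation hθ o t k).pow L).congr fun φin φout hin hout => ?_
  rw [Pi.pow_apply, Pi.pow_apply, ctlRotation_pow (src_mul_self hin hout o k)]
  congr 1
  field_simp

end

/-! ### The emulation protocol -/

section Protocol

variable {n m : ℕ}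

/-- The Hadamard gate on the record `t`. -/
def hadamardMap (t : Fin m) : Module.End ℂ (BlockState n m) where
  toFun Y x y := ∑ e, ∑ e', (hadamard (x t) e * star (hadamard (y t) e')) •
    Y (Function.update x t e) (Function.update y t e')
  map_add' Y Z := by
    funext x y
    simp only [Pi.add_apply, smul_add, Finset.sum_add_distrib]
  map_smul' c Y := by
    funext x y
    simp only [Pi.smul_apply, RingHom.id_apply, Finset.smul_sum, smul_comm c]

theorem hadamardMap_apply (t : Fin m) (Y : BlockState n m) (x y : Fin m → Fin 2) :
    hadamardMap t Y x y = ∑ e, ∑ e', (hadamard (x t) e * star (hadamard (y t) e')) •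
      Y (Function.update x t e) (Function.update y t e') := rfl

/-- The replacement of the content of the main register by `σ`. -/
def resetMap (σ : Matrix (Fin n → Fin 2) (Fin n → Fin 2) ℂ) : Module.End ℂ (BlockState n m) where
  toFun Y x y := (Y x y).trace • σ
  map_add' Y Z := by
    funext x y
    simp only [Pi.add_apply, Matrix.trace_add, add_smul]
  map_smul' c Y := by
    funext x y
    simp only [Pi.smul_apply, RingHom.id_apply, Matrix.trace_smul, smul_assoc]

theorem resetMap_apply (σ : Matrix (Fin n → Fin 2) (Fin n → Fin 2) ℂ) (Y : BlockState n m)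
    (x y : Fin m → Fin 2) : resetMap σ Y x y = (Y x y).trace • σ := rfl

/-- The coherent measurement of `σ`, with the outcome added to the record `t`. -/
def measureMap (t : Fin m) (σ : Matrix (Fin n → Fin 2) (Fin n → Fin 2) ℂ) :
    Module.End ℂ (BlockState n m) :=
  hadamardMap t * ctlRotation Real.pi t σ * hadamardMap t

/-- The reflection that is applied if the record has the value `a`: the outcome `0` of the
measurement means that the reference state was found. -/
def stepOp (σ : Matrix (Fin n → Fin 2) (Fin n → Fin 2) ℂ) (a : Fin 2) :
    Matrix (Fin n → Fin 2) (Fin n → Fin 2) ℂ :=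
  if a = 1 then 1 - (2 : ℂ) • σ else -1

/-- The Kraus operator of `measureMap` that changes the record from `a` to `c`. -/
def measureOp (σ : Matrix (Fin n → Fin 2) (Fin n → Fin 2) ℂ) (c a : Fin 2) :
    Matrix (Fin n → Fin 2) (Fin n → Fin 2) ℂ :=
  if c = a then -σ else σ - 1

theorem ctlPhase_pi (t : Fin m) (σ : Matrix (Fin n → Fin 2) (Fin n → Fin 2) ℂ)
    (x : Fin m → Fin 2) : ctlPhase Real.pi t σ x = stepOp σ (x t) := by
  have h : Complex.exp (-(Real.pi * Complex.I)) = -1 := by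
    rw [Complex.exp_neg, Complex.exp_pi_mul_I]; norm_num
  rw [ctlPhase, h, ctlProj, stepOp]
  split_ifs
  · module
  · module

theorem ctlPhase_neg_pi (t : Fin m) (σ : Matrix (Fin n → Fin 2) (Fin n → Fin 2) ℂ)
    (x : Fin m → Fin 2) : ctlPhase (-Real.pi) t σ x = stepOp σ (x t) := by
  have h : Complex.exp (-(((-Real.pi : ℝ) : ℂ) * Complex.I)) = -1 := by
    rw [Complex.ofReal_neg, neg_mul, neg_neg, Complex.exp_pi_mul_I]
  rw [ctlPhase, h, ctlProj, stepOp]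
  split_ifs
  · module
  · module

theorem ctlRotation_pi_apply (t : Fin m) (σ : Matrix (Fin n → Fin 2) (Fin n → Fin 2) ℂ)
    (Y : BlockState n m) (x y : Fin m → Fin 2) :
    ctlRotation Real.pi t σ Y x y = stepOp σ (x t) * Y x y * stepOp σ (y t) := by
  rw [ctlRotation_apply, ctlPhase_pi, ctlPhase_neg_pi, mul_assoc]

theorem sum_hadamard_stepOp (σ : Matrix (Fin n → Fin 2) (Fin n → Fin 2) ℂ) (c a : Fin 2) :
    ∑ e, (hadamard c e * hadamard e a) • stepOp σ e = measureOp σ c a := by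
  have h := sqrt_two_inv_mul_self
  rw [Fin.sum_univ_two]
  fin_cases c <;> fin_cases a <;>
    simp only [hadamard, stepOp, measureOp, Fin.zero_eta, Fin.mk_one, Matrix.smul_apply,
      Matrix.of_apply, Matrix.cons_val', Matrix.cons_val_zero, Matrix.cons_val_one,
      Matrix.cons_val_fin_one, smul_eq_mul, mul_one, mul_neg, neg_mul, h, zero_ne_one, one_ne_zero,
      if_true, if_false] <;> module

theorem star_hadamard (c a : Fin 2) : star (hadamard c a) = hadamard a c :=
  congrFun (congrFun hadamard_conjTranspose a) c

theorem measureMap_apply (t : Fin m) (σ : Matrix (Fin n → Fin 2) (Fin n → Fin 2) ℂ)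
    (Y : BlockState n m) (x y : Fin m → Fin 2) :
    measureMap t σ Y x y = ∑ a, ∑ b, measureOp σ (x t) a *
      Y (Function.update x t a) (Function.update y t b) * measureOp σ (y t) b := by
  have hsymm : ∀ a c, hadamard a c = hadamard c a := by
    intro a c; fin_cases a <;> fin_cases c <;> simp [hadamard]
  simp only [measureMap, Module.End.mul_apply, hadamardMap_apply, ctlRotation_pi_apply,
    Function.update_self, Function.update_idem, star_hadamard, ← sum_hadamard_stepOp,
    Fin.sum_univ_two]
  rw [hsymm 0 (y t), hsymm 1 (y t), hsymm 0 1]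
  simp only [mul_add, add_mul, smul_add, smul_mul_assoc, mul_smul_comm, smul_smul]
  module

theorem measureOp_one_zero (σ : Matrix (Fin n → Fin 2) (Fin n → Fin 2) ℂ) :
    measureOp σ 1 0 = -(1 - σ) := by simp [measureOp]

theorem measureOp_zero_one (σ : Matrix (Fin n → Fin 2) (Fin n → Fin 2) ℂ) :
    measureOp σ 0 1 = -(1 - σ) := by simp [measureOp]

theorem measureOp_zero_zero (σ : Matrix (Fin n → Fin 2) (Fin n → Fin 2) ℂ) :
    measureOp σ 0 0 = -σ := by simp [measureOp]

theorem stepOp_zero (σ : Matrix (Fin n → Fin 2) (Fin n → Fin 2) ℂ) : stepOp σ 0 = -1 := by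
  simp [stepOp]

theorem stepOp_one (σ : Matrix (Fin n → Fin 2) (Fin n → Fin 2) ℂ) :
    stepOp σ 1 = 1 - (2 : ℂ) • σ := by
  simp [stepOp]

variable {K M : ℕ}

/-- The emulation protocol for given reflections. The reference input is measured coherently; if it
was not found, the next reflection is applied and the rest of the protocol is run; finally the
main register is overwritten with the reference output, and all steps are undone with output
states in the place of input states. A protocol with `l` steps uses the records `0, …, l`. -/
def protocol (σi σo : Fin (K + 1) → Matrix (Fin n → Fin 2) (Fin n → Fin 2) ℂ) :
    List (Fin (K + 1)) → Module.End ℂ (BlockState n (M + 1))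
  | [] => measureMap 0 (σo 0) * resetMap (σo 0) * measureMap 0 (σi 0)
  | k :: ks => measureMap (Fin.ofNat (M + 1) (ks.length + 1)) (σo 0) *
      ctlRotation Real.pi (Fin.ofNat (M + 1) (ks.length + 1)) (σo k) * protocol σi σo ks *
      ctlRotation Real.pi (Fin.ofNat (M + 1) (ks.length + 1)) (σi k) *
      measureMap (Fin.ofNat (M + 1) (ks.length + 1)) (σi 0)

/-- If the records of the protocol start in `0` and are found in `0` at the end, then the effect on
the main register is the compression by `returnOp`, followed by the isometry `W` that takes the
input states to the output states. The other records are spectators. -/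
theorem protocol_apply {σi σo : Fin (K + 1) → Matrix (Fin n → Fin 2) (Fin n → Fin 2) ℂ}
    {W : Matrix (Fin n → Fin 2) (Fin n → Fin 2) ℂ}
    (hσi : ∀ k, (σi k)ᴴ = σi k) (hσo : ∀ k, (σo k)ᴴ = σo k)
    (hW : ∀ k, σo k * W = W * σi k) (hσo0 : σo 0 * σo 0 = σo 0)
    (htr : ∀ Z, (σi 0 * Z * σi 0).trace • σo 0 = W * (σi 0 * Z * σi 0) * Wᴴ)
    (ks : List (Fin (K + 1))) (hks : ks.length ≤ M) (Y : BlockState n (M + 1))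
    (hYl : ∀ x y, (∃ s : Fin (M + 1), s.val ≤ ks.length ∧ x s ≠ 0) → Y x y = 0)
    (hYr : ∀ x y, (∃ s : Fin (M + 1), s.val ≤ ks.length ∧ y s ≠ 0) → Y x y = 0)
    (x y : Fin (M + 1) → Fin 2) (hx : ∀ s, s.val ≤ ks.length → x s = 0)
    (hy : ∀ s, s.val ≤ ks.length → y s = 0) :
    protocol σi σo ks Y x y = W * (returnOp σi ks * Y x y * returnOp σi ks) * Wᴴ := by
  have hW' : ∀ k, Wᴴ * σo k = σi k * Wᴴ := fun k => by
    have := congrArg Matrix.conjTranspose (hW k)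
    rwa [Matrix.conjTranspose_mul, Matrix.conjTranspose_mul, hσo, hσi] at this
  induction ks generalizing Y x y with
  | nil =>
    have hx0 : x 0 = 0 := hx 0 le_rfl
    have hy0 : y 0 = 0 := hy 0 le_rfl
    have hux : Function.update x 0 0 = x := by rw [← hx0]; exact Function.update_eq_self 0 x
    have huy : Function.update y 0 0 = y := by rw [← hy0]; exact Function.update_eq_self 0 y
    have hzl : ∀ y', Y (Function.update x 0 1) y' = 0 := fun y' =>
      hYl _ _ ⟨0, le_rfl, by simp⟩
    have hzr : ∀ x', Y x' (Function.update y 0 1) = 0 := fun x' =>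
      hYr _ _ ⟨0, le_rfl, by simp⟩
    have hQ : σo 0 * -(1 - σo 0) = 0 := by rw [mul_neg, mul_sub, mul_one, hσo0, sub_self, neg_zero]
    have e₁ : -σo 0 * σo 0 * -σo 0 = σo 0 := by
      rw [neg_mul, mul_neg, neg_mul, neg_neg, hσo0, hσo0]
    have e₂ : ∀ A, A * σo 0 * -(1 - σo 0) = 0 := fun A => by rw [mul_assoc, hQ, mul_zero]
    have e₃ : -(1 - σo 0) * σo 0 = 0 := by rw [neg_mul, sub_mul, one_mul, hσo0, sub_self, neg_zero]
    simp only [protocol, Module.End.mul_apply, measureMap_apply (m := M + 1), resetMap_apply,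
      Fin.sum_univ_two, hx0, hy0, measureOp_zero_zero, measureOp_zero_one, hux, huy,
      mul_smul_comm, smul_mul_assoc, e₁, e₂, e₃, zero_mul, smul_zero, add_zero, hzl, hzr, mul_zero]
    rw [returnOp, neg_mul, neg_mul, mul_neg, neg_neg]
    exact htr _
  | cons k ks ih =>
    set t := Fin.ofNat (M + 1) (ks.length + 1) with ht
    rw [List.length_cons] at hks hYl hYr hx hy
    have htv : t.val = ks.length + 1 := Nat.mod_eq_of_lt (Nat.lt_succ_of_le hks)
    have hxt : x t = 0 := hx t htv.le
    have hyt : y t = 0 := hy t htv.le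
    have hux : Function.update x t 0 = x := by rw [← hxt]; exact Function.update_eq_self t x
    have huy : Function.update y t 0 = y := by rw [← hyt]; exact Function.update_eq_self t y
    have hne : ∀ s : Fin (M + 1), s.val ≤ ks.length → s ≠ t := by
      rintro s hs rfl
      omega
    set Y₁ := ctlRotation Real.pi t (σi k) (measureMap t (σi 0) Y) with hY₁
    have hY₁_apply : ∀ x y, Y₁ x y = stepOp (σi k) (x t) * (measureOp (σi 0) (x t) 0 *
        Y (Function.update x t 0) (Function.update y t 0) * measureOp (σi 0) (y t) 0) *
        stepOp (σi k) (y t) := by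
      intro x y
      have hzl : ∀ y', Y (Function.update x t 1) y' = 0 := fun y' =>
        hYl _ _ ⟨t, htv.le, by simp⟩
      have hzr : ∀ x', Y x' (Function.update y t 1) = 0 := fun x' =>
        hYr _ _ ⟨t, htv.le, by simp⟩
      simp only [hY₁, ctlRotation_pi_apply, measureMap_apply, Fin.sum_univ_two, hzl, hzr, mul_zero,
        zero_mul, add_zero]
    have hinner : ∀ a b, protocol σi σo ks Y₁ (Function.update x t a) (Function.update y t b) =
        W * (returnOp σi ks * (stepOp (σi k) a * (measureOp (σi 0) a 0 * Y x y *
          measureOp (σi 0) b 0) * stepOp (σi k) b) * returnOp σi ks) * Wᴴ := by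
      intro a b
      rw [ih (by omega) Y₁ ?_ ?_ _ _ ?_ ?_, hY₁_apply]
      · simp only [Function.update_self, Function.update_idem, hux, huy]
      · rintro x' y' ⟨s, hs, hxs⟩
        rw [hY₁_apply, hYl _ _ ⟨s, by omega, by simpa [hne s hs] using hxs⟩]
        simp only [mul_zero, zero_mul]
      · rintro x' y' ⟨s, hs, hys⟩
        rw [hY₁_apply, hYr _ _ ⟨s, by omega, by simpa [hne s hs] using hys⟩]
        simp only [mul_zero, zero_mul]
      · intro s hs
        rw [Function.update_of_ne (hne s hs)]
        exact hx s (by omega)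
      · intro s hs
        rw [Function.update_of_ne (hne s hs)]
        exact hy s (by omega)
    have hfirst : protocol σi σo (k :: ks) Y x y = ∑ a, ∑ b,
        (measureOp (σo 0) 0 a * stepOp (σo k) a * W) * (returnOp σi ks * (stepOp (σi k) a *
          (measureOp (σi 0) a 0 * Y x y * measureOp (σi 0) b 0) * stepOp (σi k) b) *
          returnOp σi ks) * (Wᴴ * (stepOp (σo k) b * measureOp (σo 0) 0 b)) := by
      simp only [protocol, Module.End.mul_apply, ← ht, ← hY₁]
      rw [measureMap_apply]
      refine Finset.sum_congr rfl fun a _ => Finset.sum_congr rfl fun b _ => ?_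
      rw [ctlRotation_pi_apply, hinner, hxt, hyt]
      simp only [Function.update_self, mul_assoc]
    have hstep : ∀ a, stepOp (σo k) a * W = W * stepOp (σi k) a := by
      intro a
      simp only [stepOp]
      split_ifs
      · rw [sub_mul, mul_sub, one_mul, mul_one, smul_mul_assoc, hW, mul_smul_comm]
      · rw [neg_one_mul, mul_neg_one]
    have hstep' : ∀ a, Wᴴ * stepOp (σo k) a = stepOp (σi k) a * Wᴴ := by
      intro a
      simp only [stepOp]
      split_ifs
      · rw [sub_mul, mul_sub, one_mul, mul_one, mul_smul_comm, hW', smul_mul_assoc]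
      · rw [neg_one_mul, mul_neg_one]
    have hmeas : ∀ a, measureOp (σo 0) 0 a * W = W * measureOp (σi 0) 0 a := by
      intro a
      simp only [measureOp]
      split_ifs
      · rw [neg_mul, mul_neg, hW]
      · rw [sub_mul, mul_sub, one_mul, mul_one, hW]
    have hmeas' : ∀ a, Wᴴ * measureOp (σo 0) 0 a = measureOp (σi 0) 0 a * Wᴴ := by
      intro a
      simp only [measureOp]
      split_ifs
      · rw [neg_mul, mul_neg, hW']
      · rw [sub_mul, mul_sub, one_mul, mul_one, hW']
    have hl : ∀ a, measureOp (σo 0) 0 a * stepOp (σo k) a * W =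
        W * (measureOp (σi 0) 0 a * stepOp (σi k) a) := fun a => by
      rw [mul_assoc, hstep, ← mul_assoc, hmeas, mul_assoc]
    have hr : ∀ a, Wᴴ * (stepOp (σo k) a * measureOp (σo 0) 0 a) =
        stepOp (σi k) a * measureOp (σi 0) 0 a * Wᴴ := fun a => by
      rw [← mul_assoc, hstep', mul_assoc, hmeas', mul_assoc]
    rw [hfirst]
    simp only [hl, hr]
    have hG : returnOp σi (k :: ks) = ∑ a, measureOp (σi 0) 0 a * stepOp (σi k) a *
        returnOp σi ks * (stepOp (σi k) a * measureOp (σi 0) a 0) := by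
      rw [returnOp, Fin.sum_univ_two, measureOp_zero_zero, measureOp_zero_one, measureOp_one_zero,
        stepOp_zero, stepOp_one]
      simp only [neg_mul, mul_neg, neg_neg, one_mul, mul_one, mul_assoc]
    have hsymm : ∀ a, measureOp (σi 0) a 0 = measureOp (σi 0) 0 a := fun a => by
      simp only [measureOp, eq_comm]
    rw [hG]
    simp only [Finset.sum_mul, Finset.mul_sum, hsymm, mul_assoc]
    exact Finset.sum_comm

end Protocol

section

variable {d K m M : ℕ}

theorem implements_hadamardMap (t : Fin m) :
    Implements (fun _ _ => hadamardMap t : StateMap d K m) 1 0 1 := by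
  refine Implements.of_prog [.gate1 (.inr t.succ) ⟨hadamard, hadamard_mem_unitaryGroup⟩]
    fun φin φout _ _ X => ?_
  funext x y
  exact reduced_gate1_record t hadamard X x y

theorem implements_resetMap (o : Bool) (k : Fin (K + 1)) :
    Implements (fun φin φout => resetMap (src φin φout o k) : StateMap d K m) 1 1 0 := by
  have h := Implements.of_prog (Φ := (fun φin φout => resetMap (src φin φout o k) : StateMap d K m))
    [load o 0 k] fun φin φout _ _ X => by
      funext x y
      rw [runProg_cons, load_apply]
      exact reduced_loadReg_zero _ X x y
  cases o <;> exact h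

theorem implements_measureMap {L : ℕ} (hL : 3 ≤ L) (o : Bool) (t : Fin m) :
    Implements (fun φin φout => measureMap t (src φin φout o 0) : StateMap d K m)
      (rotationWeight (Real.pi / L) ^ L) (L * 2) (L * (24 * numQubits d + 4) + 2) := by
  have h := ((implements_hadamardMap t).mul (implements_reflection (d := d) (K := K) hL o t 0)).mul
    (implements_hadamardMap t)
  rw [one_mul, mul_one] at h
  exact h.mono (by omega) (by omega)

/-- A coherent measurement uses one reflection, so that there are four reflections for each step of
the walk and two more in the middle. -/
theorem implements_protocol {L : ℕ} (hL : 3 ≤ L) (ks : List (Fin (K + 1))) :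
    Implements (fun φin φout => protocol (src φin φout false) (src φin φout true) ks :
        StateMap d K (M + 1))
      ((rotationWeight (Real.pi / L) ^ L) ^ (4 * ks.length + 2))
      ((4 * ks.length + 2) * (L * 2) + 1)
      ((4 * ks.length + 2) * (L * (24 * numQubits d + 4) + 2)) := by
  induction ks with
  | nil =>
    have h := ((implements_measureMap (d := d) (K := K) hL true (0 : Fin (M + 1))).mul
      (implements_resetMap true 0)).mul (implements_measureMap hL false 0)
    rw [mul_one, ← sq] at h
    refine h.mono ?_ ?_ <;> simp only [List.length_nil] <;> omega
  | cons k ks ih =>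
    have h := ((((implements_measureMap (d := d) (K := K) hL true
      (Fin.ofNat (M + 1) (ks.length + 1))).mul (implements_reflection hL true
      (Fin.ofNat (M + 1) (ks.length + 1)) k)).mul ih).mul (implements_reflection hL false
      (Fin.ofNat (M + 1) (ks.length + 1)) k)).mul
      (implements_measureMap hL false (Fin.ofNat (M + 1) (ks.length + 1)))
    have e : rotationWeight (Real.pi / L) ^ L * rotationWeight (Real.pi / L) ^ L *
        (rotationWeight (Real.pi / L) ^ L) ^ (4 * ks.length + 2) *
        rotationWeight (Real.pi / L) ^ L * rotationWeight (Real.pi / L) ^ L =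
        (rotationWeight (Real.pi / L) ^ L) ^ (4 * (k :: ks).length + 2) := by
      rw [List.length_cons]; ring
    rw [e] at h
    refine h.mono ?_ ?_ <;> simp only [List.length_cons]
    · exact le_of_eq (by ring)
    · have : (4 * (ks.length + 1) + 2) * (L * (24 * numQubits d + 4) + 2) =
        (4 * ks.length + 2) * (L * (24 * numQubits d + 4) + 2) +
          4 * (L * (24 * numQubits d + 4)) + 8 := by ring
      rw [this]
      omega

end

/-! ### Concentration of the sample mean -/

section Concentration

open ProbabilityTheory

/-- The tail bound for the mean of `N` independent copies of a bounded random variable. -/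
theorem one_sub_le_pi_real_abs_sub_le {μ : Measure ℝ} [IsProbabilityMeasure μ] {B : ℝ}
    (hB : ∀ᵐ y ∂μ, |y| ≤ B) {ε δ t : ℝ} (hε : 0 < ε) {N : ℕ} (hN : 0 < N)
    (ht : |(∫ y, y ∂μ) - t| ≤ ε / 2) (hNB : 4 * B ^ 2 ≤ δ * ε ^ 2 * N) :
    1 - δ ≤ (Measure.pi fun _ : Fin N => μ).real {y | |(∑ j, y j) / N - t| ≤ ε} := by
  set P : Measure (Fin N → ℝ) := Measure.pi fun _ => μ
  have hN' : (0 : ℝ) < N := Nat.cast_pos.mpr hN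
  have hid : MemLp (fun y : ℝ => y) 2 μ :=
    MemLp.of_bound measurable_id.aestronglyMeasurable B (by simpa using hB)
  have hmp : ∀ j, MeasurePreserving (fun y : Fin N → ℝ => y j) P μ := fun j =>
    measurePreserving_eval _ j
  have hj : ∀ j, MemLp (fun y : Fin N → ℝ => y j) 2 P := fun j => hid.comp_measurePreserving (hmp j)
  have hsum : MemLp (fun y : Fin N → ℝ => ∑ j, y j) 2 P := memLp_finsetSum _ fun j _ => hj j
  have hmean : P[fun y => ∑ j, y j] = N * ∫ y, y ∂μ := by
    rw [integral_finsetSum _ fun j _ => (hj j).integrable one_le_two]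
    have : ∀ j, ∫ y : Fin N → ℝ, y j ∂P = ∫ y, y ∂μ := fun j => by
      conv_rhs => rw [← (hmp j).map_eq]
      exact (integral_map (hmp j).measurable.aemeasurable
        measurable_id.aestronglyMeasurable).symm
    simp [this]
  have hvar : Var[fun y => ∑ j, y j; P] ≤ N * B ^ 2 := by
    have h := variance_sum_pi (μ := fun _ : Fin N => μ) (X := fun _ y => y) fun _ => hid
    have e : (∑ i, fun ω : Fin N → ℝ => ω i) = fun y => ∑ j, y j := by ext y; simp
    rw [e] at h
    rw [h, Finset.sum_const, Finset.card_univ, Fintype.card_fin, nsmul_eq_mul]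
    refine mul_le_mul_of_nonneg_left ?_ hN'.le
    refine (variance_le_expectation_sq measurable_id.aestronglyMeasurable).trans ?_
    have hle : ∀ᵐ y ∂μ, ((fun y : ℝ => y) ^ 2) y ≤ B ^ 2 := by
      filter_upwards [hB] with y hy
      exact sq_le_sq' (abs_le.mp hy).1 (abs_le.mp hy).2
    have := integral_mono_ae hid.integrable_sq (integrable_const (B ^ 2)) hle
    simpa using this
  have hcheb := meas_ge_le_variance_div_sq hsum (c := N * ε / 2) (by positivity)
  have hbad : P.real {y | |(∑ j, y j) / N - t| ≤ ε}ᶜ ≤ δ := by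
    have hsub : {y : Fin N → ℝ | |(∑ j, y j) / N - t| ≤ ε}ᶜ ⊆
        {y | N * ε / 2 ≤ |(∑ j, y j) - P[fun y => ∑ j, y j]|} := by
      intro y hy
      simp only [Set.mem_compl_iff, Set.mem_ofPred_eq, not_le] at hy ⊢
      rw [hmean]
      have e : (∑ j, y j) - N * ∫ y, y ∂μ =
          N * (((∑ j, y j) / N - t) - ((∫ y, y ∂μ) - t)) := by field_simp; ring
      rw [e, abs_mul, abs_of_pos hN', mul_div_assoc]
      refine mul_le_mul_of_nonneg_left ?_ hN'.le
      have := abs_sub_abs_le_abs_sub ((∑ j, y j) / N - t) ((∫ y, y ∂μ) - t)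
      linarith
    refine (measureReal_mono hsub).trans ?_
    refine (ENNReal.toReal_mono ENNReal.ofReal_ne_top hcheb).trans ?_
    rw [ENNReal.toReal_ofReal (div_nonneg (variance_nonneg _ _) (sq_nonneg _)),
      div_le_iff₀ (by positivity)]
    refine hvar.trans ?_
    nlinarith
  have hmeas : MeasurableSet {y : Fin N → ℝ | |(∑ j, y j) / N - t| ≤ ε} := by
    apply measurableSet_le <;> fun_prop
  rw [probReal_compl_eq_one_sub hmeas] at hbad
  linarith

theorem ae_sum_smul {ι : Type*} [Fintype ι] (c : ι → ENNReal) (μ : ι → Measure ℝ) {p : ℝ → Prop}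
    (h : ∀ i, ∀ᵐ y ∂μ i, p y) : ∀ᵐ y ∂(∑ i, c i • μ i), p y := by
  rw [ae_iff, Measure.coe_finsetSum]
  simp only [Finset.sum_apply, Measure.smul_apply]
  exact Finset.sum_eq_zero fun i _ => by rw [ae_iff.mp (h i), smul_zero]

theorem integral_sum_smul {ι : Type*} [Fintype ι] {c : ι → ENNReal} (hc : ∀ i, c i ≠ ⊤)
    {μ : ι → Measure ℝ} (h : ∀ i, Integrable (fun y => y) (μ i)) :
    ∫ y, y ∂(∑ i, c i • μ i) = ∑ i, (c i).toReal * ∫ y, y ∂μ i := by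
  rw [integral_finsetSum_measure fun i _ => (h i).smul_measure (hc i)]
  simp [integral_smul_measure]

end Concentration

/-! ### Circuits preserve states -/

section States

variable {n s a : ℕ}

theorem gate1Op_one (w : Wire n s a) : gate1Op w 1 = (1 : Op n s a) := by
  ext c c'
  simp only [gate1Op, Matrix.one_apply]
  by_cases h : c = c'
  · subst h; simp
  · rw [if_neg h]
    split_ifs with h1 h2
    · refine absurd (funext fun x => ?_) h
      by_cases hx : x = w
      · rw [hx, h2]
      · exact h1 x hx
    · rfl
    · rfl

theorem gate1Op_conjTranspose (w : Wire n s a) (u : Matrix (Fin 2) (Fin 2) ℂ) :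
    (gate1Op w u : Op n s a)ᴴ = gate1Op w uᴴ := by
  ext c c'
  simp only [Matrix.conjTranspose_apply, gate1Op, eq_comm, apply_ite star, star_zero]

theorem gate2Op_conjTranspose (w w' : Wire n s a) (u : Matrix (Fin 2 × Fin 2) (Fin 2 × Fin 2) ℂ) :
    (gate2Op w w' u : Op n s a)ᴴ = gate2Op w w' uᴴ := by
  ext c c'
  simp only [Matrix.conjTranspose_apply, gate2Op, eq_comm, apply_ite star, star_zero]

theorem gate1Op_mul (w : Wire n s a) (u v : Matrix (Fin 2) (Fin 2) ℂ) :
    gate1Op w u * gate1Op w v = (gate1Op w (u * v) : Op n s a) := by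
  ext c c'
  rw [gate1Op_mul_apply]
  simp only [gate1Op, Function.update_self, Matrix.mul_apply]
  have h : ∀ e, (∀ x, x ≠ w → Function.update c w e x = c' x) ↔ ∀ x, x ≠ w → c x = c' x :=
    fun e => forall₂_congr fun x hx => by rw [Function.update_of_ne hx]
  simp only [h]
  split_ifs <;> simp

theorem gate1Op_conjTranspose_mul_self (w : Wire n s a) (u : Matrix.unitaryGroup (Fin 2) ℂ) :
    (gate1Op w u.1 : Op n s a)ᴴ * gate1Op w u.1 = 1 := by
  rw [gate1Op_conjTranspose, gate1Op_mul, ← Matrix.star_eq_conjTranspose,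
    Matrix.UnitaryGroup.star_mul_self, gate1Op_one]

theorem gate2Op_conjTranspose_mul_self {w w' : Wire n s a} (h : w ≠ w')
    (u : Matrix.unitaryGroup (Fin 2 × Fin 2) ℂ) :
    (gate2Op w w' u.1 : Op n s a)ᴴ * gate2Op w w' u.1 = 1 := by
  rw [gate2Op_conjTranspose, gate2Op_mul h, ← Matrix.star_eq_conjTranspose,
    Matrix.UnitaryGroup.star_mul_self, gate2Op_one]

theorem trace_conj_of_conjTranspose_mul_self {ι : Type*} [Fintype ι] [DecidableEq ι]
    {G : Matrix ι ι ℂ} (hG : Gᴴ * G = 1) (X : Matrix ι ι ℂ) : (G * X * Gᴴ).trace = X.trace := by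
  rw [Matrix.trace_mul_comm, ← mul_assoc, hG, one_mul]

theorem loadReg_posSemidef (j : Fin (s + 1)) {σ : Matrix (Fin n → Fin 2) (Fin n → Fin 2) ℂ}
    (hσ : σ.PosSemidef) {X : Op n s a} (hX : X.PosSemidef) : (loadReg j σ X).PosSemidef := by
  have h : loadReg j σ X = (σ.submatrix (fun b k => b (.inl (j, k))) fun b k => b (.inl (j, k))) ⊙
      ∑ c : Fin n → Fin 2, X.submatrix (fun b => setReg j b c) fun b => setReg j b c := by
    ext b b'
    simp [loadReg, Matrix.sum_apply]
  rw [h]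
  exact (hσ.submatrix _).hadamard (Matrix.posSemidef_sum _ fun _ _ => hX.submatrix _)

theorem trace_loadReg (j : Fin (s + 1)) (σ : Matrix (Fin n → Fin 2) (Fin n → Fin 2) ℂ)
    (X : Op n s a) : (loadReg j σ X).trace = σ.trace * X.trace := by
  have hinv : Function.Involutive fun p : Config n s a × (Fin n → Fin 2) =>
      (setReg j p.1 p.2, fun k => p.1 (.inl (j, k))) := by
    rintro ⟨b, c⟩
    refine Prod.ext ?_ ?_
    · funext v
      rcases v with ⟨i, k⟩ | i
      · by_cases h : i = j
        · subst h; simp [setReg]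
        · simp [setReg, h]
      · rfl
    · funext k
      simp [setReg]
  have h1 : (loadReg j σ X).trace = ∑ p : Config n s a × (Fin n → Fin 2),
      σ (fun k => p.1 (.inl (j, k))) (fun k => p.1 (.inl (j, k))) *
        X (setReg j p.1 p.2) (setReg j p.1 p.2) := by
    rw [Fintype.sum_prod_type]
    refine Finset.sum_congr rfl fun b _ => ?_
    simp only [Matrix.diag_apply, loadReg, Finset.mul_sum]
  have h2 : ∀ p : Config n s a × (Fin n → Fin 2), (fun k => setReg j p.1 p.2 (.inl (j, k))) = p.2 ∧
      setReg j (setReg j p.1 p.2) (fun k => p.1 (.inl (j, k))) = p.1 := fun p =>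
    ⟨congrArg Prod.snd (hinv p), congrArg Prod.fst (hinv p)⟩
  rw [h1, ← Equiv.sum_comp hinv.toPerm, Fintype.sum_prod_type_right, Matrix.trace, Matrix.trace,
    Finset.sum_mul_sum]
  refine Finset.sum_congr rfl fun c _ => Finset.sum_congr rfl fun b _ => ?_
  obtain ⟨e₁, e₂⟩ := h2 (b, c)
  exact congrArg₂ (· * ·) (congrArg₂ σ e₁ e₁) (congrArg₂ X e₂ e₂)

theorem freshAnc_posSemidef (i : Fin a) {X : Op n s a} (hX : X.PosSemidef) :
    (freshAnc i X).PosSemidef := by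
  let f : Config n s a → ℂ := fun b => if b (.inr i) = 0 then 1 else 0
  have h : freshAnc i X = Matrix.vecMulVec f (star f) ⊙ ∑ x : Fin 2,
      X.submatrix (fun b => Function.update b (.inr i) x)
        fun b => Function.update b (.inr i) x := by
    ext b b'
    simp only [freshAnc, Matrix.hadamard_apply, Matrix.vecMulVec_apply, Pi.star_apply,
      Matrix.sum_apply, Matrix.submatrix_apply, f]
    split_ifs <;> simp_all
  rw [h]
  exact (Matrix.posSemidef_vecMulVec_self_star f).hadamard
    (Matrix.posSemidef_sum _ fun _ _ => hX.submatrix _)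

theorem trace_freshAnc (i : Fin a) (X : Op n s a) : (freshAnc i X).trace = X.trace := by
  have hinv : Function.Involutive fun p : Config n s a × Fin 2 =>
      (Function.update p.1 (.inr i) p.2, p.1 (.inr i)) := by
    rintro ⟨b, c⟩
    simp
  have h1 : (freshAnc i X).trace = ∑ p : Config n s a × Fin 2, if p.1 (.inr i) = 0 then
      X (Function.update p.1 (.inr i) p.2) (Function.update p.1 (.inr i) p.2) else 0 := by
    rw [Fintype.sum_prod_type]
    refine Finset.sum_congr rfl fun b _ => ?_
    simp only [Matrix.diag_apply, freshAnc, and_self]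
    split_ifs <;> simp
  rw [h1, ← Equiv.sum_comp hinv.toPerm, Fintype.sum_prod_type]
  refine Finset.sum_congr rfl fun b _ => ?_
  simp

end States

section Apply

variable {d K s a : ℕ} {φin φout : Fin (K + 1) → EuclideanSpace ℂ (Fin d)}

theorem Instr.apply_posSemidef (I : Instr K (numQubits d) s a) {X : Op (numQubits d) s a}
    (hX : X.PosSemidef) : (I.apply φin φout X).PosSemidef := by
  cases I with
  | gate1 w u => exact hX.mul_mul_conjTranspose_same _
  | gate2 w w' h u => exact hX.mul_mul_conjTranspose_same _
  | fresh i => exact freshAnc_posSemidef i hX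
  | loadIn j i => exact loadReg_posSemidef j (encodeOp_posSemidef (ketbra_posSemidef _)) hX
  | loadOut j i => exact loadReg_posSemidef j (encodeOp_posSemidef (ketbra_posSemidef _)) hX

theorem Instr.trace_apply (hin : ∀ i, ‖φin i‖ = 1) (hout : ∀ i, ‖φout i‖ = 1)
    (I : Instr K (numQubits d) s a) (X : Op (numQubits d) s a) :
    (I.apply φin φout X).trace = X.trace := by
  cases I with
  | gate1 w u => exact trace_conj_of_conjTranspose_mul_self (gate1Op_conjTranspose_mul_self w u) X
  | gate2 w w' h u =>
    exact trace_conj_of_conjTranspose_mul_self (gate2Op_conjTranspose_mul_self h u) X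
  | fresh i => exact trace_freshAnc i X
  | loadIn j i => 
    rw [Instr.apply, trace_loadReg, trace_encodeOp, trace_ketbra _ (hin i), one_mul]
  | loadOut j i => 
    rw [Instr.apply, trace_loadReg, trace_encodeOp, trace_ketbra _ (hout i), one_mul]

theorem runProg_posSemidef {m : ℕ} (p : Prog d K m) {X : Op (numQubits d) 1 (m + 1)}
    (hX : X.PosSemidef) : (runProg φin φout p X).PosSemidef := by
  induction p generalizing X with
  | nil => exact hX
  | cons I p ih => rw [runProg_cons]; exact ih (I.apply_posSemidef hX)

theorem trace_runProg {m : ℕ} (hin : ∀ i, ‖φin i‖ = 1) (hout : ∀ i, ‖φout i‖ = 1)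
    (p : Prog d K m) (X : Op (numQubits d) 1 (m + 1)) :
    (runProg φin φout p X).trace = X.trace := by
  induction p generalizing X with
  | nil => rfl
  | cons I p ih => rw [runProg_cons, ih, I.trace_apply hin hout]

end Apply

/-! ### The law of one run -/

section Law

variable {n m : ℕ}

/-- The unnormalized state of the main register if the kickback ancilla is found in `b` and the
records are found in `x`. -/
def outcomeState (X : Op n 1 (m + 1)) (b : Fin 2) (x : Fin m → Fin 2) :
    Matrix (Fin n → Fin 2) (Fin n → Fin 2) ℂ :=
  ∑ r, X.submatrix (fun u => cfg u r b x) fun u => cfg u r b x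

theorem outcomeState_posSemidef {X : Op n 1 (m + 1)} (hX : X.PosSemidef) (b : Fin 2)
    (x : Fin m → Fin 2) : (outcomeState X b x).PosSemidef :=
  Matrix.posSemidef_sum _ fun _ _ => hX.submatrix _

theorem sum_outcomeState (X : Op n 1 (m + 1)) (x : Fin m → Fin 2) :
    ∑ b, outcomeState X b x = reduced X x x := by
  ext u v
  simp only [outcomeState, reduced_apply, Matrix.sum_apply, Matrix.submatrix_apply]
  exact Finset.sum_comm

/-- The basis labels of the wires, as tuples. -/
def cfgEquiv : (Fin m → Fin 2) × (Fin n → Fin 2) × (Fin n → Fin 2) × Fin 2 ≃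
    Config n 1 (m + 1) where
  toFun p := cfg p.2.1 p.2.2.1 p.2.2.2 p.1
  invFun c := (fun t => c (.inr t.succ), fun k => c (.inl (0, k)), fun k => c (.inl (1, k)),
    c (.inr 0))
  left_inv _ := rfl
  right_inv c := (eq_cfg c).symm

theorem sum_config {M : Type*} [AddCommMonoid M] (f : Config n 1 (m + 1) → M) :
    ∑ c, f c = ∑ x, ∑ u, ∑ r, ∑ b, f (cfg u r b x) := by
  rw [← Equiv.sum_comp cfgEquiv, Fintype.sum_prod_type]
  simp only [Fintype.sum_prod_type]
  rfl

theorem sum_trace_reduced (X : Op n 1 (m + 1)) : ∑ x, (reduced X x x).trace = X.trace :=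
  (sum_config fun c => X c c).symm

variable {d K : ℕ}

/-- The circuit that runs a program and returns `κ` times the value of the observable if all
records are found in `0`, and `0` otherwise. -/
abbrev Prog.circuit (p : Prog d K m) (κ : ℝ) : Circuit d K where
  s := 1
  a := m + 1
  instrs := p
  post o x := if ∀ t : Fin m, x t.succ = 0 then κ * o else 0

theorem effect_cfg (p : Prog d K m) (κ : ℝ) (v : (Fin (numQubits d) → Fin 2) → ℂ)
    (b₀ : Fin 2) (x₀ : Fin m → Fin 2) (u u' r r' : Fin (numQubits d) → Fin 2) (b b' : Fin 2)
    (x x' : Fin m → Fin 2) :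
    (p.circuit κ).effect v (Fin.cons b₀ x₀ : Fin (m + 1) → Fin 2) (cfg u r b x) (cfg u' r' b' x') =
      if r = r' ∧ (b = b₀ ∧ x = x₀) ∧ b' = b₀ ∧ x' = x₀ then v u * star (v u') else 0 := by
  have h1 : (∀ (j : Fin (1 + 1)) (k : Fin (numQubits d)), j ≠ 0 →
      cfg u r b x (.inl (j, k)) = cfg u' r' b' x' (.inl (j, k))) ↔ r = r' := by
    constructor
    · intro h; funext k; exact h 1 k one_ne_zero
    · rintro rfl j k hj
      simp [cfg, hj]
  have h2 : (∀ i : Fin (m + 1), cfg u r b x (.inr i) = (Fin.cons b₀ x₀ : Fin (m + 1) → Fin 2) i ∧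
      cfg u' r' b' x' (.inr i) = (Fin.cons b₀ x₀ : Fin (m + 1) → Fin 2) i) ↔
      (b = b₀ ∧ x = x₀) ∧ b' = b₀ ∧ x' = x₀ := by
    simp only [forall_and, Fin.forall_fin_succ, cfg_kick, cfg_record, Fin.cons_zero, Fin.cons_succ,
      funext_iff]
  exact if_congr (and_congr h1 h2) rfl rfl

theorem trace_effect_mul (p : Prog d K m) (κ : ℝ) (v : (Fin (numQubits d) → Fin 2) → ℂ)
    (b : Fin 2) (x : Fin m → Fin 2) (X : Op (numQubits d) 1 (m + 1)) :
    ((p.circuit κ).effect v (Fin.cons b x : Fin (m + 1) → Fin 2) * X).trace =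
      star v ⬝ᵥ (outcomeState X b x *ᵥ v) := by
  simp only [Matrix.trace, Matrix.diag_apply, Matrix.mul_apply]
  have h : ∀ f : Config (numQubits d) 1 (m + 1) → Config (numQubits d) 1 (m + 1) → ℂ,
      ∑ c, ∑ c', f c c' = ∑ x, ∑ u, ∑ r, ∑ b, ∑ x', ∑ u', ∑ r', ∑ b',
        f (cfg u r b x) (cfg u' r' b' x') := fun f => by
    rw [sum_config]; simp only [sum_config]
  refine (h _).trans ?_
  simp only [effect_cfg, ite_and, ite_mul, zero_mul, Finset.sum_ite_eq, Finset.sum_ite_eq',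
    Finset.mem_univ, if_true, Finset.sum_ite_irrel, Finset.sum_const_zero]
  simp only [dotProduct, Matrix.mulVec, outcomeState, Matrix.sum_apply, Matrix.submatrix_apply,
    Pi.star_apply, Finset.mul_sum, Finset.sum_mul]
  symm
  rw [Finset.sum_comm]
  refine Finset.sum_congr rfl fun u _ => ?_
  rw [Finset.sum_comm]
  exact Finset.sum_congr rfl fun r _ => Finset.sum_congr rfl fun u' _ => by ring

/-- The law of the result of one run, in terms of the outcome states. -/
theorem law_circuit (p : Prog d K m) (κ : ℝ) {O : Matrix (Fin d) (Fin d) ℂ} (hO : O.IsHermitian)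
    (φin φout : Fin (K + 1) → EuclideanSpace ℂ (Fin d)) (ρ : Matrix (Fin d) (Fin d) ℂ) :
    (p.circuit κ).law hO φin φout ρ =
      ∑ q : (Fin (numQubits d) → Fin 2) × Fin 2 × (Fin m → Fin 2),
        ENNReal.ofReal (star ((encodeOp_isHermitian hO).eigenvectorBasis q.1).ofLp ⬝ᵥ
          (outcomeState (runProg φin φout p ((p.circuit κ).initial ρ)) q.2.1 q.2.2 *ᵥ
            ((encodeOp_isHermitian hO).eigenvectorBasis q.1).ofLp)).re •
        Measure.dirac (if q.2.2 = 0 then κ * (encodeOp_isHermitian hO).eigenvalues q.1 else 0) := by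
  rw [Fintype.sum_prod_type, Circuit.law]
  refine Finset.sum_congr rfl fun e _ => ?_
  refine ((Fin.consEquiv fun _ => Fin 2).sum_comp _).symm.trans ?_
  refine Finset.sum_congr rfl fun q _ => ?_
  obtain ⟨b, x⟩ := q
  rw [← trace_effect_mul p κ]
  congr 2
  refine if_congr ?_ rfl rfl
  rw [funext_iff]
  rfl

theorem sum_dotProduct_eigenvectorBasis {ι : Type*} [Fintype ι] [DecidableEq ι] {H : Matrix ι ι ℂ}
    (hH : H.IsHermitian) (A : Matrix ι ι ℂ) :
    ∑ e, star (hH.eigenvectorBasis e).ofLp ⬝ᵥ (A *ᵥ (hH.eigenvectorBasis e).ofLp) = A.trace := by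
  have h : ∀ e, star (hH.eigenvectorBasis e).ofLp ⬝ᵥ (A *ᵥ (hH.eigenvectorBasis e).ofLp) =
      ((hH.eigenvectorUnitary : Matrix ι ι ℂ)ᴴ * (A * hH.eigenvectorUnitary)) e e := fun e => rfl
  simp only [h]
  change Matrix.trace _ = _
  rw [Matrix.trace_mul_comm, mul_assoc, ← Matrix.star_eq_conjTranspose,
    Matrix.mem_unitaryGroup_iff.mp hH.eigenvectorUnitary.2, mul_one]

/-- The expectation of a Hermitian matrix, evaluated in an eigenbasis. -/
theorem sum_eigenvalues_mul_dotProduct {ι : Type*} [Fintype ι] [DecidableEq ι] {H : Matrix ι ι ℂ}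
    (hH : H.IsHermitian) (A : Matrix ι ι ℂ) :
    ∑ e, (hH.eigenvalues e : ℂ) * (star (hH.eigenvectorBasis e).ofLp ⬝ᵥ
      (A *ᵥ (hH.eigenvectorBasis e).ofLp)) = (H * A).trace := by
  rw [← sum_dotProduct_eigenvectorBasis hH]
  refine Finset.sum_congr rfl fun e _ => ?_
  have h : star (hH.eigenvectorBasis e).ofLp ᵥ* H =
      (hH.eigenvalues e : ℂ) • star (hH.eigenvectorBasis e).ofLp := by
    have h' := Matrix.star_mulVec H (hH.eigenvectorBasis e).ofLp
    rw [hH.eq, hH.mulVec_eigenvectorBasis] at h'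
    rw [← h']
    ext i
    simp
  rw [← Matrix.mulVec_mulVec, Matrix.dotProduct_mulVec _ H, h, smul_dotProduct, smul_eq_mul]

theorem abs_eigenvalues_encodeOp_le {O : Matrix (Fin d) (Fin d) ℂ} (hO : O.IsHermitian)
    (e : Fin (numQubits d) → Fin 2) : |(encodeOp_isHermitian hO).eigenvalues e| ≤ opNorm O := by
  set v := ((encodeOp_isHermitian hO).eigenvectorBasis e).ofLp with hv
  set l := (encodeOp_isHermitian hO).eigenvalues e
  have h : encodeOp O *ᵥ v = (l : ℂ) • v := by
    have := (encodeOp_isHermitian hO).mulVec_eigenvectorBasis e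
    rw [this]; rfl
  by_cases hl : l = 0
  · rw [hl, abs_zero]; exact opNorm_nonneg O
  set w := (encodeMatrix d)ᴴ *ᵥ v with hw
  have hOw : O *ᵥ w = (l : ℂ) • w := by
    rw [hw, ← Matrix.mulVec_smul, ← h, encodeOp, Matrix.mulVec_mulVec, Matrix.mulVec_mulVec,
      ← Matrix.mul_assoc, ← Matrix.mul_assoc, encodeMatrix_conjTranspose_mul_self, Matrix.one_mul]
  have hw0 : WithLp.toLp 2 w ≠ 0 := by
    intro h0
    have h0' : w = 0 := congrArg WithLp.ofLp h0
    have h1 : (l : ℂ) • v = 0 := by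
      rw [← h, encodeOp, ← Matrix.mulVec_mulVec, ← hw, h0', Matrix.mulVec_zero]
    have h2 : v = 0 := (smul_eq_zero.mp h1).resolve_left (by exact_mod_cast hl)
    have h3 := (encodeOp_isHermitian hO).eigenvectorBasis.orthonormal.1 e
    have h4 : (encodeOp_isHermitian hO).eigenvectorBasis e = 0 := by
      ext i; exact congrFun h2 i
    rw [h4, norm_zero] at h3
    exact zero_ne_one h3
  have hle := norm_mulVec_le O w
  rw [hOw, WithLp.toLp_smul, norm_smul, Complex.norm_real] at hle
  exact le_of_mul_le_mul_right hle (norm_pos_iff.mpr hw0)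

theorem initial_eq (p : Prog d K m) (κ : ℝ) (ρ : Matrix (Fin d) (Fin d) ℂ)
    (u u' r r' : Fin (numQubits d) → Fin 2) (b b' : Fin 2) (x x' : Fin m → Fin 2) :
    (p.circuit κ).initial ρ (cfg u r b x) (cfg u' r' b' x') =
      if ((r = 0 ∧ r' = 0) ∧ (b = 0 ∧ b' = 0) ∧ x = 0 ∧ x' = 0) then encodeOp ρ u u' else 0 := by
  have h1 : (∀ (j : Fin (1 + 1)) (k : Fin (numQubits d)), j ≠ 0 →
      cfg u r b x (.inl (j, k)) = 0 ∧ cfg u' r' b' x' (.inl (j, k)) = 0) ↔ r = 0 ∧ r' = 0 := by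
    constructor
    · intro h; exact ⟨funext fun k => (h 1 k one_ne_zero).1, funext fun k => (h 1 k one_ne_zero).2⟩
    · rintro ⟨rfl, rfl⟩ j k hj
      simp [cfg, hj]
  have h2 : (∀ i : Fin (m + 1), cfg u r b x (.inr i) = 0 ∧ cfg u' r' b' x' (.inr i) = 0) ↔
      (b = 0 ∧ b' = 0) ∧ x = 0 ∧ x' = 0 := by
    rw [Fin.forall_fin_succ]
    simp only [forall_and, cfg_kick, cfg_record, funext_iff, Pi.zero_apply]
  exact if_congr (and_congr h1 h2) rfl rfl

theorem reduced_initial (p : Prog d K m) (κ : ℝ) (ρ : Matrix (Fin d) (Fin d) ℂ)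
    (x y : Fin m → Fin 2) : reduced ((p.circuit κ).initial ρ) x y =
      if x = 0 ∧ y = 0 then encodeOp ρ else 0 := by
  ext u v
  simp only [reduced_apply, initial_eq, and_self, ite_and]
  split_ifs <;> simp

theorem initial_posSemidef (p : Prog d K m) (κ : ℝ) {ρ : Matrix (Fin d) (Fin d) ℂ}
    (hρ : ρ.PosSemidef) : Matrix.PosSemidef ((p.circuit κ).initial ρ) := by
  let P : Config (numQubits d) 1 (m + 1) → Prop := fun c =>
    (fun k => c (.inl (1, k))) = 0 ∧ c (.inr 0) = 0 ∧ (fun t : Fin m => c (.inr t.succ)) = 0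
  classical
  let f : Config (numQubits d) 1 (m + 1) → ℂ := fun c => if P c then 1 else 0
  have h : (p.circuit κ).initial ρ = Matrix.vecMulVec f (star f) ⊙
      (encodeOp ρ).submatrix (fun c k => c (.inl (0, k))) fun c k => c (.inl (0, k)) := by
    ext c c'
    have h1 : (p.circuit κ).initial ρ c c' = if P c ∧ P c' then
        encodeOp ρ (fun k => c (.inl (0, k))) (fun k => c' (.inl (0, k))) else 0 := by
      rw [eq_cfg c, eq_cfg c', initial_eq]
      refine if_congr ?_ rfl rfl
      simp only [P, cfg_second, cfg_kick, cfg_record]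
      tauto
    rw [h1, Matrix.hadamard_apply, Matrix.vecMulVec_apply, Pi.star_apply, Matrix.submatrix_apply]
    simp only [f]
    by_cases hc : P c <;> by_cases hc' : P c' <;>
      simp only [hc, hc', and_true, and_false, if_true, if_false, star_one, star_zero, mul_one,
        mul_zero, zero_mul, one_mul]
  rw [h]
  exact (Matrix.posSemidef_vecMulVec_self_star f).hadamard ((encodeOp_posSemidef hρ).submatrix _)

variable {φin φout : Fin (K + 1) → EuclideanSpace ℂ (Fin d)} {ρ : Matrix (Fin d) (Fin d) ℂ}
  {O : Matrix (Fin d) (Fin d) ℂ}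

theorem ae_law_circuit (p : Prog d K m) (κ : ℝ) (hO : O.IsHermitian) :
    ∀ᵐ y ∂(p.circuit κ).law hO φin φout ρ, |y| ≤ |κ| * opNorm O := by
  rw [law_circuit]
  refine ae_sum_smul _ _ fun q => ?_
  rw [ae_dirac_iff (measurableSet_le (by fun_prop) (by fun_prop))]
  split_ifs
  · rw [abs_mul]
    exact mul_le_mul_of_nonneg_left (abs_eigenvalues_encodeOp_le hO _) (abs_nonneg _)
  · rw [abs_zero]
    exact mul_nonneg (abs_nonneg _) (opNorm_nonneg _)

theorem ofReal_re_dotProduct {n : Type*} [Fintype n] {A : Matrix n n ℂ} (hA : A.PosSemidef)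
    (v : n → ℂ) : ((star v ⬝ᵥ (A *ᵥ v)).re : ℂ) = star v ⬝ᵥ (A *ᵥ v) ∧
      0 ≤ (star v ⬝ᵥ (A *ᵥ v)).re := by
  have h := hA.dotProduct_mulVec_nonneg v
  rw [Complex.le_def] at h
  exact ⟨Complex.ext rfl h.2, h.1⟩

theorem isProbabilityMeasure_law_circuit (hin : ∀ i, ‖φin i‖ = 1) (hout : ∀ i, ‖φout i‖ = 1)
    (hρ : IsDensity ρ) (p : Prog d K m) (κ : ℝ) (hO : O.IsHermitian) :
    IsProbabilityMeasure ((p.circuit κ).law hO φin φout ρ) := by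
  have hpsd := runProg_posSemidef (φin := φin) (φout := φout) p (initial_posSemidef p κ hρ.1)
  constructor
  rw [law_circuit, Measure.coe_finsetSum, Finset.sum_apply]
  simp only [Measure.smul_apply, measure_univ, smul_eq_mul, mul_one]
  rw [← ENNReal.ofReal_sum_of_nonneg fun q _ =>
    (ofReal_re_dotProduct (outcomeState_posSemidef hpsd _ _) _).2, ← Complex.re_sum,
    Fintype.sum_prod_type_right]
  simp only [sum_dotProduct_eigenvectorBasis]
  rw [Fintype.sum_prod_type_right]
  simp only [← Matrix.trace_sum, sum_outcomeState]
  rw [Matrix.trace_sum, sum_trace_reduced, trace_runProg hin hout, ← sum_trace_reduced]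
  simp only [reduced_initial, and_self]
  simp [apply_ite, trace_encodeOp, hρ.2]

theorem integral_law_circuit (hρ : IsDensity ρ) (p : Prog d K m) (κ : ℝ) (hO : O.IsHermitian) :
    ∫ y, y ∂(p.circuit κ).law hO φin φout ρ =
      κ * (encodeOp O * reduced (runProg φin φout p ((p.circuit κ).initial ρ)) 0 0).trace.re := by
  have hpsd := runProg_posSemidef (φin := φin) (φout := φout) p (initial_posSemidef p κ hρ.1)
  rw [law_circuit, integral_sum_smul (fun _ => ENNReal.ofReal_ne_top)
    fun _ => integrable_dirac (by simp)]
  simp only [integral_dirac]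
  rw [Fintype.sum_prod_type_right, Fintype.sum_prod_type_right, ← sum_outcomeState, Finset.mul_sum,
    Matrix.trace_sum, Complex.re_sum, Finset.mul_sum]
  rw [Finset.sum_eq_single (0 : Fin m → Fin 2)]
  rotate_left
  · intro x _ hx
    simp [hx]
  · simp
  refine Finset.sum_congr rfl fun b _ => ?_
  rw [← sum_eigenvalues_mul_dotProduct (encodeOp_isHermitian hO), Complex.re_sum, Finset.mul_sum]
  refine Finset.sum_congr rfl fun e _ => ?_
  have h := ofReal_re_dotProduct (outcomeState_posSemidef hpsd b 0)
    ((encodeOp_isHermitian hO).eigenvectorBasis e).ofLp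
  rw [ENNReal.toReal_ofReal h.2, if_pos rfl, Complex.re_ofReal_mul]
  ring

end Law

/-! ### Random circuits from signed mixtures -/

section RandomCircuits

variable {d K m : ℕ}

/-- The encoded state with all records in `0`. -/
def encodedState (m : ℕ) (ρ : Matrix (Fin d) (Fin d) ℂ) : BlockState (numQubits d) m :=
  fun x y => if x = 0 ∧ y = 0 then encodeOp ρ else 0

theorem Implements.exists_family {Φ : StateMap d K m} {γ : ℝ} {c g : ℕ}
    (h : Implements Φ γ c g) : ∃ (l : ℕ) (α : Fin l → ℝ) (p : Fin l → Prog d K m),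
      ∑ i, |α i| = γ ∧ (∀ i, copiesOf (p i) ≤ c) ∧ (∀ i, gatesOf (p i) ≤ g) ∧
      ∀ φin φout : Fin (K + 1) → EuclideanSpace ℂ (Fin d), (∀ i, ‖φin i‖ = 1) →
        (∀ i, ‖φout i‖ = 1) → ∀ X,
        ∑ i, (α i : ℂ) • reduced (runProg φin φout (p i) X) = Φ φin φout (reduced X) := by
  obtain ⟨L, h1, h2, h3⟩ := h
  refine ⟨L.length, fun i => L[i].1, fun i => L[i].2, ?_, fun i => (h2 _ (L.getElem_mem _)).1,
    fun i => (h2 _ (L.getElem_mem _)).2, fun φin φout hin hout X => ?_⟩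
  · rw [← h1]; exact Fin.sum_univ_fun_getElem L fun p => |p.1|
  · rw [← h3 φin φout hin hout X]
    exact Fin.sum_univ_fun_getElem L
      fun p : ℝ × Prog d K m => (p.1 : ℂ) • reduced (runProg φin φout p.2 X)

/-- A signed mixture of programs is turned into a random circuit: a program is drawn with
probability proportional to the modulus of its coefficient, and its sign and the normalization go
into the post-processing. -/
theorem Implements.exists_randomCircuit {Φ : StateMap d K m} {γ : ℝ} {c g : ℕ}
    (h : Implements Φ γ c g) (hγ : 0 < γ) :
    ∃ R : RandomCircuit d K, (∀ i, (R.circuit i).copies ≤ c) ∧ (∀ i, (R.circuit i).gates ≤ g) ∧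
      ∀ {O : Matrix (Fin d) (Fin d) ℂ} (hO : O.IsHermitian)
        {φin φout : Fin (K + 1) → EuclideanSpace ℂ (Fin d)}, (∀ i, ‖φin i‖ = 1) →
        (∀ i, ‖φout i‖ = 1) → ∀ {ρ : Matrix (Fin d) (Fin d) ℂ}, IsDensity ρ →
        IsProbabilityMeasure (R.law hO φin φout ρ) ∧
        (∀ᵐ y ∂(R.law hO φin φout ρ), |y| ≤ γ * opNorm O) ∧
        ∫ y, y ∂(R.law hO φin φout ρ) =
          (encodeOp O * Φ φin φout (encodedState m ρ) 0 0).trace.re := by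
  obtain ⟨l, α, p, h1, hc, hg, h3⟩ := h.exists_family
  have hw : ∀ i, 0 ≤ |α i| / γ := fun i => div_nonneg (abs_nonneg _) hγ.le
  have hp : ∑ i, ENNReal.ofReal (|α i| / γ) = 1 := by
    rw [← ENNReal.ofReal_sum_of_nonneg fun i _ => hw i, ← Finset.sum_div, h1,
      div_self hγ.ne', ENNReal.ofReal_one]
  set κ : Fin l → ℝ := fun i => γ * SignType.sign (α i) with hκ
  refine ⟨⟨Fin l, PMF.ofFintype _ hp, fun i => Prog.circuit (p i) (κ i)⟩, hc, hg, ?_⟩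
  intro O hO φin φout hin hout ρ hρ
  have hprob : ∀ i, IsProbabilityMeasure ((Prog.circuit (p i) (κ i)).law hO φin φout ρ) := fun i =>
    isProbabilityMeasure_law_circuit hin hout hρ _ _ hO
  have hae : ∀ i, ∀ᵐ y ∂(Prog.circuit (p i) (κ i)).law hO φin φout ρ, |y| ≤ γ * opNorm O := by
    intro i
    filter_upwards [ae_law_circuit (φin := φin) (φout := φout) (ρ := ρ) (p i) (κ i) hO] with y hy
    refine hy.trans (mul_le_mul_of_nonneg_right ?_ (opNorm_nonneg O))
    rw [hκ, abs_mul, abs_of_pos hγ]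
    refine mul_le_of_le_one_right hγ.le ?_
    rcases SignType.sign (α i) with _ | _ | _ <;> norm_num
  refine ⟨⟨?_⟩, ?_, ?_⟩
  · rw [RandomCircuit.law, Measure.coe_finsetSum, Finset.sum_apply]
    simp only [Measure.smul_apply, measure_univ, smul_eq_mul, mul_one, PMF.ofFintype_apply]
    exact hp
  · exact ae_sum_smul _ _ hae
  · have hint : ∀ i, Integrable (fun y : ℝ => y)
        ((Prog.circuit (p i) (κ i)).law hO φin φout ρ) := fun i =>
      Integrable.of_bound measurable_id.aestronglyMeasurable _ (by simpa using hae i)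
    refine (integral_sum_smul (fun _ => PMF.apply_ne_top _ _) hint).trans ?_
    let X : Op (numQubits d) 1 (m + 1) := (Prog.circuit ([] : Prog d K m) 0).initial ρ
    have hX : reduced X = encodedState m ρ := by
      funext x y; exact reduced_initial _ _ _ _ _
    have hterm : ∀ i, ((PMF.ofFintype _ hp) i).toReal *
        ∫ y, y ∂((Prog.circuit (p i) (κ i)).law hO φin φout ρ) =
        (encodeOp O * ((α i : ℂ) • reduced (runProg φin φout (p i) X)) 0 0).trace.re := by
      intro i
      rw [PMF.ofFintype_apply, ENNReal.toReal_ofReal (hw i), integral_law_circuit hρ]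
      have e : ∀ r : ℝ, |α i| / γ * (κ i * r) = α i * r := fun r => by
        conv_rhs => rw [← abs_mul_sign (α i)]
        simp only [hκ]
        field_simp
      refine (e _).trans ?_
      rw [Pi.smul_apply, Pi.smul_apply, Matrix.mul_smul, Matrix.trace_smul, smul_eq_mul,
        Complex.re_ofReal_mul]
      rfl
    refine (Finset.sum_congr rfl fun i _ => hterm i).trans ?_
    rw [← hX, ← h3 φin φout hin hout X, Finset.sum_apply, Finset.sum_apply, Finset.mul_sum,
      Matrix.trace_sum, Complex.re_sum]

end RandomCircuits

/-! ### The expectation of the protocol -/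

section Expectation

variable {d K : ℕ} {φin φout : Fin (K + 1) → EuclideanSpace ℂ (Fin d)}
  {U : Matrix (Fin d) (Fin d) ℂ}

theorem ketbra_of_ofLp_eq {v w : EuclideanSpace ℂ (Fin d)} (h : w.ofLp = U *ᵥ v.ofLp) :
    ketbra w = U * ketbra v * Uᴴ := by
  rw [ketbra, ketbra, h, Matrix.star_mulVec, Matrix.mul_vecMulVec, Matrix.vecMulVec_mul]

theorem norm_eq_one_of_ofLp_eq (hU : Uᴴ * U = 1) {v w : EuclideanSpace ℂ (Fin d)} (hv : ‖v‖ = 1)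
    (h : w.ofLp = U *ᵥ v.ofLp) : ‖w‖ = 1 := by
  have hn : ∀ v : EuclideanSpace ℂ (Fin d), ((‖v‖ ^ 2 : ℝ) : ℂ) =
      star v.ofLp ⬝ᵥ v.ofLp := fun v => by
    rw [dotProduct_comm, ← EuclideanSpace.inner_eq_star_dotProduct, Complex.ofReal_pow]
    exact (inner_self_eq_norm_sq_to_K v).symm
  have h1 : ‖w‖ ^ 2 = ‖v‖ ^ 2 := by
    rw [← Complex.ofReal_inj, hn, hn, h, Matrix.star_mulVec, ← Matrix.dotProduct_mulVec,
      Matrix.mulVec_mulVec, hU, Matrix.one_mulVec]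
  rw [hv] at h1
  nlinarith [norm_nonneg w]

theorem returnOp_src_mul_encodeMatrix (ks : List (Fin (K + 1))) :
    returnOp (src φin φout false) ks * encodeMatrix d =
      encodeMatrix d * returnOp (fun k => ketbra (φin k)) ks := by
  have h : ∀ k, src φin φout false k * encodeMatrix d = encodeMatrix d * ketbra (φin k) := fun k =>
    mul_encodeMatrix_of_encodeOp _
  induction ks with
  | nil => exact h 0
  | cons k ks ih =>
    simp only [returnOp, Matrix.add_mul, Matrix.mul_add, Matrix.mul_assoc, Matrix.sub_mul,
      Matrix.mul_sub, Matrix.one_mul, Matrix.mul_one, Matrix.smul_mul, Matrix.mul_smul, h, ih]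
    simp only [← Matrix.mul_assoc, h, ih]

theorem src_conjTranspose (o : Bool) (k : Fin (K + 1)) :
    (src φin φout o k)ᴴ = src φin φout o k := by
  rw [src, encodeOp_conjTranspose, ketbra_conjTranspose]

/-- A run of the protocol that ends with all records in `0` applies the unknown unitary to the
compressed state. -/
theorem trace_encodeOp_mul_protocol (hU : Uᴴ * U = 1) (hin : ∀ i, ‖φin i‖ = 1)
    (hout : ∀ i, (φout i).ofLp = U *ᵥ (φin i).ofLp) (O ρ : Matrix (Fin d) (Fin d) ℂ) {M : ℕ}
    (ks : List (Fin (K + 1))) (hks : ks.length ≤ M) :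
    (encodeOp O * protocol (src φin φout false) (src φin φout true) ks
      (encodedState (M + 1) ρ) 0 0).trace =
    (Uᴴ * O * U * (returnOp (fun k => ketbra (φin k)) ks * ρ *
      returnOp (fun k => ketbra (φin k)) ks)).trace := by
  have hout' : ∀ i, ‖φout i‖ = 1 := fun i => norm_eq_one_of_ofLp_eq hU (hin i) (hout i)
  have hket : ∀ k, ketbra (φout k) = U * ketbra (φin k) * Uᴴ := fun k => ketbra_of_ofLp_eq (hout k)
  set G := returnOp (fun k => ketbra (φin k)) ks with hG
  have hGE := returnOp_src_mul_encodeMatrix (φin := φin) (φout := φout) ks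
  have hGE' : (encodeMatrix d)ᴴ * returnOp (src φin φout false) ks = G * (encodeMatrix d)ᴴ := by
    have := congrArg Matrix.conjTranspose hGE
    rwa [Matrix.conjTranspose_mul, Matrix.conjTranspose_mul,
      returnOp_conjTranspose (src_conjTranspose false),
      returnOp_conjTranspose fun k => ketbra_conjTranspose (φin k)] at this
  rw [protocol_apply (W := encodeOp U) (src_conjTranspose false) (src_conjTranspose true) ?_
    (src_mul_self hin hout' true 0) ?_ ks hks]
  · have h0 : encodedState (M + 1) ρ 0 0 = encodeOp ρ := if_pos ⟨rfl, rfl⟩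
    have h1 : returnOp (src φin φout false) ks * encodeOp ρ * returnOp (src φin φout false) ks =
        encodeOp (G * ρ * G) := by
      rw [encodeOp, encodeOp, ← Matrix.mul_assoc, ← Matrix.mul_assoc, hGE, Matrix.mul_assoc _ _ᴴ,
        hGE']
      simp only [Matrix.mul_assoc, hG]
    rw [h0, h1, encodeOp_conjTranspose, encodeOp_mul, encodeOp_mul, encodeOp_mul, trace_encodeOp,
      ← mul_assoc O, Matrix.trace_mul_comm]
    simp only [mul_assoc]
  · rintro x y ⟨s, -, hs⟩
    exact if_neg fun h => hs (congrFun h.1 s)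
  · rintro x y ⟨s, -, hs⟩
    exact if_neg fun h => hs (congrFun h.2 s)
  · exact fun _ _ => rfl
  · exact fun _ _ => rfl
  · intro k
    simp only [src, encodeOp_mul, cond_true, cond_false]
    rw [hket, mul_assoc _ Uᴴ, hU, mul_one]
  · intro Z
    have h1 : src φin φout false 0 * Z * src φin φout false 0 =
        encodeOp ((ketbra (φin 0) * ((encodeMatrix d)ᴴ * Z * encodeMatrix d)).trace •
          ketbra (φin 0)) := by
      rw [← ketbra_mul_mul_ketbra]
      simp only [src, encodeOp, cond_false, Matrix.mul_assoc]
    rw [h1, trace_encodeOp, Matrix.trace_smul, trace_ketbra _ (hin 0), smul_eq_mul, mul_one,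
      encodeOp_conjTranspose, encodeOp_mul, encodeOp_mul, src, cond_true, hket, ← encodeOp_smul,
      mul_smul_comm, smul_mul_assoc]

/-- The average of the protocol over the random walk with `T` steps. -/
def protocolAvg (d K T : ℕ) : StateMap d K (T + 1) :=
  walkAvg K T fun ks φin φout => protocol (src φin φout false) (src φin φout true) ks

/-- The bias of the estimate. -/
theorem abs_trace_protocolAvg_sub_le (hU : Uᴴ * U = 1) (hin : ∀ i, ‖φin i‖ = 1)
    (hout : ∀ i, (φout i).ofLp = U *ᵥ (φin i).ofLp) (O : Matrix (Fin d) (Fin d) ℂ)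
    {ρ : Matrix (Fin d) (Fin d) ℂ} (hρ : IsDensity ρ) (hsupp : ρ ∈ operatorsOn (inputSpace φin))
    (T : ℕ) :
    |(encodeOp O * protocolAvg d K T φin φout (encodedState (T + 1) ρ) 0 0).trace.re -
        (O * U * ρ * Uᴴ).trace.re| ≤
      3 * opNorm O * (((1 + lambdaPerp φin) / 2) ^ T *
        √(Module.finrank ℂ (inputSpace φin))) := by
  let f : StateMap d K (T + 1) →ₗ[ℂ] ℂ :=
    { toFun := fun Φ => (encodeOp O * Φ φin φout (encodedState (T + 1) ρ) 0 0).trace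
      map_add' := fun Φ Ψ => by
        simp only [Pi.add_apply, LinearMap.add_apply, Matrix.mul_add, Matrix.trace_add]
      map_smul' := fun c Φ => by
        simp only [Pi.smul_apply, LinearMap.smul_apply, Matrix.mul_smul, Matrix.trace_smul,
          RingHom.id_apply] }
  have h1 : (encodeOp O * protocolAvg d K T φin φout (encodedState (T + 1) ρ) 0 0).trace =
      walkAvg K T fun ks => (Uᴴ * O * U * (returnOp (fun k => ketbra (φin k)) ks * ρ *
        returnOp (fun k => ketbra (φin k)) ks)).trace :=
    (map_walkAvg f T _).trans (walkAvg_congr fun ks hks =>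
      trace_encodeOp_mul_protocol hU hin hout O ρ ks hks.le)
  have h2 : (O * U * ρ * Uᴴ).trace = (Uᴴ * O * U * ρ).trace := by
    rw [Matrix.trace_mul_comm]; simp only [mul_assoc]
  have hU1 : opNorm U ≤ 1 := opNorm_le_one_of_conjTranspose_mul_self hU
  have h3 : opNorm (Uᴴ * O * U) ≤ opNorm O :=
    calc opNorm (Uᴴ * O * U) ≤ opNorm (Uᴴ * O) * opNorm U := opNorm_mul_le _ _
      _ ≤ opNorm (Uᴴ * O) := mul_le_of_le_one_right (opNorm_nonneg _) hU1
      _ ≤ opNorm Uᴴ * opNorm O := opNorm_mul_le _ _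
      _ ≤ opNorm O := by
        rw [opNorm_conjTranspose]; exact mul_le_of_le_one_left (opNorm_nonneg _) hU1
  rw [h1, h2, ← Complex.sub_re]
  refine (Complex.abs_re_le_norm _).trans
    ((norm_trace_sub_walkAvg_le hin hρ hsupp (Uᴴ * O * U) T).trans ?_)
  have := lambdaPerp_nonneg hin
  gcongr

theorem implements_protocolAvg {L : ℕ} (hL : 3 ≤ L) (d K T : ℕ) :
    Implements (protocolAvg d K T) ((rotationWeight (Real.pi / L) ^ L) ^ (4 * T + 2))
      ((4 * T + 2) * (L * 2) + 1) ((4 * T + 2) * (L * (24 * numQubits d + 4) + 2)) :=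
  Implements.walkAvg fun ks hks => by
    have h := implements_protocol (d := d) (K := K) (M := T) hL ks
    rwa [hks] at h

end Expectation

/-! ### Estimates -/

section Estimates

theorem RandomCircuit.one_sub_le_successProb {d K : ℕ} (R : RandomCircuit d K)
    {O : Matrix (Fin d) (Fin d) ℂ} (hO : O.IsHermitian)
    {φin φout : Fin (K + 1) → EuclideanSpace ℂ (Fin d)} {ρ : Matrix (Fin d) (Fin d) ℂ}
    (hprob : IsProbabilityMeasure (R.law hO φin φout ρ)) {B ε δ t : ℝ}
    (hB : ∀ᵐ y ∂(R.law hO φin φout ρ), |y| ≤ B) (hε : 0 < ε) {N : ℕ} (hN : 0 < N)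
    (ht : |(∫ y, y ∂(R.law hO φin φout ρ)) - t| ≤ ε / 2) (hNB : 4 * B ^ 2 ≤ δ * ε ^ 2 * N) :
    1 - δ ≤ R.successProb N hO φin φout ρ ε t :=
  one_sub_le_pi_real_abs_sub_le hB hε hN ht hNB

theorem numQubits_le_log {d : ℕ} (hd : 2 ≤ d) : (numQubits d : ℝ) ≤ 3 * Real.log d := by
  have hn : 0 < numQubits d := Nat.clog_pos Nat.one_lt_two hd
  have h1 : 2 ^ (numQubits d - 1) ≤ d := (Nat.pow_pred_clog_lt_self Nat.one_lt_two hd).le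
  have hd' : (2 : ℝ) ≤ d := by exact_mod_cast hd
  have h2 : ((numQubits d - 1 : ℕ) : ℝ) * Real.log 2 ≤ Real.log d := by
    rw [← Real.log_pow]
    exact Real.log_le_log (by positivity) (by exact_mod_cast h1)
  have h3 : Real.log 2 ≤ Real.log d := Real.log_le_log two_pos hd'
  rw [Nat.cast_sub hn, Nat.cast_one] at h2
  have h4 := Real.log_two_gt_d9
  have h5 : (1 : ℝ) ≤ numQubits d := by exact_mod_cast hn
  nlinarith

/-- The total weight of the signed mixture stays bounded when the number of rotations is
proportional to the length of the walk: there are `O(T²)` rotations of weight `1 + O(T⁻²)`. -/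
theorem rotationWeight_pow_le {T : ℕ} (hT : 0 < T) :
    (rotationWeight (Real.pi / (3 * T : ℕ)) ^ (3 * T)) ^ (4 * T + 2) ≤
      Real.exp (12 * Real.pi ^ 2) ∧
    1 ≤ (rotationWeight (Real.pi / (3 * T : ℕ)) ^ (3 * T)) ^ (4 * T + 2) := by
  have hT' : (1 : ℝ) ≤ T := by exact_mod_cast hT
  set θ := Real.pi / (3 * T : ℕ) with hθ
  have hpi := Real.pi_pos
  have h0 : 0 ≤ θ := by positivity
  have h1 : θ ≤ Real.pi / 3 := by
    rw [hθ]; push_cast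
    gcongr
    linarith
  have hcos : 0 < Real.cos θ := Real.cos_pos_of_mem_Ioo ⟨by linarith, by linarith⟩
  have hone := one_le_rotationWeight hcos
  refine ⟨?_, one_le_pow₀ (one_le_pow₀ hone)⟩
  rw [← pow_mul]
  calc rotationWeight θ ^ (3 * T * (4 * T + 2)) ≤ Real.exp (6 * θ ^ 2) ^ (3 * T * (4 * T + 2)) := by
        refine pow_le_pow_left₀ (by linarith) ((rotationWeight_le h0 h1).trans ?_) _
        have := Real.add_one_le_exp (6 * θ ^ 2)
        linarith
    _ = Real.exp ((3 * T * (4 * T + 2) : ℕ) * (6 * θ ^ 2)) := by rw [← Real.exp_nat_mul]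
    _ ≤ Real.exp (12 * Real.pi ^ 2) := by
        refine Real.exp_le_exp.mpr ?_
        have hθT : θ ^ 2 * (T : ℝ) ^ 2 = Real.pi ^ 2 / 9 := by
          rw [hθ]; push_cast; field_simp; ring
        have h2 : θ ^ 2 * T ≤ θ ^ 2 * (T : ℝ) ^ 2 := by
          refine mul_le_mul_of_nonneg_left ?_ (sq_nonneg _)
          nlinarith
        push_cast
        nlinarith

/-- The length of the walk that makes the bias at most `ε / 2`. -/
def walkLength (Λ x : ℝ) : ℕ := ⌈5 * ((1 - Λ)⁻¹ * max 1 (Real.log x))⌉₊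

theorem walkLength_pos {Λ : ℝ} (hΛ : Λ < 1) (x : ℝ) : 0 < walkLength Λ x := by
  have : 0 < 1 - Λ := by linarith
  exact Nat.ceil_pos.mpr (by positivity)

theorem walkLength_le {Λ : ℝ} (h0 : 0 ≤ Λ) (h1 : Λ < 1) (x : ℝ) :
    (walkLength Λ x : ℝ) ≤ 6 * ((1 - Λ)⁻¹ * max 1 (Real.log x)) := by
  have hpos : 0 < 1 - Λ := by linarith
  have h2 : 1 ≤ (1 - Λ)⁻¹ := (one_le_inv₀ hpos).mpr (by linarith)
  have h3 : 1 ≤ (1 - Λ)⁻¹ * max 1 (Real.log x) :=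
    one_le_mul_of_one_le_of_one_le h2 (le_max_left _ _)
  have h4 := (Nat.ceil_lt_add_one (a := 5 * ((1 - Λ)⁻¹ * max 1 (Real.log x))) (by positivity)).le
  rw [walkLength]
  linarith

/-- With `m = max 1 (log x)`, the walk contributes a factor `exp (-5m/2)`, of which `exp (m/2)` is
lost to `√x` and the rest is at most `exp (-2) ≤ 1/6`. -/
theorem bias_le {Λ l o ε : ℝ} {D : ℕ} (h1 : Λ < 1) (hl0 : 0 ≤ l) (hl : l ≤ Λ) (ho : 0 ≤ o)
    (hε : 0 < ε) :
    3 * o * (((1 + l) / 2) ^ walkLength Λ (o ^ 2 * D / ε ^ 2) * √(D : ℝ)) ≤ ε / 2 := by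
  set x := o ^ 2 * D / ε ^ 2 with hx
  set m := max 1 (Real.log x) with hm
  have hpos : 0 < 1 - Λ := by linarith
  have hm1 : 1 ≤ m := le_max_left _ _
  have hx0 : 0 ≤ x := by positivity
  have hoD : o * √(D : ℝ) ≤ ε * Real.exp (m / 2) := by
    have e : o * √(D : ℝ) = ε * √x := by
      rw [hx, Real.sqrt_div (by positivity), Real.sqrt_mul (by positivity), Real.sqrt_sq ho,
        Real.sqrt_sq hε.le]
      field_simp
    rw [e]
    refine mul_le_mul_of_nonneg_left ?_ hε.le
    rw [Real.sqrt_le_left (Real.exp_pos _).le, ← Real.exp_nat_mul]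
    rcases hx0.eq_or_lt with h | h
    · rw [← h]; exact (Real.exp_pos _).le
    · refine (Real.log_le_iff_le_exp h).mp ((le_max_right 1 _).trans (le_of_eq ?_))
      push_cast; ring
  have hq : ((1 + l) / 2) ^ walkLength Λ x ≤ Real.exp (-(5 / 2 * m)) := by
    have h2 : (1 + l) / 2 ≤ Real.exp (-((1 - Λ) / 2)) := by
      have := Real.add_one_le_exp (-((1 - Λ) / 2))
      linarith
    refine (pow_le_pow_left₀ (by linarith) h2 _).trans ?_
    rw [← Real.exp_nat_mul]
    refine Real.exp_le_exp.mpr ?_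
    have h3 : 5 * ((1 - Λ)⁻¹ * m) ≤ walkLength Λ x := Nat.le_ceil _
    have h4 : 5 * ((1 - Λ)⁻¹ * m) * ((1 - Λ) / 2) = 5 / 2 * m := by field_simp
    have h5 := mul_le_mul_of_nonneg_right h3 (by linarith : 0 ≤ (1 - Λ) / 2)
    linarith
  have h6 : 6 * Real.exp (-2) ≤ 1 := by
    rw [Real.exp_neg, ← div_eq_mul_inv, div_le_one (Real.exp_pos _)]
    have : Real.exp 2 = Real.exp 1 ^ 2 := by rw [← Real.exp_nat_mul]; norm_num
    rw [this]
    nlinarith [Real.exp_one_gt_d9]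
  calc 3 * o * (((1 + l) / 2) ^ walkLength Λ x * √(D : ℝ))
      = 3 * (((1 + l) / 2) ^ walkLength Λ x) * (o * √(D : ℝ)) := by ring
    _ ≤ 3 * Real.exp (-(5 / 2 * m)) * (ε * Real.exp (m / 2)) := by gcongr
    _ = 3 * ε * Real.exp (-(2 * m)) := by
        rw [show -(2 * m) = -(5 / 2 * m) + m / 2 by ring, Real.exp_add]; ring
    _ ≤ 3 * ε * Real.exp (-2) := by gcongr; linarith
    _ ≤ ε / 2 := by nlinarith

/-- The number of shots, for a universal bound `B` on the weight of the signed mixture. -/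
def shotCount (B δ y : ℝ) : ℕ := ⌈4 * B ^ 2 / δ * y⌉₊ + 1

theorem shotCount_le {B δ y : ℝ} (hδ : 0 < δ) (hy : 0 ≤ y) :
    (shotCount B δ y : ℝ) ≤ (4 * B ^ 2 / δ + 2) * max 1 y := by
  have h := (Nat.ceil_lt_add_one (a := 4 * B ^ 2 / δ * y) (by positivity)).le
  have h1 : 4 * B ^ 2 / δ * y ≤ 4 * B ^ 2 / δ * max 1 y :=
    mul_le_mul_of_nonneg_left (le_max_right _ _) (by positivity)
  have h2 : 1 ≤ max 1 y := le_max_left _ _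
  rw [shotCount]
  push_cast
  linarith

theorem le_shotCount {B γ δ o ε : ℝ} (hγ : 0 ≤ γ) (hγB : γ ≤ B) (hδ : 0 < δ) (hε : 0 < ε) :
    4 * (γ * o) ^ 2 ≤ δ * ε ^ 2 * shotCount B δ (o ^ 2 / ε ^ 2) := by
  have h : 4 * B ^ 2 / δ * (o ^ 2 / ε ^ 2) ≤ shotCount B δ (o ^ 2 / ε ^ 2) := by
    rw [shotCount]
    push_cast
    have := Nat.le_ceil (4 * B ^ 2 / δ * (o ^ 2 / ε ^ 2))
    linarith
  calc 4 * (γ * o) ^ 2 = 4 * γ ^ 2 * o ^ 2 := by ring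
    _ ≤ 4 * B ^ 2 * o ^ 2 := by gcongr
    _ = δ * ε ^ 2 * (4 * B ^ 2 / δ * (o ^ 2 / ε ^ 2)) := by field_simp
    _ ≤ _ := by gcongr

theorem mul_comm_of_le_one {d : ℕ} (hd : d ≤ 1) (A B : Matrix (Fin d) (Fin d) ℂ) :
    A * B = B * A := by
  have : Subsingleton (Fin d) := Fin.subsingleton_iff_le_one.mpr hd
  ext i j
  simp only [Matrix.mul_apply]
  refine Finset.sum_congr rfl fun k _ => ?_
  rw [Subsingleton.elim k i, Subsingleton.elim j i, mul_comm]

end Estimates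

end

end UQE


theorem theoremS4 :
    -- the parameter `λ_⊥` lies in `[0, 1)` as soon as the condition for emulation holds
    (∀ (d K : ℕ) (φ : Fin (K + 1) → EuclideanSpace ℂ (Fin d)), (∀ i, ‖φ i‖ = 1) →
      UQE.GeneratesFullAlgebra φ → 0 ≤ UQE.lambdaPerp φ ∧ UQE.lambdaPerp φ < 1) ∧
    ∃ C : ℝ, 0 < C ∧ ∀ δ : ℝ, 0 < δ → δ < 1 → ∃ C' : ℝ, 0 < C' ∧
      ∀ (d K deff : ℕ) (Λ : ℝ), 0 ≤ Λ → Λ < 1 → ∀ ε : ℝ, 0 < ε →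
      ∀ (O : Matrix (Fin d) (Fin d) ℂ) (hO : O.IsHermitian),
      ∃ (T N : ℕ) (R : UQE.RandomCircuit d K),
        (T : ℝ) ≤ C * ((1 - Λ)⁻¹ * max 1 (Real.log (UQE.opNorm O ^ 2 * deff / ε ^ 2))) ∧
        (∀ i, ((R.circuit i).copies : ℝ) ≤ C * (T : ℝ) ^ 2) ∧
        (∀ i, ((R.circuit i).gates : ℝ) ≤ C * ((T : ℝ) ^ 2 * Real.log d)) ∧
        (N : ℝ) ≤ C' * max 1 (UQE.opNorm O ^ 2 / ε ^ 2) ∧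
        ∀ (U : Matrix (Fin d) (Fin d) ℂ), U ∈ Matrix.unitaryGroup (Fin d) ℂ →
        ∀ (φin φout : Fin (K + 1) → EuclideanSpace ℂ (Fin d)),
          (∀ i, ‖φin i‖ = 1) → (∀ i, (φout i).ofLp = U *ᵥ (φin i).ofLp) →
          UQE.GeneratesFullAlgebra φin →
          Module.finrank ℂ (UQE.inputSpace φin) = deff →
          UQE.lambdaPerp φin ≤ Λ →
        ∀ ρ : Matrix (Fin d) (Fin d) ℂ, UQE.IsDensity ρ →
          ρ ∈ UQE.operatorsOn (UQE.inputSpace φin) →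
          1 - δ ≤ R.successProb N hO φin φout ρ ε (O * U * ρ * Uᴴ).trace.re := by
  refine ⟨fun d K φ hφ hgen => ⟨UQE.lambdaPerp_nonneg hφ, UQE.lambdaPerp_lt_one hφ hgen⟩,
    1548, by norm_num, fun δ hδ _ => ?_⟩
  -- the universal bound on the weight of the signed mixture
  set B := Real.exp (12 * Real.pi ^ 2) with hB
  have hB1 : 1 ≤ B := Real.one_le_exp (by positivity)
  refine ⟨4 * B ^ 2 / δ + 2, by positivity, fun d K deff Λ hΛ0 hΛ1 ε hε O hO => ?_⟩
  have hN := UQE.shotCount_le (B := B) hδ (by positivity : 0 ≤ UQE.opNorm O ^ 2 / ε ^ 2)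
  have hN0 : 0 < UQE.shotCount B δ (UQE.opNorm O ^ 2 / ε ^ 2) := Nat.succ_pos _
  have hm : 0 < (1 - Λ)⁻¹ * max 1 (Real.log (UQE.opNorm O ^ 2 * deff / ε ^ 2)) :=
    mul_pos (inv_pos.mpr (by linarith)) (lt_max_of_lt_left one_pos)
  by_cases hd : d ≤ 1
  · -- In dimension at most one all matrices commute, and nothing has to be done.
    obtain ⟨R, hc, hg, hR⟩ := (UQE.Implements.one (d := d) (K := K) (m := 0)).exists_randomCircuit
      one_pos
    refine ⟨0, _, R, ?_, fun i => ?_, fun i => ?_, hN, ?_⟩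
    · rw [Nat.cast_zero]; positivity
    · rw [Nat.le_zero.mp (hc i)]; simp
    · rw [Nat.le_zero.mp (hg i)]; simp
    intro U hU φin φout hin hout _ _ _ ρ hρ _
    have hUU : Uᴴ * U = 1 := Matrix.mem_unitaryGroup_iff'.mp hU
    obtain ⟨h1, h2, h3⟩ := hR hO hin
      (fun i => UQE.norm_eq_one_of_ofLp_eq hUU (hin i) (hout i)) hρ
    refine R.one_sub_le_successProb hO h1 h2 hε hN0 ?_
      (UQE.le_shotCount zero_le_one hB1 hδ hε)
    have e : (UQE.encodeOp O * UQE.encodedState 0 ρ 0 0).trace = (O * U * ρ * Uᴴ).trace := by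
      rw [UQE.encodedState, if_pos ⟨rfl, rfl⟩, UQE.encodeOp_mul, UQE.trace_encodeOp, mul_assoc O U,
        UQE.mul_comm_of_le_one hd U ρ, mul_assoc, mul_assoc,
        show U * Uᴴ = 1 from Matrix.mem_unitaryGroup_iff.mp hU, mul_one]
    rw [h3]
    change |(UQE.encodeOp O * UQE.encodedState 0 ρ 0 0).trace.re - _| ≤ _
    rw [e, sub_self, abs_zero]
    positivity
  · have hd2 : 2 ≤ d := by omega
    set T := UQE.walkLength Λ (UQE.opNorm O ^ 2 * deff / ε ^ 2) with hT
    have hT0 : 0 < T := UQE.walkLength_pos hΛ1 _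
    have hT1 : (1 : ℝ) ≤ T := by exact_mod_cast hT0
    obtain ⟨hγB, hγ1⟩ := UQE.rotationWeight_pow_le hT0
    set γ := (UQE.rotationWeight (Real.pi / (3 * T : ℕ)) ^ (3 * T)) ^ (4 * T + 2) with hγ
    obtain ⟨R, hc, hg, hR⟩ := (UQE.implements_protocolAvg (L := 3 * T) (by omega) d K
      T).exists_randomCircuit (by linarith)
    refine ⟨T, _, R, ?_, fun i => ?_, fun i => ?_, hN, ?_⟩
    · have := UQE.walkLength_le hΛ0 hΛ1 (UQE.opNorm O ^ 2 * deff / ε ^ 2)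
      linarith
    · have h : ((R.circuit i).copies : ℝ) ≤ (4 * T + 2) * (3 * T * 2) + 1 := by exact_mod_cast hc i
      nlinarith
    · -- `1548 = 516 * 3`: at most `516 T²` gates for each of at most `3 log d` qubits
      have h : ((R.circuit i).gates : ℝ) ≤
          (4 * T + 2) * (3 * T * (24 * UQE.numQubits d + 4) + 2) := by exact_mod_cast hg i
      have hn1 : (1 : ℝ) ≤ UQE.numQubits d := by
        exact_mod_cast Nat.clog_pos Nat.one_lt_two hd2
      have hn := UQE.numQubits_le_log hd2
      have h1 : (4 * T + 2 : ℝ) ≤ 6 * T := by linarith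
      have h2 : (3 * T * (24 * UQE.numQubits d + 4) + 2 : ℝ) ≤ 86 * (T * UQE.numQubits d) := by
        nlinarith
      calc ((R.circuit i).gates : ℝ) ≤ _ := h
        _ ≤ 6 * T * (86 * (T * UQE.numQubits d)) := by gcongr
        _ = 516 * (T : ℝ) ^ 2 * UQE.numQubits d := by ring
        _ ≤ 516 * (T : ℝ) ^ 2 * (3 * Real.log d) := by gcongr
        _ = _ := by ring
    intro U hU φin φout hin hout _ hdim hl ρ hρ hsupp
    have hUU : Uᴴ * U = 1 := Matrix.mem_unitaryGroup_iff'.mp hU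
    obtain ⟨h1, h2, h3⟩ := hR hO hin
      (fun i => UQE.norm_eq_one_of_ofLp_eq hUU (hin i) (hout i)) hρ
    refine R.one_sub_le_successProb hO h1 h2 hε hN0 ?_
      (UQE.le_shotCount (by linarith) hγB hδ hε)
    rw [h3]
    refine (UQE.abs_trace_protocolAvg_sub_le hUU hin hout O hρ hsupp T).trans ?_
    rw [hdim]
    exact UQE.bias_le hΛ1 (UQE.lambdaPerp_nonneg hin) hl (UQE.opNorm_nonneg O) hε
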